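/- **Setting.** Let $d>4$ be an integer. Fix constants $\epsilon,c_1,c_2,\eta>0$, $C\in\mathbb R$, $\alpha\in(0,1)$ and functions $K\mapsto C_e(K),\,C_g(K),\,L_1(K)$ of $K>1$. For $L>0$ put $\beta=L^{-d}$. Consider a function $D$ on $\mathbb Z^d$ and real-valued functions $f_n(k;z)$ $(n\ge 0)$, $g_n(k;z)$, $e_n(k;z)$ $(n\ge1)$ of $k\in[-\pi,\pi]^d$ and $z>0$ (all may depend on $L$) with $f_0=1$ and $$f_{n+1}(k;z)=\sum_{m=1}^{n+1}g_m(k;z)f_{n+1-m}(k;z)+e_{n+1}(k;z)\qquad(n\ge0).$$ Write $\hat D(k)=\sum_{x}D(x)e^{ik\cdot x}$, $a(k)=1-\hat D(k)$, $\sigma^2=-\nabla^2\hat D(0)$ and $\|h\|_1=(2\pi)^{-d}\int_{[-\pi,\pi]^d}|h(k)|\,dk$; $\nabla^2$ is the Laplacian in $k$. Assume the following. *Assumption S.* For every $n$ and $z>0$, $f_n(\cdot;z)$, $g_n(\cdot;z)$ and $e_n(\cdot;z)$ are invariant under sign changes of single components and under permutations of the components of $k$; $f_n(\cdot;z)$ and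 $g_n(\cdot;z)$ are $C^2$ near $k=0$; and for each $n$, $|f_n(k;z)|$ is bounded uniformly in $k\in[-\pi,\pi]^d$ and $z$ in some neighbourhood of $1$. *Assumption D.* $D\ge0$, $\sum_xD(x)=1$, $\sum_x|x|^{2+2\epsilon}D(x)<\infty$, $f_1(k;z)=z\hat D(k)$, $e_1(k;z)=0$, $\|D\|_\infty\le CL^{-d}$, $\sigma^2\le CL^2$, and, for $k\in[-\pi,\pi]^d$: $c_1L^2|k|^2\le a(k)\le c_2L^2|k|^2$ if $\|k\|_\infty\le L^{-1}$; $a(k)>\eta$ if $\|k\|_\infty\ge L^{-1}$; and $a(k)<2-\eta$ always. *Bounds.* For $K>0$, say that (F$_K$) holds at $(m,z)$ if $$\|\hat D^2f_m(\cdot;z)\|_1\le K\beta m^{-d/2},\qquad |f_m(0;z)|\le K,\qquad |\nabla^2f_m(0;z)|\le K\sigma^2m;$$ that (E$_K$) holds at $(m,z)$ if, for all $k\in[-\pi,\pi]^d$, $$|e_m(k;z)|\le C_e(K)\beta m^{-d/2},\qquad |e_m(k;z)-e_m(0;z)|\le C_e(K)a(k)\beta m^{-(d-2)/2};$$ and that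 (G$_K$) holds at $(m,z)$ if $g_m(0;\cdot)$ is differentiable at $z$ and, for all $k\in[-\pi,\pi]^d$ and $\epsilon'\in[0,\epsilon]$, $$|g_m(k;z)|\le C_g(K)\beta m^{-d/2},\quad |\nabla^2g_m(0;z)|\le C_g(K)\sigma^2\beta m^{-(d-2)/2},\quad |\partial_zg_m(0;z)|\le C_g(K)\beta m^{-(d-2)/2},$$ $$|g_m(k;z)-g_m(0;z)-a(k)\sigma^{-2}\nabla^2g_m(0;z)|\le C_g(K)\beta\,a(k)^{1+\epsilon'}m^{-(d-2-2\epsilon')/2}.$$ *Assumptions E and G.* For every $K>1$ with $L\ge L_1(K)$, every $n$ and every non-degenerate interval $I\subset[1-\alpha,1+\alpha]$: if (F$_K$) holds for all $z\in I$ and $1\le m\le n$, then (E$_K$) and (G$_K$) hold for all $z\in I$ and $2\le m\le n+1$. *Critical value.* Let $z_0=1$ and $z_{n+1}=1-\sum_{m=2}^{n+1}g_m(0;z_n)$ for $n\ge0$ (so $z_1=1$). The critical value of the recursion is $z_c=\lim_{n\to\infty}z_n$. **Theorem.** There is $L_0$, depending only on $d,\epsilon,C,c_1,c_2,\eta,\alpha$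 and the functions $C_e,C_g,L_1$, such that for every $L\ge L_0$ and all $D,f,g,e$ satisfying the recursion and Assumptions S, D, E, G for this $L$, the limit $z_c$ exists, and the following holds. Suppose that there is $p_c>0$ such that the susceptibility $\chi(z)=\sum_{n=0}^\infty f_n(0;z)$ converges and is positive for $z\in(0,p_c)$, with $\lim_{z\uparrow p_c}\chi(z)=\infty$. Suppose also that, for every $K>1$ with $L\ge L_1(K)$, if (F$_K$) holds at $z=z_c$ for all $m\ge1$, then (E$_K$) and (G$_K$) hold for all $m\ge2$ and all $z\in(0,z_c]$. Then $z_c=p_c$. -/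

import Mathlib

open Filter Topology MeasureTheory
open scoped ENNReal

noncomputable section

namespace LaceRec

/-- The dual space `ℝ^d`, with the Euclidean norm. -/
abbrev Dual (d : ℕ) : Type := EuclideanSpace ℝ (Fin d)

/-- The cube `[-π, π]^d`. -/
def cube (d : ℕ) : Set (Dual d) := {k | ∀ i, |k i| ≤ Real.pi}

/-- The Fourier transform `∑_x D(x) exp(i k·x)` of a function `D` on `ℤ^d`. -/
def fourier {d : ℕ} (D : (Fin d → ℤ) → ℝ) (k : Dual d) : ℂ :=
  ∑' x : Fin d → ℤ, (D x : ℂ) * Complex.exp (Complex.I * ((∑ i, k i * (x i : ℝ) : ℝ) : ℂ))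

/-- The (real) Fourier transform of the step distribution. Under `AssumptionD` the full Fourier
transform is real, being equal to `f 1 k 1`, so that nothing is lost in taking the real part. -/
def Dhat {d : ℕ} (D : (Fin d → ℤ) → ℝ) (k : Dual d) : ℝ := (fourier D k).re

/-- `a(k) = 1 - D̂(k)`. -/
def a {d : ℕ} (D : (Fin d → ℤ) → ℝ) (k : Dual d) : ℝ := 1 - Dhat D k

/-- The Laplacian `∇² h(0)` at the origin. -/
def lapZero {d : ℕ} (h : Dual d → ℝ) : ℝ := Laplacian.laplacian h (0 : Dual d)

/-- `σ² = -∇² D̂(0)`. -/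
def sigmaSq {d : ℕ} (D : (Fin d → ℤ) → ℝ) : ℝ := -lapZero (Dhat D)

/-- `β = L^{-d}`. -/
def beta (d : ℕ) (L : ℝ) : ℝ := (L ^ d)⁻¹

/-- `‖h‖₁ = (2π)^{-d} ∫_{[-π,π]^d} |h(k)| dk`, as an extended non-negative number. -/
def normOne {d : ℕ} (h : Dual d → ℝ) : ℝ≥0∞ :=
  ENNReal.ofReal (((2 * Real.pi) ^ d)⁻¹) * ∫⁻ k in cube d, ‖h k‖ₑ

/-- Invariance on the cube under sign changes of a component and permutations of components. -/
def LatticeSymmetric {d : ℕ} (h : Dual d → ℝ) : Prop :=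
  ∀ k ∈ cube d,
    (∀ i : Fin d, h (WithLp.toLp 2 (Function.update k.ofLp i (-(k i)))) = h k) ∧
    (∀ π : Equiv.Perm (Fin d), h (WithLp.toLp 2 (fun i => k (π i))) = h k)

/-- The recursion relation
`f_{n+1}(k;z) = ∑_{m=1}^{n+1} g_m(k;z) f_{n+1-m}(k;z) + e_{n+1}(k;z)`, with `f_0 = 1`. -/
def Recursion {d : ℕ} (f g e : ℕ → Dual d → ℝ → ℝ) : Prop :=
  ∀ z : ℝ, 0 < z → ∀ k ∈ cube d,
    f 0 k z = 1 ∧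
    ∀ n : ℕ, f (n + 1) k z =
      (∑ m ∈ Finset.Icc 1 (n + 1), g m k z * f (n + 1 - m) k z) + e (n + 1) k z

/-- Lattice symmetry, a weak boundedness of `f_n`, and the regularity at `k = 0` that gives
a meaning to `∇² f_n(0;z)` and `∇² g_n(0;z)`. -/
structure AssumptionS {d : ℕ} (f g e : ℕ → Dual d → ℝ → ℝ) : Prop where
  symm_f : ∀ n : ℕ, ∀ z : ℝ, 0 < z → LatticeSymmetric (fun k => f n k z)
  symm_g : ∀ n : ℕ, 1 ≤ n → ∀ z : ℝ, 0 < z → LatticeSymmetric (fun k => g n k z)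
  symm_e : ∀ n : ℕ, 1 ≤ n → ∀ z : ℝ, 0 < z → LatticeSymmetric (fun k => e n k z)
  bounded : ∀ n : ℕ, ∃ U ∈ 𝓝 (1 : ℝ), ∃ B : ℝ, ∀ z ∈ U, ∀ k ∈ cube d, |f n k z| ≤ B
  smooth_f : ∀ n : ℕ, ∀ z : ℝ, 0 < z → ContDiffAt ℝ 2 (fun k => f n k z) 0
  smooth_g : ∀ n : ℕ, 1 ≤ n → ∀ z : ℝ, 0 < z → ContDiffAt ℝ 2 (fun k => g n k z) 0

/-- The assumption on the step distribution `D = D_L`, with moment exponent `ε` and constants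
`C, c₁, c₂, η`. -/
structure AssumptionD {d : ℕ} (ε C c₁ c₂ η L : ℝ) (D : (Fin d → ℤ) → ℝ)
    (f e : ℕ → Dual d → ℝ → ℝ) : Prop where
  nonneg : ∀ x, 0 ≤ D x
  f_one : ∀ z : ℝ, 0 < z → ∀ k ∈ cube d, (f 1 k z : ℂ) = z * fourier D k
  e_one : ∀ z : ℝ, 0 < z → ∀ k ∈ cube d, e 1 k z = 0
  normalised : HasSum D 1
  moment : Summable fun x : Fin d → ℤ => (√(∑ i, (x i : ℝ) ^ 2)) ^ (2 + 2 * ε) * D x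
  sup_le : ∀ x, D x ≤ C * beta d L
  sigma_le : sigmaSq D ≤ C * L ^ 2
  small_k : ∀ k ∈ cube d, (∀ i, |k i| ≤ L⁻¹) →
    c₁ * L ^ 2 * ‖k‖ ^ 2 ≤ a D k ∧ a D k ≤ c₂ * L ^ 2 * ‖k‖ ^ 2
  large_k : ∀ k ∈ cube d, (∃ i, L⁻¹ ≤ |k i|) → η < a D k
  away_two : ∀ k ∈ cube d, a D k < 2 - η

/-- The bounds on `f_m(·;z)`, with constant `K`:
`‖D̂² f_m‖₁ ≤ K β m^{-d/2}`, `|f_m(0)| ≤ K`, `|∇² f_m(0)| ≤ K σ² m`. -/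
structure FBounds {d : ℕ} (L : ℝ) (D : (Fin d → ℤ) → ℝ) (f : ℕ → Dual d → ℝ → ℝ)
    (K : ℝ) (m : ℕ) (z : ℝ) : Prop where
  l1 : normOne (fun k => Dhat D k ^ 2 * f m k z) ≤
    ENNReal.ofReal (K * beta d L * (m : ℝ) ^ (-(d : ℝ) / 2))
  zero : |f m 0 z| ≤ K
  lap : |lapZero (fun k => f m k z)| ≤ K * sigmaSq D * m

/-- The bounds on `e_m(·;z)`, with constant `Ce`. -/
structure EBounds {d : ℕ} (L : ℝ) (D : (Fin d → ℤ) → ℝ) (e : ℕ → Dual d → ℝ → ℝ)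
    (Ce : ℝ) (m : ℕ) (z : ℝ) : Prop where
  sup : ∀ k ∈ cube d, |e m k z| ≤ Ce * beta d L * (m : ℝ) ^ (-(d : ℝ) / 2)
  diff : ∀ k ∈ cube d, |e m k z - e m 0 z| ≤
    Ce * a D k * beta d L * (m : ℝ) ^ (-((d : ℝ) - 2) / 2)

/-- The bounds on `g_m(·;z)`, with constant `Cg`. -/
structure GBounds {d : ℕ} (ε L : ℝ) (D : (Fin d → ℤ) → ℝ) (g : ℕ → Dual d → ℝ → ℝ)
    (Cg : ℝ) (m : ℕ) (z : ℝ) : Prop where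
  sup : ∀ k ∈ cube d, |g m k z| ≤ Cg * beta d L * (m : ℝ) ^ (-(d : ℝ) / 2)
  lap : |lapZero (fun k => g m k z)| ≤
    Cg * sigmaSq D * beta d L * (m : ℝ) ^ (-((d : ℝ) - 2) / 2)
  differentiable : DifferentiableAt ℝ (fun w => g m 0 w) z
  deriv_le : |deriv (fun w => g m 0 w) z| ≤
    Cg * beta d L * (m : ℝ) ^ (-((d : ℝ) - 2) / 2)
  taylor : ∀ ε' ∈ Set.Icc 0 ε, ∀ k ∈ cube d,
    |g m k z - g m 0 z - a D k * (sigmaSq D)⁻¹ * lapZero (fun k => g m k z)| ≤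
      Cg * beta d L * a D k ^ (1 + ε') * (m : ℝ) ^ (-((d : ℝ) - 2 - 2 * ε') / 2)

/-- For every `K > 1` with `L ≥ L₁(K)`: if, for some `n` and some interval `I ⊆ [1-α, 1+α]`,
the `f`-bounds with constant `K` hold for `z ∈ I` and `1 ≤ m ≤ n`, then the `e`-bounds with
constant `Ce(K)` hold for `z ∈ I` and `2 ≤ m ≤ n + 1`. -/
def AssumptionE {d : ℕ} (α : ℝ) (Ce L₁ : ℝ → ℝ) (L : ℝ) (D : (Fin d → ℤ) → ℝ)
    (f e : ℕ → Dual d → ℝ → ℝ) : Prop :=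
  ∀ K : ℝ, 1 < K → L₁ K ≤ L → ∀ n : ℕ, ∀ I : Set ℝ, I.OrdConnected → I.Nontrivial →
    I ⊆ Set.Icc (1 - α) (1 + α) →
    (∀ z ∈ I, ∀ m ∈ Finset.Icc 1 n, FBounds L D f K m z) →
    ∀ z ∈ I, ∀ m ∈ Finset.Icc 2 (n + 1), EBounds L D e (Ce K) m z

/-- The same for `g`, with constant `Cg(K)`. -/
def AssumptionG {d : ℕ} (α ε : ℝ) (Cg L₁ : ℝ → ℝ) (L : ℝ) (D : (Fin d → ℤ) → ℝ)
    (f g : ℕ → Dual d → ℝ → ℝ) : Prop :=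
  ∀ K : ℝ, 1 < K → L₁ K ≤ L → ∀ n : ℕ, ∀ I : Set ℝ, I.OrdConnected → I.Nontrivial →
    I ⊆ Set.Icc (1 - α) (1 + α) →
    (∀ z ∈ I, ∀ m ∈ Finset.Icc 1 n, FBounds L D f K m z) →
    ∀ z ∈ I, ∀ m ∈ Finset.Icc 2 (n + 1), GBounds ε L D g (Cg K) m z

/-- The sequence `z_0 = z_1 = 1`, `z_{n+1} = 1 - ∑_{m=2}^{n+1} g_m(0; z_n)`. -/
def zSeq {d : ℕ} (g : ℕ → Dual d → ℝ → ℝ) : ℕ → ℝ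
  | 0 => 1
  | n + 1 => 1 - ∑ m ∈ Finset.Icc 2 (n + 1), g m 0 (zSeq g n)

/-- `zc` is the critical value of the recursion relation: the limit of the `z_n`. -/
def IsCriticalValue {d : ℕ} (g : ℕ → Dual d → ℝ → ℝ) (zc : ℝ) : Prop :=
  Tendsto (zSeq g) atTop (𝓝 zc)

/-- The susceptibility series `∑_{n ≥ 0} f_n(0;z)` converges (as a limit of partial sums) with
value `s`. -/
def HasSusceptibility {d : ℕ} (f : ℕ → Dual d → ℝ → ℝ) (z s : ℝ) : Prop :=
  Tendsto (fun N : ℕ => ∑ n ∈ Finset.range N, f n 0 z) atTop (𝓝 s)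

/-- For every `K > 1` with `L ≥ L₁(K)`: if the `f`-bounds with constant `K` hold for `z = zc` and
all `m ≥ 1`, then the `e`- and `g`-bounds with constants `Ce(K)`, `Cg(K)` hold for all `m ≥ 2`,
uniformly in the (positive) parameters `z ≤ zc`. -/
def UniformEG {d : ℕ} (ε : ℝ) (Ce Cg L₁ : ℝ → ℝ) (L : ℝ) (D : (Fin d → ℤ) → ℝ)
    (f g e : ℕ → Dual d → ℝ → ℝ) (zc : ℝ) : Prop :=
  ∀ K : ℝ, 1 < K → L₁ K ≤ L → (∀ m : ℕ, 1 ≤ m → FBounds L D f K m zc) →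
    ∀ z ∈ Set.Ioc 0 zc, ∀ m : ℕ, 2 ≤ m →
      EBounds L D e (Ce K) m z ∧ GBounds ε L D g (Cg K) m z

end LaceRec

end

/-! Fix `k` and `z`, put θ = d/2 ≥ 5/2, and let F, G, S be the generating functions of f_n, g_n and
of the source (1 at n = 0, then e_n). The recursion is the renewal equation (1 - G)F = S. Where a(k)
is bounded below, G is a contraction and f_n = O(n^{-θ}) by comparison with a supersolution
(`exists_abs_renewal_le_of_contraction`). Where a(k) is small, G has mass 1 - κ up to a small error,
with κ comparable to a(k). Abel summation gives 1 - G = κ + (1 - X)H with H nearly constant, and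
inverting this bounds the Green function q = 1/(1 - G) by a multiple of (1 + xn)^{-(θ-1)}, with x
proportional to κ. Applying X d/dX twice improves the decay to `greenTail`, whose integral over the
relevant ball of `k` is O(β n^{-d/2}) (`exists_abs_renewal_le`, `exists_lintegral_greenTail_le`).
With Parseval for large a(k) and second differences for the Laplacian, this yields the f-bounds
(`exists_fBounds`).

The constant K obtained there depends only on d, C, c₁, η: of e_m and g_m only smallness is used. So
K is fixed first, C_e(K) and C_g(K) are then just numbers, and a large L makes their products with β
small. The induction closes on shrinking nested intervals around z_n: f-bounds up to n give e- and
g-bounds up to n + 1, which give the f-bounds up to n + 1 on the next interval (`induction_bounds`).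
The intervals shrink to z_c, where the g_m(0; z_c) sum to 1 (`exists_criticalValue`).

Summing the recursion at k = 0 gives χ(z)(1 - ∑ g_m(0;z)) = 1 + ∑ e_m(0;z), which lies in [1/2,
3/2]. If z_c < p_c, the left side vanishes at z_c. If z_c > p_c, then 1 - ∑ g_m(0;z) ≥ (z_c - z)/2
keeps χ bounded below p_c. Both are impossible (`criticalValue_eq`). -/

noncomputable section

namespace LaceRec

/-! ### Polynomial weights, their convolutions, and a comparison principle. -/

section Weights

open Finset

/-- The polynomially decaying weight `(1 + x n)^{-s}`. -/
def wt (s x : ℝ) (n : ℕ) : ℝ := (1 + x * n) ^ (-s)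

lemma one_add_mul_pos {x : ℝ} (hx : 0 ≤ x) (n : ℕ) : 0 < 1 + x * (n : ℝ) := by positivity

lemma wt_pos (s : ℝ) {x : ℝ} (hx : 0 ≤ x) (n : ℕ) : 0 < wt s x n :=
  Real.rpow_pos_of_pos (one_add_mul_pos hx n) _

@[simp] lemma wt_zero_right (s x : ℝ) : wt s x 0 = 1 := by simp [wt]

lemma wt_le_one {s x : ℝ} (hs : 0 ≤ s) (hx : 0 ≤ x) (n : ℕ) : wt s x n ≤ 1 :=
  Real.rpow_le_one_of_one_le_of_nonpos (by nlinarith [mul_nonneg hx n.cast_nonneg (α := ℝ)])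
    (by linarith)

lemma wt_anti_param {s x y : ℝ} (hs : 0 ≤ s) (hx : 0 ≤ x) (hxy : x ≤ y) (n : ℕ) :
    wt s y n ≤ wt s x n :=
  Real.rpow_le_rpow_of_nonpos (one_add_mul_pos hx n) (by gcongr) (by linarith)

lemma wt_anti_exponent {s t x : ℝ} (hst : s ≤ t) (hx : 0 ≤ x) (n : ℕ) :
    wt t x n ≤ wt s x n :=
  Real.rpow_le_rpow_of_exponent_le
    (by nlinarith [mul_nonneg hx n.cast_nonneg (α := ℝ)]) (by linarith)

/-- In a convolution over j + i = n one index is at least n/2, so its weight can be replaced by the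
weight at n. -/
lemma wt_le_of_le_two_mul {s x : ℝ} (hs : 0 ≤ s) (hx : 0 ≤ x) {i n : ℕ} (h : n ≤ 2 * i) :
    wt s x i ≤ 2 ^ s * wt s x n := by
  have h1 : (1 + x * (n : ℝ)) / 2 ≤ 1 + x * (i : ℝ) := by
    have : (n : ℝ) ≤ 2 * i := by exact_mod_cast h
    nlinarith
  have h2 := one_add_mul_pos hx n
  calc wt s x i ≤ ((1 + x * (n : ℝ)) / 2) ^ (-s) :=
        Real.rpow_le_rpow_of_nonpos (by positivity) h1 (by linarith)
    _ = 2 ^ s * wt s x n := by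
        rw [Real.div_rpow h2.le (by norm_num), Real.rpow_neg (by norm_num : (0:ℝ) ≤ 2), wt]
        field_simp

/-- The ratio (1 + yn)/(1 + xn) is nondecreasing in n when x ≤ y. This lets the weight at n be
charged to the smaller parameter x. -/
lemma wt_exchange {s x y : ℝ} (hs : 0 ≤ s) (hx : 0 ≤ x) (hxy : x ≤ y) {i n : ℕ} (h : i ≤ n) :
    wt s y n * wt s x i ≤ wt s x n * wt s y i := by
  have hy := hx.trans hxy
  have h1 := one_add_mul_pos hx n
  have h2 := one_add_mul_pos hx i
  have h3 := one_add_mul_pos hy n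
  have h4 := one_add_mul_pos hy i
  have h5 : (i : ℝ) ≤ n := by exact_mod_cast h
  unfold wt
  rw [← Real.mul_rpow h3.le h2.le, ← Real.mul_rpow h1.le h4.le]
  refine Real.rpow_le_rpow_of_nonpos (by positivity) ?_ (by linarith)
  nlinarith [mul_nonneg (sub_nonneg.2 hxy) (sub_nonneg.2 h5)]

lemma sum_antidiagonal_fst (φ : ℕ → ℝ) (n : ℕ) :
    ∑ p ∈ antidiagonal n, φ p.1 = ∑ j ∈ range (n + 1), φ j :=
  Nat.sum_antidiagonal_eq_sum_range_succ_mk (fun p : ℕ × ℕ => φ p.1) n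

lemma sum_antidiagonal_snd (φ : ℕ → ℝ) (n : ℕ) :
    ∑ p ∈ antidiagonal n, φ p.2 = ∑ j ∈ range (n + 1), φ j := by
  rw [← sum_antidiagonal_fst, ← Nat.sum_antidiagonal_swap]
  simp

/-- Convolution bound for the weights. -/
lemma sum_wt_mul_wt_le {s x y S : ℝ} (hs : 0 ≤ s) (hx : 0 ≤ x) (hxy : x ≤ y) (n : ℕ)
    (hS : ∑ j ∈ range (n + 1), wt s y j ≤ S) :
    ∑ p ∈ antidiagonal n, wt s y p.1 * wt s x p.2 ≤ 2 ^ s * (2 * S) * wt s x n := by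
  have hy := hx.trans hxy
  have hx' := fun n => (wt_pos s hx n).le
  have hy' := fun n => (wt_pos s hy n).le
  have key : ∀ p ∈ antidiagonal n, wt s y p.1 * wt s x p.2 ≤
      2 ^ s * wt s x n * (wt s y p.1 + wt s y p.2) := by
    rintro ⟨j, i⟩ hp
    rw [HasAntidiagonal.mem_antidiagonal] at hp
    simp only at hp ⊢
    have h2 : (0 : ℝ) < 2 ^ s := by positivity
    -- The larger index is moved to n. In both cases the factor left to be summed has parameter y,
    -- so only the mass S of that weight enters.
    rcases le_total j i with h | h
    · have := wt_le_of_le_two_mul hs hx (i := i) (n := n) (by omega)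
      calc _ ≤ wt s y j * (2 ^ s * wt s x n) := by gcongr; exact hy' j
        _ ≤ _ := by nlinarith [mul_nonneg h2.le (mul_nonneg (hx' n) (hy' i))]
    · have := wt_le_of_le_two_mul hs hy (i := j) (n := n) (by omega)
      have h3 := wt_exchange hs hx hxy (i := i) (n := n) (by omega)
      calc _ ≤ (2 ^ s * wt s y n) * wt s x i := by gcongr; exact hx' i
        _ ≤ _ := by nlinarith [mul_nonneg h2.le (mul_nonneg (hx' n) (hy' j))]
  refine (sum_le_sum key).trans ?_
  rw [← mul_sum, sum_add_distrib, sum_antidiagonal_fst, sum_antidiagonal_snd]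
  have : 0 ≤ 2 ^ s * wt s x n := mul_nonneg (by positivity) (hx' n)
  nlinarith

/-- Discrete integral comparison: after reducing to exponent 3/2, x times the weight at j + 1 is
dominated by the decrement of 2/√(1 + xj). Telescoping gives 2/x, and the term j = 0 adds 1 ≤ 1/x.
-/
lemma sum_wt_le {s x : ℝ} (hs : 3 / 2 ≤ s) (hx : 0 < x) (hx1 : x ≤ 1) (n : ℕ) :
    ∑ j ∈ range n, wt s x j ≤ 3 / x := by
  let φ : ℕ → ℝ := fun j => (√(1 + x * j))⁻¹
  have step : ∀ j : ℕ, x * wt s x (j + 1) ≤ 2 * (φ j - φ (j + 1)) := by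
    intro j
    have h1 : wt s x (j + 1) ≤ (√(1 + x * (j + 1 : ℕ)) ^ 3)⁻¹ := by
      refine (wt_anti_exponent hs hx.le _).trans (le_of_eq ?_)
      have := one_add_mul_pos hx.le (j + 1)
      rw [wt, Real.rpow_neg this.le, Real.sqrt_eq_rpow, ← Real.rpow_natCast,
        ← Real.rpow_mul this.le]
      norm_num
    have hu := one_add_mul_pos hx.le j
    have hv := one_add_mul_pos hx.le (j + 1)
    have hu2 := Real.sq_sqrt hu.le
    have hv2 := Real.sq_sqrt hv.le
    have hup := Real.sqrt_pos.2 hu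
    have hvp := Real.sqrt_pos.2 hv
    have huv : √(1 + x * (j : ℝ)) ≤ √(1 + x * ((j + 1 : ℕ) : ℝ)) :=
      Real.sqrt_le_sqrt (by push_cast; nlinarith)
    simp only [φ]
    set u := √(1 + x * (j : ℝ))
    set v := √(1 + x * ((j + 1 : ℕ) : ℝ))
    have hxuv : x = v ^ 2 - u ^ 2 := by rw [hu2, hv2]; push_cast; ring
    have h3 : x * (v ^ 3)⁻¹ ≤ 2 * (u⁻¹ - v⁻¹) := by
      have e1 : 2 * (u⁻¹ - v⁻¹) - x * (v ^ 3)⁻¹ =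
          (v - u) * (v - u) * (2 * v + u) / (u * v ^ 3) := by
        rw [hxuv]; field_simp; ring
      have : 0 ≤ (v - u) * (v - u) * (2 * v + u) / (u * v ^ 3) := by
        have := mul_self_nonneg (v - u)
        positivity
      linarith
    exact (mul_le_mul_of_nonneg_left h1 hx.le).trans h3
  have tel : ∀ n, x * ∑ j ∈ range n, wt s x (j + 1) ≤ 2 * (φ 0 - φ n) := by
    intro n
    induction n with
    | zero => simp
    | succ n ih => rw [sum_range_succ, mul_add]; linarith [step n]
  rw [le_div_iff₀ hx]
  cases n with
  | zero => simp
  | succ n =>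
    rw [sum_range_succ']
    have h1 := tel n
    have h2 : φ 0 = 1 := by simp [φ]
    have h3 : 0 ≤ φ n := by simp only [φ]; positivity
    simp only [wt_zero_right]
    nlinarith

/-- From 1 + x(n+1) ≤ (1 + x)(1 + xn) and (1 + x)^s ≤ e^{sx} ≤ 1/(1 - δ) ≤ 1 + 2δ. A shift by one
step thus costs a factor close to 1, which the mass defect pays for in the supersolutions below. -/
lemma wt_pred_le {s x δ : ℝ} (hs : 0 < s) (hx : 0 ≤ x) (hδ : s * x ≤ δ) (hδ1 : δ ≤ 1 / 2) (n : ℕ) :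
    wt s x n ≤ (1 + 2 * δ) * wt s x (n + 1) := by
  have h1 := one_add_mul_pos hx n
  have h2 := one_add_mul_pos hx (n + 1)
  have h3 : 1 + x * ((n + 1 : ℕ) : ℝ) ≤ (1 + x) * (1 + x * n) := by
    push_cast
    nlinarith [mul_nonneg (mul_nonneg hx hx) n.cast_nonneg (α := ℝ)]
  have h4 : (1 + x) ^ s ≤ 1 + 2 * δ := by
    have : (1 + x) ^ s ≤ Real.exp (s * x) := by
      rw [mul_comm, Real.exp_mul]
      exact Real.rpow_le_rpow (by linarith) (by linarith [Real.add_one_le_exp x]) hs.le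
    have h5 : 1 - s * x ≤ Real.exp (-(s * x)) := by linarith [Real.add_one_le_exp (-(s * x))]
    have h6 : Real.exp (s * x) * Real.exp (-(s * x)) = 1 := by rw [← Real.exp_add]; simp
    have h7 := Real.exp_pos (s * x)
    have h8 : Real.exp (s * x) * (1 - δ) ≤ 1 := by nlinarith
    have h9 : 1 ≤ (1 + 2 * δ) * (1 - δ) := by nlinarith [mul_nonneg hs.le hx]
    nlinarith
  have h10 : (1 + x * ((n + 1 : ℕ) : ℝ)) ^ s ≤ (1 + 2 * δ) * (1 + x * n) ^ s :=
    calc _ ≤ ((1 + x) * (1 + x * n)) ^ s := Real.rpow_le_rpow h2.le h3 hs.le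
      _ = (1 + x) ^ s * (1 + x * n) ^ s := Real.mul_rpow (by linarith) h1.le
      _ ≤ _ := by gcongr
  have h11 : 0 < (1 + x * (n : ℝ)) ^ s := by positivity
  have h12 : 0 < (1 + x * ((n + 1 : ℕ) : ℝ)) ^ s := by positivity
  unfold wt
  rw [Real.rpow_neg h1.le, Real.rpow_neg h2.le]
  rw [inv_le_iff_one_le_mul₀ h11]
  calc (1 : ℝ) = (1 + x * ((n + 1 : ℕ) : ℝ)) ^ s * ((1 + x * ((n + 1 : ℕ) : ℝ)) ^ s)⁻¹ := by
        field_simp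
    _ ≤ ((1 + 2 * δ) * (1 + x * n) ^ s) * ((1 + x * ((n + 1 : ℕ) : ℝ)) ^ s)⁻¹ := by gcongr
    _ = _ := by ring

/-- Comparison principle for renewal-type equations `c r_n = s_n + ∑ t_j r_{n-j}`. -/
lemma abs_le_of_supersolution {c : ℝ} (hc : 0 < c) {r s t σ τ w : ℕ → ℝ} {N : ℕ}
    (h : ∀ n ≤ N, c * r n = s n + ∑ p ∈ antidiagonal n, t p.1 * r p.2) (ht0 : t 0 = 0)
    (ht : ∀ j ≤ N, |t j| ≤ τ j) (hs : ∀ n ≤ N, |s n| ≤ σ n) (hw : ∀ n, 0 ≤ w n)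
    (hsup : ∀ n ≤ N, σ n + ∑ p ∈ antidiagonal n, τ p.1 * w p.2 ≤ c * w n) :
    ∀ n ≤ N, |r n| ≤ w n := by
  intro n
  induction n using Nat.strong_induction_on with
  | _ n ih =>
    intro hn
    have h1 : |∑ p ∈ antidiagonal n, t p.1 * r p.2| ≤ ∑ p ∈ antidiagonal n, τ p.1 * w p.2 := by
      refine (abs_sum_le_sum_abs _ _).trans (sum_le_sum ?_)
      rintro ⟨j, i⟩ hp
      rw [HasAntidiagonal.mem_antidiagonal] at hp
      simp only at hp ⊢
      rw [abs_mul]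
      -- The term j = 0 contains `r n` itself, out of reach of the induction hypothesis; it drops
      -- out because `t 0 = 0`.
      rcases Nat.eq_zero_or_pos j with rfl | hj
      · rw [ht0]; simpa using mul_nonneg ((abs_nonneg _).trans (ht 0 (by omega))) (hw i)
      · exact mul_le_mul (ht j (by omega)) (ih i (by omega) (by omega)) (abs_nonneg _)
          ((abs_nonneg _).trans (ht j (by omega)))
    have h2 : c * |r n| ≤ c * w n := by
      rw [← abs_of_pos hc, ← abs_mul, abs_of_pos hc, h n hn]
      exact (abs_add_le _ _).trans ((add_le_add (hs n hn) h1).trans (hsup n hn))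
    exact le_of_mul_le_mul_left h2 hc

end Weights

/-! ### Products and inverses of power series dominated by weights. -/

section PowerSeriesBounds

open Finset PowerSeries

/-- The constant in the convolution bound for weights with exponent `s`. -/
def convConst (s : ℝ) : ℝ := 2 ^ s * 6

lemma one_le_convConst {s : ℝ} (hs : 0 ≤ s) : 1 ≤ convConst s := by
  have : (1 : ℝ) ≤ 2 ^ s := Real.one_le_rpow (by norm_num) hs
  unfold convConst; linarith

/-- A first factor with parameter 1 has mass at most 3, so the constant is free of x. With equal
parameters, as in `sum_wt_mul_wt_self_le`, a factor 1/x is lost. -/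
lemma sum_wt_one_mul_wt_le {s x : ℝ} (hs : 3 / 2 ≤ s) (hx : 0 ≤ x) (hx1 : x ≤ 1) (n : ℕ) :
    ∑ p ∈ antidiagonal n, wt s 1 p.1 * wt s x p.2 ≤ convConst s * wt s x n := by
  have h := sum_wt_mul_wt_le (by linarith) hx hx1 n (sum_wt_le hs one_pos le_rfl (n + 1))
  refine h.trans (le_of_eq ?_)
  unfold convConst; ring

lemma sum_wt_mul_wt_self_le {s x : ℝ} (hs : 3 / 2 ≤ s) (hx : 0 < x) (hx1 : x ≤ 1) (n : ℕ) :
    ∑ p ∈ antidiagonal n, wt s x p.1 * wt s x p.2 ≤ convConst s / x * wt s x n := by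
  have h := sum_wt_mul_wt_le (by linarith) hx.le le_rfl n (sum_wt_le hs hx hx1 (n + 1))
  refine h.trans (le_of_eq ?_)
  unfold convConst; ring

lemma abs_coeff_mul_le {A B : PowerSeries ℝ} {α β : ℕ → ℝ} {N : ℕ}
    (hA : ∀ n ≤ N, |coeff n A| ≤ α n) (hB : ∀ n ≤ N, |coeff n B| ≤ β n) {n : ℕ} (hn : n ≤ N) :
    |coeff n (A * B)| ≤ ∑ p ∈ antidiagonal n, α p.1 * β p.2 := by
  rw [coeff_mul]
  refine (abs_sum_le_sum_abs _ _).trans (sum_le_sum ?_)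
  rintro ⟨j, i⟩ hp
  rw [HasAntidiagonal.mem_antidiagonal] at hp
  simp only at hp ⊢
  rw [abs_mul]
  exact mul_le_mul (hA j (by omega)) (hB i (by omega)) (abs_nonneg _)
    ((abs_nonneg _).trans (hA j (by omega)))

/-- Products of series dominated by weights, the first with parameter one. -/
lemma abs_coeff_mul_le_wt_one {A B : PowerSeries ℝ} {s x α β : ℝ} (hs : 3 / 2 ≤ s) (hx : 0 ≤ x)
    (hx1 : x ≤ 1) {N : ℕ} (hA : ∀ n ≤ N, |coeff n A| ≤ α * wt s 1 n)
    (hB : ∀ n ≤ N, |coeff n B| ≤ β * wt s x n) {n : ℕ} (hn : n ≤ N) :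
    |coeff n (A * B)| ≤ α * β * convConst s * wt s x n := by
  have hα : 0 ≤ α := by simpa using (abs_nonneg _).trans (hA 0 (Nat.zero_le _))
  have hβ : 0 ≤ β := by simpa using (abs_nonneg _).trans (hB 0 (Nat.zero_le _))
  refine (abs_coeff_mul_le hA hB hn).trans ?_
  calc _ = α * β * ∑ p ∈ antidiagonal n, wt s 1 p.1 * wt s x p.2 := by
        rw [mul_sum]; exact sum_congr rfl fun _ _ => by ring
    _ ≤ α * β * (convConst s * wt s x n) := by gcongr; exact sum_wt_one_mul_wt_le hs hx hx1 n
    _ = _ := by ring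

/-- Products of series dominated by weights with the same parameter. -/
lemma abs_coeff_mul_le_wt {A B : PowerSeries ℝ} {s x α β : ℝ} (hs : 3 / 2 ≤ s) (hx : 0 < x)
    (hx1 : x ≤ 1) {N : ℕ} (hA : ∀ n ≤ N, |coeff n A| ≤ α * wt s x n)
    (hB : ∀ n ≤ N, |coeff n B| ≤ β * wt s x n) {n : ℕ} (hn : n ≤ N) :
    |coeff n (A * B)| ≤ α * β * (convConst s / x) * wt s x n := by
  have hα : 0 ≤ α := by simpa using (abs_nonneg _).trans (hA 0 (Nat.zero_le _))
  have hβ : 0 ≤ β := by simpa using (abs_nonneg _).trans (hB 0 (Nat.zero_le _))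
  refine (abs_coeff_mul_le hA hB hn).trans ?_
  calc _ = α * β * ∑ p ∈ antidiagonal n, wt s x p.1 * wt s x p.2 := by
        rw [mul_sum]; exact sum_congr rfl fun _ _ => by ring
    _ ≤ α * β * (convConst s / x * wt s x n) := by
        gcongr; exact sum_wt_mul_wt_self_le hs hx hx1 n
    _ = _ := by ring

/-- Separating the constant term of the first factor in a product of power series. -/
lemma coeff_mul_split (A B : PowerSeries ℝ) (n : ℕ) :
    coeff n (A * B) = coeff 0 A * coeff n B +
      ∑ p ∈ antidiagonal n, (if p.1 = 0 then 0 else coeff p.1 A) * coeff p.2 B := by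
  rw [coeff_mul]
  have h0 : ((0, n) : ℕ × ℕ) ∈ antidiagonal n := by simp
  rw [← add_sum_erase _ _ h0, ← add_sum_erase (antidiagonal n)
    (fun p => (if p.1 = 0 then 0 else coeff p.1 A) * coeff p.2 B) h0]
  simp only [if_true, zero_mul, zero_add]
  congr 1
  refine sum_congr rfl ?_
  rintro ⟨j, i⟩ hp
  rw [mem_erase, HasAntidiagonal.mem_antidiagonal] at hp
  have : j ≠ 0 := by
    rintro rfl
    exact hp.1 (by simp only at hp; rw [← hp.2]; simp)
  simp [this]

/-- Inverse of a power series whose higher coefficients are small and decay polynomially. -/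
lemma abs_coeff_inverse_le {H P : PowerSeries ℝ} {s b : ℝ} (hs : 3 / 2 ≤ s) {N : ℕ}
    (hHP : H * P = 1) (h0 : 1 / 2 ≤ coeff 0 H) (hb0 : 0 ≤ b) (hb : 4 * b * convConst s ≤ 1)
    (hH : ∀ j ≤ N, 1 ≤ j → |coeff j H| ≤ b * wt s 1 j) :
    (∀ n ≤ N, |coeff n P| ≤ 2 * wt s 1 n) ∧
      ∀ n ≤ N, 1 ≤ n → |coeff n P| ≤ 4 * b * convConst s * wt s 1 n := by
  have hrec : ∀ n, coeff 0 H * coeff n P = coeff n (1 : PowerSeries ℝ) +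
      ∑ p ∈ antidiagonal n, (if p.1 = 0 then 0 else -coeff p.1 H) * coeff p.2 P := by
    intro n
    have h := coeff_mul_split H P n
    rw [hHP] at h
    have h2 : ∑ p ∈ antidiagonal n, (if p.1 = 0 then 0 else -coeff p.1 H) * coeff p.2 P =
        -∑ p ∈ antidiagonal n, (if p.1 = 0 then 0 else coeff p.1 H) * coeff p.2 P := by
      rw [← sum_neg_distrib]
      refine sum_congr rfl fun p _ => ?_
      split_ifs <;> simp
    rw [h2]; linarith
  have hpos : 0 < coeff 0 H := by linarith
  have hτ : ∀ j ≤ N, |if j = 0 then 0 else -coeff j H| ≤ b * wt s 1 j := by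
    intro j hj
    have := mul_nonneg hb0 (wt_pos s zero_le_one j).le
    split_ifs with h
    · simpa using this
    · rw [abs_neg]; exact hH j hj (by omega)
  have hconv : ∀ n, ∑ p ∈ antidiagonal n, (b * wt s 1 p.1) * (2 * wt s 1 p.2) ≤
      2 * b * convConst s * wt s 1 n := by
    intro n
    calc _ = 2 * b * ∑ p ∈ antidiagonal n, wt s 1 p.1 * wt s 1 p.2 := by
          rw [mul_sum]; exact sum_congr rfl fun _ _ => by ring
      _ ≤ 2 * b * (convConst s * wt s 1 n) := by
          gcongr; exact sum_wt_one_mul_wt_le hs zero_le_one le_rfl n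
      _ = _ := by ring
  have main : ∀ n ≤ N, |coeff n P| ≤ 2 * wt s 1 n := by
    refine abs_le_of_supersolution (σ := fun n => if n = 0 then 1 else 0)
      (s := fun n => coeff n (1 : PowerSeries ℝ))
      (t := fun j => if j = 0 then 0 else -coeff j H)
      (τ := fun j => if j = 0 then 0 else b * wt s 1 j)
      hpos (fun n _ => hrec n) (by simp)
      ?_ ?_ (fun n => mul_nonneg zero_le_two (wt_pos s zero_le_one n).le) ?_
    · intro j hj
      have := hτ j hj
      split_ifs at this ⊢ with h
      · simp
      · exact this
    · intro n _
      simp only [coeff_one]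
      split_ifs <;> simp
    · intro n _
      rcases Nat.eq_zero_or_pos n with rfl | hn0
      · simp [-coeff_zero_eq_constantCoeff]; linarith
      · have h1 : ∑ p ∈ antidiagonal n, (if p.1 = 0 then 0 else b * wt s 1 p.1) *
            (2 * wt s 1 p.2) ≤ 2 * b * convConst s * wt s 1 n := by
          refine le_trans (sum_le_sum fun p _ => ?_) (hconv n)
          have h2 := wt_pos s zero_le_one p.1
          have h3 := wt_pos s zero_le_one p.2
          split_ifs
          · rw [zero_mul]; positivity
          · exact le_rfl
        have := wt_pos s zero_le_one n
        rw [if_neg hn0.ne', zero_add]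
        nlinarith
  -- The first bound is fed back into the recursion: for n ≥ 1 the source vanishes, and every
  -- remaining term carries a factor b.
  refine ⟨main, fun n hn hn1 => ?_⟩
  have h1 : |∑ p ∈ antidiagonal n, (if p.1 = 0 then 0 else -coeff p.1 H) * coeff p.2 P| ≤
      2 * b * convConst s * wt s 1 n := by
    refine le_trans ((abs_sum_le_sum_abs _ _).trans (sum_le_sum ?_)) (hconv n)
    rintro ⟨j, i⟩ hp
    rw [HasAntidiagonal.mem_antidiagonal] at hp
    simp only at hp ⊢
    rw [abs_mul]
    exact mul_le_mul (hτ j (by omega)) (main i (by omega)) (abs_nonneg _)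
      ((abs_nonneg _).trans (hτ j (by omega)))
  have h2 : coeff 0 H * |coeff n P| ≤ 2 * b * convConst s * wt s 1 n := by
    nth_rw 1 [← abs_of_pos hpos]
    rw [← abs_mul, hrec n, coeff_one,
      if_neg (by omega), zero_add]
    exact h1
  have := abs_nonneg (coeff n P)
  nlinarith

/-- Inverse of `1 - X + κ P` for `P` close to a constant at least one. -/
lemma abs_coeff_resolvent_le {P R : PowerSeries ℝ} {s κ b : ℝ} (hs : 3 / 2 ≤ s) {N : ℕ}
    (hκ : 0 ≤ κ) (hκ1 : κ ≤ 1 / 2) (hR : (1 - X + C κ * P) * R = 1) (hP0 : 1 ≤ coeff 0 P)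
    (hb0 : 0 ≤ b) (hb : b * convConst s ≤ 1 / 2)
    (hP : ∀ j ≤ N, 1 ≤ j → |coeff j P| ≤ b * wt s 1 j) :
    ∀ n ≤ N, |coeff n R| ≤ wt s (κ / (4 * s)) n := by
  have hs0 : 0 < s := by linarith
  -- With s x = κ/4 the shift X costs at most 1 + κ/2, and the higher coefficients of κP cost at
  -- most κ/2. The total 1 + κ is covered by the constant term 1 + κP₀, as P₀ ≥ 1.
  set x := κ / (4 * s) with hx
  have hx0 : 0 ≤ x := by positivity
  have hx1 : x ≤ 1 := by rw [hx, div_le_one (by positivity)]; linarith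
  have hsx : s * x = κ / 4 := by rw [hx]; field_simp
  have hw := fun n => (wt_pos s hx0 n).le
  have hw1 := fun n => (wt_pos s zero_le_one n).le
  have hc : 0 < 1 + κ * coeff 0 P := by nlinarith
  refine abs_le_of_supersolution (c := 1 + κ * coeff 0 P)
    (s := fun n => coeff n (1 : PowerSeries ℝ)) (σ := fun n => if n = 0 then 1 else 0)
    (t := fun j => if j = 0 then 0 else coeff j (X - C κ * P : PowerSeries ℝ))
    (τ := fun j => (if j = 1 then 1 else 0) + κ * (b * wt s 1 j))
    hc ?_ (by simp) ?_ ?_ hw ?_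
  · intro n _
    have h := coeff_mul_split (1 - X + C κ * P) R n
    rw [hR] at h
    have h0 : coeff 0 (1 - X + C κ * P : PowerSeries ℝ) = 1 + κ * coeff 0 P := by
      simp only [map_add, map_sub, coeff_C_mul, coeff_zero_X, coeff_one, if_true, sub_zero]
    rw [h0] at h
    have h2 : ∑ p ∈ antidiagonal n,
        (if p.1 = 0 then 0 else coeff p.1 (X - C κ * P : PowerSeries ℝ)) * coeff p.2 R =
        -∑ p ∈ antidiagonal n,
          (if p.1 = 0 then 0 else coeff p.1 (1 - X + C κ * P : PowerSeries ℝ)) * coeff p.2 R := by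
      rw [← sum_neg_distrib]
      refine sum_congr rfl fun p _ => ?_
      split_ifs with hp
      · simp
      · simp only [map_sub, map_add, coeff_one, if_neg hp]; ring
    simp only [h2]; linarith
  · intro j hj
    have := mul_nonneg hκ (mul_nonneg hb0 (hw1 j))
    rcases Nat.eq_zero_or_pos j with rfl | hj0
    · simpa using mul_nonneg hκ hb0
    · simp only [if_neg hj0.ne', map_sub, coeff_C_mul, coeff_X]
      refine (abs_sub _ _).trans (add_le_add ?_ ?_)
      · split_ifs <;> simp
      · rw [abs_mul, abs_of_nonneg hκ]
        exact mul_le_mul_of_nonneg_left (hP j hj hj0) hκ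
  · intro n _
    simp only [coeff_one]
    split_ifs <;> simp
  · intro n _
    have e1 : ∑ p ∈ antidiagonal n, ((if p.1 = 1 then 1 else 0) + κ * (b * wt s 1 p.1)) *
        wt s x p.2 = ∑ p ∈ antidiagonal n, (if p.1 = 1 then 1 else 0) * wt s x p.2 +
        κ * b * ∑ p ∈ antidiagonal n, wt s 1 p.1 * wt s x p.2 := by
      rw [mul_sum, ← sum_add_distrib]
      exact sum_congr rfl fun _ _ => by ring
    have e2 : κ * b * ∑ p ∈ antidiagonal n, wt s 1 p.1 * wt s x p.2 ≤ κ / 2 * wt s x n :=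
      calc _ ≤ κ * b * (convConst s * wt s x n) := by
            gcongr; exact sum_wt_one_mul_wt_le hs hx0 hx1 n
        _ = κ * (b * convConst s) * wt s x n := by ring
        _ ≤ κ * (1 / 2) * wt s x n := by gcongr; exact hw n
        _ = _ := by ring
    have e3 : (if n = 0 then (1 : ℝ) else 0) +
        ∑ p ∈ antidiagonal n, (if p.1 = 1 then 1 else 0) * wt s x p.2 ≤
        (1 + κ / 2) * wt s x n := by
      cases n with
      | zero => simp; linarith
      | succ n =>
        have h1 : ∑ p ∈ antidiagonal (n + 1), (if p.1 = 1 then (1 : ℝ) else 0) * wt s x p.2 =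
            wt s x n := by
          rw [sum_eq_single ((1, n) : ℕ × ℕ)]
          · simp
          · rintro ⟨j, i⟩ hp hne
            rw [HasAntidiagonal.mem_antidiagonal] at hp
            have : j ≠ 1 := by
              rintro rfl
              exact hne (by simp only [Prod.mk.injEq, true_and]; simp only at hp; omega)
            simp [this]
          · intro h; exact absurd (by simp [add_comm]) h
        rw [h1]
        have := wt_pred_le hs0 hx0 hsx.le (by linarith) n
        simp only [Nat.add_eq_zero_iff, one_ne_zero, and_false, if_false, zero_add]
        linarith
    rw [e1]
    have := hw n
    have : κ * wt s x n ≤ κ * coeff 0 P * wt s x n := by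
      rw [mul_assoc]
      exact mul_le_mul_of_nonneg_left (le_mul_of_one_le_left (hw n) hP0) hκ
    linarith

end PowerSeriesBounds

/-! ### Renewal kernels and the first bound on their Green function. -/

section GreenFunction

open Finset PowerSeries

/-- A kernel `g` with polynomially decaying small tail, of total mass `1 - κ` up to a small error,
on the range `n ≤ N`. -/
structure RenewalKernel (θ b κ : ℝ) (N : ℕ) (g : ℕ → ℝ) : Prop where
  kappa_nonneg : 0 ≤ κ
  kappa_le : κ ≤ 1 / 2
  zero : g 0 = 0
  one : |g 1| ≤ 2
  bound : ∀ m ≤ N, 2 ≤ m → |g m| ≤ b * wt θ 1 m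
  tail : ∀ j ≤ N, 1 ≤ j → |1 - κ - ∑ m ∈ range (j + 1), g m| ≤ b * wt (θ - 1) 1 j

/-- The rate at which the parameter of the weights depends on the mass defect `κ`. -/
def rate (θ : ℝ) : ℝ := 1 / (4 * (θ - 1))

/-- The smallness required of the tail of a renewal kernel. -/
def smallness (θ : ℝ) : ℝ := 1 / (8 * convConst (θ - 1) ^ 2)

lemma smallness_pos {θ : ℝ} (hθ : 5 / 2 ≤ θ) : 0 < smallness θ := by
  have := one_le_convConst (s := θ - 1) (by linarith)
  unfold smallness; positivity

lemma smallness_le_one {θ : ℝ} (hθ : 5 / 2 ≤ θ) : smallness θ ≤ 1 := by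
  have := one_le_convConst (s := θ - 1) (by linarith)
  unfold smallness
  rw [div_le_one (by positivity)]
  nlinarith

lemma rate_pos {θ : ℝ} (hθ : 5 / 2 ≤ θ) : 0 < rate θ := by
  unfold rate
  have : 0 < θ - 1 := by linarith
  positivity

lemma rate_le_one {θ : ℝ} (hθ : 5 / 2 ≤ θ) : rate θ ≤ 1 := by
  unfold rate
  rw [div_le_one (by linarith)]
  linarith

/-- First bound on the Green function `q = 1 / (1 - G)` of a renewal kernel. -/
lemma RenewalKernel.abs_coeff_green_le {θ b κ : ℝ} {N : ℕ} {g : ℕ → ℝ} (hθ : 5 / 2 ≤ θ)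
    (hg : RenewalKernel θ b κ N g) (hb0 : 0 ≤ b) (hb : b ≤ smallness θ) {q : PowerSeries ℝ}
    (hq : (1 - PowerSeries.mk g) * q = 1) :
    ∀ n ≤ N, |coeff n q| ≤ 2 * convConst (θ - 1) * wt (θ - 1) (rate θ * κ) n := by
  set s := θ - 1 with hs
  have hs32 : 3 / 2 ≤ s := by linarith
  have hc := one_le_convConst (s := s) (by linarith)
  have hκ := hg.kappa_nonneg
  have hκ1 := hg.kappa_le
  -- The inverse of H has higher coefficients of size 4bc, with c the convolution constant. The
  -- resolvent bound then needs 4bc · c ≤ 1/2, which is how `smallness` is chosen.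
  have hbc : 8 * b * convConst s * convConst s ≤ 1 := by
    unfold smallness at hb
    rw [le_div_iff₀ (by positivity)] at hb
    rw [← hs] at hb
    linarith
  have hbc' : 4 * b * convConst s ≤ 1 := by nlinarith [mul_nonneg hb0 (zero_le_one.trans hc)]
  -- Abel summation: 1 - G = κ + (1 - X)H. With P = 1/H this reads 1 - G = (1 - X + κP)/P, so q is P
  -- times the resolvent of the preceding lemma.
  let H : PowerSeries ℝ := PowerSeries.mk fun j => 1 - κ - ∑ m ∈ range (j + 1), g m
  have hH0 : coeff 0 H = 1 - κ := by simp [H, hg.zero]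
  have hGH : 1 - PowerSeries.mk g = C κ + (1 - X) * H := by
    ext n
    cases n with
    | zero => simp [H, hg.zero]
    | succ n =>
      rw [sub_mul, one_mul]
      simp only [map_sub, map_add, coeff_succ_X_mul, coeff_C, coeff_one, coeff_mk, H,
        sum_range_succ _ (n + 1)]
      simp
  have hHP : H * H⁻¹ = 1 := by
    refine PowerSeries.mul_inv_cancel _ ?_
    rw [← coeff_zero_eq_constantCoeff_apply, hH0]; linarith
  set P := H⁻¹ with hP
  obtain ⟨hPb, hPs⟩ := abs_coeff_inverse_le hs32 hHP (by rw [hH0]; linarith) hb0 hbc'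
    (N := N) (fun j hj hj1 => by simpa [H] using hg.tail j hj hj1)
  have hP0 : 1 ≤ coeff 0 P := by
    have h := congrArg constantCoeff hHP
    rw [map_mul, ← coeff_zero_eq_constantCoeff_apply, ← coeff_zero_eq_constantCoeff_apply, hH0,
      map_one] at h
    nlinarith
  let T : PowerSeries ℝ := 1 - X + C κ * P
  have hT0 : constantCoeff T ≠ 0 := by
    have : constantCoeff T = 1 + κ * coeff 0 P := by simp [T]
    rw [this]; nlinarith
  have hTR : T * T⁻¹ = 1 := PowerSeries.mul_inv_cancel _ hT0
  have hR := abs_coeff_resolvent_le hs32 hκ hκ1 hTR hP0 (N := N) (b := 4 * b * convConst s)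
    (by positivity) (by linarith) hPs
  have hqPR : q = P * T⁻¹ := by
    have h1 : (1 - PowerSeries.mk g) * (P * T⁻¹) = 1 := by
      calc (1 - PowerSeries.mk g) * (P * T⁻¹) = (C κ * P + (1 - X) * (H * P)) * T⁻¹ := by
            rw [hGH]; ring
        _ = T * T⁻¹ := by rw [hHP]; ring
        _ = 1 := hTR
    calc q = q * ((1 - PowerSeries.mk g) * (P * T⁻¹)) := by rw [h1, mul_one]
      _ = ((1 - PowerSeries.mk g) * q) * (P * T⁻¹) := by ring
      _ = _ := by rw [hq, one_mul]
  intro n hn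
  have hx : κ / (4 * s) = rate θ * κ := by unfold rate; rw [← hs]; ring
  rw [← hx, hqPR]
  have h := abs_coeff_mul_le_wt_one (B := T⁻¹) (x := κ / (4 * s)) (β := 1) hs32 (by positivity)
    (by rw [div_le_one (by positivity)]; linarith) hPb (fun n hn => by simpa using hR n hn) hn
  linarith

/-- The Euler operator `X d/dX`. -/
def euler (A : PowerSeries ℝ) : PowerSeries ℝ := X * d⁄dX ℝ A

lemma coeff_euler (A : PowerSeries ℝ) (n : ℕ) : coeff n (euler A) = n * coeff n A := by
  unfold euler
  cases n with
  | zero => simp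
  | succ n => rw [coeff_succ_X_mul, coeff_derivative]; push_cast; ring

lemma euler_mul (A B : PowerSeries ℝ) : euler (A * B) = euler A * B + A * euler B := by
  unfold euler
  rw [Derivation.leibniz]
  simp only [smul_eq_mul]; ring

lemma euler_sub (A B : PowerSeries ℝ) : euler (A - B) = euler A - euler B := by
  unfold euler; rw [map_sub]; ring

lemma euler_one : euler 1 = 0 := by
  ext n; rw [coeff_euler, coeff_one]; split_ifs with h <;> simp [h]

/-- Obtained by differentiating (1 - G)q = 1. The operator multiplies the n-th coefficient by n, so
bounds on the right side become extra decay of q. -/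
lemma euler_green {G q : PowerSeries ℝ} (hq : (1 - G) * q = 1) : euler q = q * q * euler G := by
  have h := congrArg euler hq
  rw [euler_mul, euler_sub, euler_one, zero_sub] at h
  calc euler q = ((1 - G) * q) * euler q := by rw [hq, one_mul]
    _ = q * ((1 - G) * euler q) := by ring
    _ = q * (q * euler G) := by rw [show (1 - G) * euler q = q * euler G by linear_combination h]
    _ = _ := by ring

lemma euler_euler_green {G q : PowerSeries ℝ} (hq : (1 - G) * q = 1) :
    euler (euler q) = euler (euler G) * (q * q) +
      2 * (euler G * (euler G * (q * (q * q)))) := by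
  rw [euler_green hq, euler_mul, euler_mul, euler_green hq]
  ring

end GreenFunction

/-! ### Improved decay of the Green function by two Euler derivatives. -/

section GreenFunctionDecay

open Finset PowerSeries

lemma exists_sum_wt_le : ∃ Z : ℝ, 0 ≤ Z ∧ ∀ n, ∑ j ∈ range n, wt (5 / 4) 1 j ≤ Z := by
  have h : Summable fun j : ℕ => wt (5 / 4) 1 j := by
    refine ((Real.summable_one_div_nat_add_rpow 1 (5 / 4)).2 (by norm_num)).congr fun j => ?_
    rw [abs_of_pos (by positivity), wt, Real.rpow_neg (by positivity), one_div, one_mul, add_comm]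
  exact ⟨∑' j, wt (5 / 4) 1 j, tsum_nonneg fun j => (wt_pos _ zero_le_one j).le,
    fun n => h.sum_le_tsum _ fun j _ => (wt_pos _ zero_le_one j).le⟩

lemma wt_one_le_rpow {s : ℝ} (hs : 0 ≤ s) {n : ℕ} (hn : 1 ≤ n) : wt s 1 n ≤ (n : ℝ) ^ (-s) := by
  have : (0 : ℝ) < n := by exact_mod_cast hn
  exact Real.rpow_le_rpow_of_nonpos this (by linarith) (by linarith)

lemma rpow_le_wt_one {s : ℝ} (hs : 0 ≤ s) {n : ℕ} (hn : 1 ≤ n) :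
    (n : ℝ) ^ (-s) ≤ 2 ^ s * wt s 1 n := by
  have h1 : (1 : ℝ) ≤ n := by exact_mod_cast hn
  have h2 : (n : ℝ) ^ (-s) ≤ ((1 + 1 * (n : ℝ)) / 2) ^ (-s) :=
    Real.rpow_le_rpow_of_nonpos (by positivity) (by linarith) (by linarith)
  refine h2.trans (le_of_eq ?_)
  rw [Real.div_rpow (by positivity) (by norm_num), Real.rpow_neg (by norm_num : (0:ℝ) ≤ 2), wt]
  field_simp

/-- The sequence j(1 + j)^{-3/2} is not summable. Splitting j = j^{3/4} j^{1/4} and bounding the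
first factor by n^{3/4} leaves the summable weight of exponent 5/4. -/
lemma nat_mul_wt_le {s : ℝ} (hs : 3 / 2 ≤ s) {j n : ℕ} (hj : j ≤ n) :
    j * wt s 1 j ≤ (n : ℝ) ^ (3 / 4 : ℝ) * wt (5 / 4) 1 j := by
  rcases Nat.eq_zero_or_pos j with rfl | hj0
  · simp; positivity
  have h0 : (0 : ℝ) < j := by exact_mod_cast hj0
  have hjn : (j : ℝ) ≤ n := by exact_mod_cast hj
  have h1 : (0 : ℝ) < 1 + 1 * j := by positivity
  calc (j : ℝ) * wt s 1 j = (j : ℝ) ^ (3 / 4 : ℝ) * ((j : ℝ) ^ (1 / 4 : ℝ) * wt s 1 j) := by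
        rw [← mul_assoc, ← Real.rpow_add h0]; norm_num
    _ ≤ (n : ℝ) ^ (3 / 4 : ℝ) * ((1 + 1 * (j : ℝ)) ^ (1 / 4 : ℝ) * wt (3 / 2) 1 j) := by
        have := (wt_pos s zero_le_one j).le
        gcongr
        · linarith
        · exact wt_anti_exponent hs zero_le_one j
    _ = (n : ℝ) ^ (3 / 4 : ℝ) * wt (5 / 4) 1 j := by
        unfold wt; rw [← Real.rpow_add h1]; norm_num

lemma sum_nat_mul_wt_mul_wt_le {s x Z : ℝ} (hs : 3 / 2 ≤ s) (hx : 0 < x) (hx1 : x ≤ 1)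
    (hZ : ∀ n, ∑ j ∈ range n, wt (5 / 4) 1 j ≤ Z) (n : ℕ) :
    ∑ p ∈ antidiagonal n, (p.1 * wt s 1 p.1) * wt s x p.2 ≤
      2 ^ s * (n * wt s 1 n * (3 / x) + (n : ℝ) ^ (3 / 4 : ℝ) * Z * wt s x n) := by
  have hs0 : 0 ≤ s := by linarith
  have hx' := fun n => (wt_pos s hx.le n).le
  have hw := fun n => (wt_pos s zero_le_one n).le
  have hz := fun n => (wt_pos (5 / 4) zero_le_one n).le
  have key : ∀ p ∈ antidiagonal n, (p.1 * wt s 1 p.1) * wt s x p.2 ≤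
      2 ^ s * (n * wt s 1 n) * wt s x p.2 +
        2 ^ s * ((n : ℝ) ^ (3 / 4 : ℝ) * wt s x n) * wt (5 / 4) 1 p.1 := by
    rintro ⟨j, i⟩ hp
    rw [HasAntidiagonal.mem_antidiagonal] at hp
    simp only at hp ⊢
    have hjn : (j : ℝ) ≤ n := by exact_mod_cast (by omega : j ≤ n)
    have p1 : 0 ≤ 2 ^ s * (n * wt s 1 n) * wt s x i := by have := hw n; have := hx' i; positivity
    have p2 : 0 ≤ 2 ^ s * ((n : ℝ) ^ (3 / 4 : ℝ) * wt s x n) * wt (5 / 4) 1 j := by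
      have := hx' n; have := hz j; positivity
    rcases le_total j i with h | h
    · have h1 := wt_le_of_le_two_mul hs0 hx.le (i := i) (n := n) (by omega)
      have h2 := nat_mul_wt_le hs (j := j) (n := n) (by omega)
      have : (j * wt s 1 j) * wt s x i ≤
          ((n : ℝ) ^ (3 / 4 : ℝ) * wt (5 / 4) 1 j) * (2 ^ s * wt s x n) :=
        mul_le_mul h2 h1 (hx' i) (by have := hz j; positivity)
      linarith
    · have h1 := wt_le_of_le_two_mul hs0 zero_le_one (i := j) (n := n) (by omega)
      have : (j * wt s 1 j) * wt s x i ≤ (n * (2 ^ s * wt s 1 n)) * wt s x i := by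
        have := hx' i; have := hw j
        gcongr
      linarith
  refine (sum_le_sum key).trans ?_
  rw [sum_add_distrib, ← mul_sum, ← mul_sum, sum_antidiagonal_fst, sum_antidiagonal_snd]
  have h1 := sum_wt_le hs hx hx1 (n + 1)
  have h2 := hZ (n + 1)
  have := hw n
  have := hx' n
  calc _ ≤ 2 ^ s * (n * wt s 1 n) * (3 / x) + 2 ^ s * ((n : ℝ) ^ (3 / 4 : ℝ) * wt s x n) * Z := by
        gcongr
    _ = _ := by ring

lemma RenewalKernel.abs_coeff_euler_le {θ b κ : ℝ} {N : ℕ} {g : ℕ → ℝ} (hθ : 5 / 2 ≤ θ)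
    (hg : RenewalKernel θ b κ N g) (hb : b ≤ 1) {n : ℕ} (hn : n ≤ N) :
    |coeff n (euler (PowerSeries.mk g))| ≤ 2 * 2 ^ (θ - 1) * wt (θ - 1) 1 n := by
  have h2 : (1 : ℝ) ≤ 2 ^ (θ - 1) := Real.one_le_rpow (by norm_num) (by linarith)
  rw [coeff_euler, coeff_mk, abs_mul, Nat.abs_cast]
  rcases Nat.lt_or_ge n 2 with h | h
  · interval_cases n
    · simp; positivity
    -- The coefficient at 1 is not small; the factor 2 · 2^{θ-1} in the statement is chosen to
    -- absorb it.
    · have : wt (θ - 1) 1 1 = (2 ^ (θ - 1))⁻¹ := by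
        unfold wt; rw [← Real.rpow_neg (by norm_num)]; norm_num
      rw [this, mul_assoc, mul_inv_cancel₀ (by positivity)]
      simpa using hg.one
  · have hn0 : (0 : ℝ) < 1 + 1 * n := by positivity
    have hw := wt_pos θ zero_le_one n
    have e : wt (θ - 1) 1 n = (1 + 1 * n) * wt θ 1 n := by
      unfold wt
      nth_rw 2 [← Real.rpow_one (1 + 1 * (n : ℝ))]
      rw [← Real.rpow_add hn0]; congr 1; ring
    have h3 := hg.bound n hn h
    have h4 : |g n| ≤ wt θ 1 n := h3.trans (by nlinarith)
    calc (n : ℝ) * |g n| ≤ (1 + 1 * n) * wt θ 1 n := by gcongr; linarith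
      _ ≤ _ := by rw [← e]; have := wt_pos (θ - 1) zero_le_one n; nlinarith

/-- The decay of the Green function of a renewal kernel with mass defect proportional to `x`. -/
def greenTail (θ x : ℝ) (n : ℕ) : ℝ := (n : ℝ) ^ (-θ) * x ^ (1 / 4 - θ) + wt (θ + 1) x n

lemma greenTail_nonneg (θ : ℝ) {x : ℝ} (hx : 0 ≤ x) (n : ℕ) : 0 ≤ greenTail θ x n := by
  have := wt_pos (θ + 1) hx n
  unfold greenTail; positivity

/-- The left side collects the contributions to n²|q_n|. In the range xn ≥ 1 the factor 1 + xn is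
comparable to xn, so n² can be exchanged for x^{-2} in the weights. -/
lemma error_terms_le_greenTail {θ x : ℝ} (hθ : 5 / 2 ≤ θ) (hx : 0 < x) (hx1 : x ≤ 1) {n : ℕ}
    (hn : 1 ≤ n) (hxn : 1 ≤ x * n) :
    n * wt (θ - 1) 1 n * (1 / x ^ 2) + (n : ℝ) ^ (3 / 4 : ℝ) * (1 / x) * wt (θ - 1) x n +
      1 / x ^ 2 * wt (θ - 1) x n ≤ 6 * ((n : ℝ) ^ 2 * greenTail θ x n) := by
  have hn0 : (0 : ℝ) < n := by exact_mod_cast hn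
  have hxn0 : 0 < x * n := by positivity
  have hV : 0 ≤ (n : ℝ) ^ 2 * ((n : ℝ) ^ (-θ) * x ^ (1 / 4 - θ)) := by positivity
  have hW := wt_pos (θ + 1) hx.le n
  have a1 : n * wt (θ - 1) 1 n * (1 / x ^ 2) ≤
      (n : ℝ) ^ 2 * ((n : ℝ) ^ (-θ) * x ^ (1 / 4 - θ)) := by
    have h1 : 1 / x ^ 2 ≤ x ^ (1 / 4 - θ) := by
      rw [one_div, ← Real.rpow_natCast, ← Real.rpow_neg hx.le]
      exact Real.rpow_le_rpow_of_exponent_ge hx hx1 (by push_cast; linarith)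
    have h2 := wt_one_le_rpow (s := θ - 1) (by linarith) hn
    calc _ ≤ n * (n : ℝ) ^ (-(θ - 1)) * x ^ (1 / 4 - θ) := by gcongr
      _ = _ := by
        rw [← mul_assoc]; congr 1
        rw [← Real.rpow_natCast, ← Real.rpow_add hn0]
        nth_rw 1 [← Real.rpow_one (n : ℝ)]
        rw [← Real.rpow_add hn0]; congr 1; push_cast; ring
  have a2 : (n : ℝ) ^ (3 / 4 : ℝ) * (1 / x) * wt (θ - 1) x n ≤
      (n : ℝ) ^ 2 * ((n : ℝ) ^ (-θ) * x ^ (1 / 4 - θ)) := by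
    have h1 : wt (θ - 1) x n ≤ (x * n) ^ (-(θ - 1)) :=
      Real.rpow_le_rpow_of_nonpos hxn0 (by linarith) (by linarith)
    -- Inserting this factor turns n^{7/4-θ} x^{-θ} into n^{2-θ} x^{1/4-θ}. For x proportional to
    -- |k|² and θ = d/2, the power x^{-θ} would just fail to be integrable at k = 0.
    have h2 : 1 ≤ (x * n) ^ (1 / 4 : ℝ) := Real.one_le_rpow hxn (by norm_num)
    calc _ ≤ (n : ℝ) ^ (3 / 4 : ℝ) * (1 / x) * ((x * n) ^ (-(θ - 1)) * (x * n) ^ (1 / 4 : ℝ)) := by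
          gcongr
          exact h1.trans (le_mul_of_one_le_right (by positivity) h2)
      _ = ((n : ℝ) ^ (3 / 4 : ℝ) * (n : ℝ) ^ (5 / 4 - θ)) *
          (x ^ (-1 : ℝ) * x ^ (5 / 4 - θ)) := by
        rw [← Real.rpow_add hxn0, Real.mul_rpow hx.le hn0.le, Real.rpow_neg_one,
          show -(θ - 1) + 1 / 4 = 5 / 4 - θ by ring]
        ring
      _ = _ := by
        rw [← Real.rpow_add hn0, ← Real.rpow_add hx, ← mul_assoc, ← Real.rpow_natCast,
          ← Real.rpow_add hn0]
        congr 2 <;> push_cast <;> ring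
  have a3 : 1 / x ^ 2 * wt (θ - 1) x n ≤ 4 * ((n : ℝ) ^ 2 * wt (θ + 1) x n) := by
    have e : wt (θ - 1) x n = (1 + x * n) ^ 2 * wt (θ + 1) x n := by
      unfold wt
      rw [← Real.rpow_natCast, ← Real.rpow_add (by positivity)]; congr 1; push_cast; ring
    rw [e]
    calc _ ≤ 1 / x ^ 2 * ((2 * (x * n)) ^ 2 * wt (θ + 1) x n) := by gcongr; linarith
      _ = _ := by field_simp; norm_num
  have e : (n : ℝ) ^ 2 * greenTail θ x n = (n : ℝ) ^ 2 * ((n : ℝ) ^ (-θ) * x ^ (1 / 4 - θ)) +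
      (n : ℝ) ^ 2 * wt (θ + 1) x n := by unfold greenTail; ring
  rw [e]
  have : 0 ≤ (n : ℝ) ^ 2 * wt (θ + 1) x n := by positivity
  linarith

/-- For xn ≤ 1 the weight in `greenTail` is bounded below and the first bound on q suffices. For xn
≥ 1 one expands n² q_n by `euler_euler_green`: each product of two q-type factors costs 1/x, while a
factor from the first Euler derivative of G has parameter 1 and costs no power of x. -/
lemma exists_abs_green_le_greenTail {θ : ℝ} (hθ : 5 / 2 ≤ θ) : ∃ A : ℝ, 1 ≤ A ∧
    ∀ (b κ : ℝ) (N : ℕ) (g : ℕ → ℝ) (q : PowerSeries ℝ), RenewalKernel θ b κ N g → 0 ≤ b →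
      b ≤ smallness θ → (1 - PowerSeries.mk g) * q = 1 → 0 < κ →
      ∀ n ≤ N, 1 ≤ n → |coeff n q| ≤ A * greenTail θ (rate θ * κ) n := by
  obtain ⟨Z, hZ0, hZ⟩ := exists_sum_wt_le
  set s := θ - 1 with hs
  have hs32 : 3 / 2 ≤ s := by linarith
  set c := convConst s with hc
  have hc1 : 1 ≤ c := one_le_convConst (by linarith)
  set D : ℝ := 2 * 2 ^ s with hD
  have hD0 : 0 < D := by positivity
  -- The first two summands come from E²G · q², split according to the larger index; the third comes
  -- from 2(EG)²q³. Here E = X d/dX.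
  set M : ℝ := 4 * D * c ^ 3 * 2 ^ s * 3 + 4 * D * c ^ 3 * 2 ^ s * Z + 16 * D ^ 2 * c ^ 7 with hM
  have hM0 : 0 ≤ M := by positivity
  refine ⟨6 * M + 2 * c * 2 ^ (θ + 1) + 1, by
    have : 0 ≤ 2 * c * 2 ^ (θ + 1) := by positivity
    linarith, ?_⟩
  intro b κ N g q hg hb0 hb hq hκ n hn hn1
  have hr := rate_pos hθ
  set x := rate θ * κ with hx
  have hx0 : 0 < x := by positivity
  have hx1 : x ≤ 1 := by nlinarith [rate_le_one hθ, hg.kappa_le]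
  have hn0 : (0 : ℝ) < n := by exact_mod_cast hn1
  have hq1 := hg.abs_coeff_green_le hθ hb0 hb hq
  rw [← hs, ← hc, ← hx] at hq1
  have hV := greenTail_nonneg θ hx0.le n
  have hW := wt_pos s hx0.le n
  have hw := wt_pos s zero_le_one n
  rcases le_total (x * n) 1 with hxn | hxn
  · have h1 : 1 ≤ 2 ^ (θ + 1) * wt (θ + 1) x n := by
      have h2 : (2 : ℝ) ^ (-(θ + 1)) ≤ wt (θ + 1) x n :=
        Real.rpow_le_rpow_of_nonpos (by positivity) (by linarith) (by linarith)
      rw [Real.rpow_neg (by norm_num)] at h2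
      calc (1 : ℝ) = 2 ^ (θ + 1) * (2 ^ (θ + 1))⁻¹ := by field_simp
        _ ≤ _ := by gcongr
    have h3 : wt (θ + 1) x n ≤ greenTail θ x n := by
      unfold greenTail; have : 0 ≤ (n : ℝ) ^ (-θ) * x ^ (1 / 4 - θ) := by positivity
      linarith
    calc |coeff n q| ≤ 2 * c * wt s x n := hq1 n hn
      _ ≤ 2 * c * 1 := by gcongr; exact wt_le_one (by linarith) hx0.le n
      _ ≤ 2 * c * (2 ^ (θ + 1) * wt (θ + 1) x n) := by gcongr
      _ ≤ 2 * c * (2 ^ (θ + 1) * greenTail θ x n) := by gcongr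
      _ ≤ _ := by nlinarith [mul_nonneg hM0 hV]
  · have hE := fun n (hn : n ≤ N) =>
      hg.abs_coeff_euler_le hθ (hb.trans (smallness_le_one hθ)) hn
    rw [← hs, ← hD] at hE
    have hqq := fun n (hn : n ≤ N) => abs_coeff_mul_le_wt hs32 hx0 hx1 hq1 hq1 hn
    have hqqq := fun n (hn : n ≤ N) => abs_coeff_mul_le_wt hs32 hx0 hx1 hq1 hqq hn
    have hT1 := fun n (hn : n ≤ N) => abs_coeff_mul_le_wt_one hs32 hx0.le hx1 hE hqqq hn
    have hT2 := abs_coeff_mul_le_wt_one hs32 hx0.le hx1 hE hT1 hn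
    have hEE : ∀ j ≤ N, |coeff j (euler (euler (PowerSeries.mk g)))| ≤ D * (j * wt s 1 j) := by
      intro j hj
      rw [coeff_euler, abs_mul, Nat.abs_cast]
      calc _ ≤ j * (D * wt s 1 j) := by gcongr; exact hE j hj
        _ = _ := by ring
    have hS1 := abs_coeff_mul_le hEE hqq hn
    have hS2 : |coeff n (euler (euler (PowerSeries.mk g)) * (q * q))| ≤
        D * (2 * c * (2 * c) * (c / x)) *
        (2 ^ s * (n * wt s 1 n * (3 / x) + (n : ℝ) ^ (3 / 4 : ℝ) * Z * wt s x n)) := by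
      refine hS1.trans ?_
      calc _ = D * (2 * c * (2 * c) * (c / x)) *
            ∑ p ∈ antidiagonal n, (p.1 * wt s 1 p.1) * wt s x p.2 := by
            rw [mul_sum]; exact sum_congr rfl fun _ _ => by ring
        _ ≤ _ := by gcongr; exact sum_nat_mul_wt_mul_wt_le hs32 hx0 hx1 hZ n
    have htot : (n : ℝ) ^ 2 * |coeff n q| ≤ M * (n * wt s 1 n * (1 / x ^ 2) +
        (n : ℝ) ^ (3 / 4 : ℝ) * (1 / x) * wt s x n + 1 / x ^ 2 * wt s x n) := by
      have e1 : (n : ℝ) ^ 2 * |coeff n q| = |coeff n (euler (euler q))| := by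
        rw [coeff_euler, coeff_euler, abs_mul, abs_mul, Nat.abs_cast]; ring
      rw [e1, euler_euler_green hq, map_add, two_mul, map_add]
      refine (abs_add_le _ _).trans ((add_le_add hS2
        ((abs_add_le _ _).trans (add_le_add hT2 hT2))).trans ?_)
      set u1 := n * wt s 1 n * (1 / x ^ 2) with hu1
      set u2 := (n : ℝ) ^ (3 / 4 : ℝ) * (1 / x) * wt s x n with hu2
      set u3 := 1 / x ^ 2 * wt s x n with hu3
      have p1 : 0 ≤ u1 := by positivity
      have p2 : 0 ≤ u2 := by positivity
      have p3 : 0 ≤ u3 := by positivity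
      calc _ = 4 * D * c ^ 3 * 2 ^ s * 3 * u1 + 4 * D * c ^ 3 * 2 ^ s * Z * u2 +
            16 * D ^ 2 * c ^ 7 * u3 := by
            rw [hu1, hu2, hu3, ← hc]; field_simp; ring
        _ ≤ _ := by
            have q1 : 0 ≤ 4 * D * c ^ 3 * 2 ^ s * 3 := by positivity
            have q2 : 0 ≤ 4 * D * c ^ 3 * 2 ^ s * Z := by positivity
            have q3 : 0 ≤ 16 * D ^ 2 * c ^ 7 := by positivity
            have l1 : 4 * D * c ^ 3 * 2 ^ s * 3 * u1 ≤ M * u1 := by gcongr; linarith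
            have l2 : 4 * D * c ^ 3 * 2 ^ s * Z * u2 ≤ M * u2 := by gcongr; linarith
            have l3 : 16 * D ^ 2 * c ^ 7 * u3 ≤ M * u3 := by gcongr; linarith
            linarith
    have hfin := error_terms_le_greenTail hθ hx0 hx1 hn1 hxn
    rw [← hs] at hfin
    have h5 : (n : ℝ) ^ 2 * |coeff n q| ≤ (n : ℝ) ^ 2 * (6 * M * greenTail θ x n) := by
      refine htot.trans ((mul_le_mul_of_nonneg_left hfin hM0).trans (le_of_eq (by ring)))
    have h6 := le_of_mul_le_mul_left h5 (by positivity)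
    refine h6.trans ?_
    have : 0 ≤ 2 * c * 2 ^ (θ + 1) * greenTail θ x n := by positivity
    nlinarith

end GreenFunctionDecay

/-! ### Solutions of renewal equations: nearly critical, contractive, and differences of two. -/

section Renewal

open Finset PowerSeries

lemma one_sub_mk_mul_inv {g : ℕ → ℝ} (hg : g 0 = 0) :
    (1 - PowerSeries.mk g) * (1 - PowerSeries.mk g)⁻¹ = 1 := by
  refine PowerSeries.mul_inv_cancel _ ?_
  rw [← coeff_zero_eq_constantCoeff_apply]
  simp [hg]

lemma greenTail_le_of_le_two_mul {θ x : ℝ} (hθ : 0 ≤ θ) (hx : 0 ≤ x) {i n : ℕ} (hi : 1 ≤ i)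
    (hn : 1 ≤ n) (h : n ≤ 2 * i) : greenTail θ x i ≤ 2 ^ (θ + 1) * greenTail θ x n := by
  have h1 := wt_le_of_le_two_mul (s := θ + 1) (by linarith) hx h
  have hn0 : (0 : ℝ) < n := by exact_mod_cast hn
  have hi0 : (0 : ℝ) < i := by exact_mod_cast hi
  have h2 : (i : ℝ) ^ (-θ) ≤ 2 ^ (θ + 1) * (n : ℝ) ^ (-θ) := by
    have h3 : (n : ℝ) / 2 ≤ i := by
      have : (n : ℝ) ≤ 2 * i := by exact_mod_cast h
      linarith
    calc (i : ℝ) ^ (-θ) ≤ ((n : ℝ) / 2) ^ (-θ) :=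
          Real.rpow_le_rpow_of_nonpos (by positivity) h3 (by linarith)
      _ = 2 ^ θ * (n : ℝ) ^ (-θ) := by
          rw [Real.div_rpow hn0.le (by norm_num), Real.rpow_neg (by norm_num : (0:ℝ) ≤ 2)]
          field_simp
      _ ≤ _ := by gcongr <;> linarith
  unfold greenTail
  have : (0 : ℝ) ≤ x ^ (1 / 4 - θ) := by positivity
  nlinarith

/-- Bounds on the solution of a renewal equation, uniform in the mass defect. -/
lemma exists_abs_renewal_le {θ : ℝ} (hθ : 5 / 2 ≤ θ) : ∃ A : ℝ, 1 ≤ A ∧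
    ∀ (b κ : ℝ) (N : ℕ) (g : ℕ → ℝ) (S F : PowerSeries ℝ), RenewalKernel θ b κ N g → 0 ≤ b →
      b ≤ smallness θ → (1 - PowerSeries.mk g) * F = S →
      (∀ n ≤ N, |coeff n S| ≤ wt θ 1 n) →
      (∀ n ≤ N, |coeff n F| ≤ A) ∧
      (0 < κ → ∀ n ≤ N, 1 ≤ n → |coeff n F| ≤ A * greenTail θ (rate θ * κ) n) := by
  obtain ⟨A₀, hA₀, hq2⟩ := exists_abs_green_le_greenTail hθ
  set s := θ - 1 with hs
  have hs32 : 3 / 2 ≤ s := by linarith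
  set c := convConst s with hc
  have hc1 : 1 ≤ c := one_le_convConst (by linarith)
  refine ⟨2 * c * c + 3 * A₀ * 2 ^ (θ + 1) + 6 * c * 2 ^ θ, ?_, ?_⟩
  · have : 0 ≤ 3 * A₀ * 2 ^ (θ + 1) + 6 * c * 2 ^ θ := by positivity
    nlinarith
  intro b κ N g S F hg hb0 hb hF hS
  set q := (1 - PowerSeries.mk g)⁻¹ with hqdef
  have hq : (1 - PowerSeries.mk g) * q = 1 := one_sub_mk_mul_inv hg.zero
  have hFq : F = S * q := by
    rw [← hF]
    calc F = ((1 - PowerSeries.mk g) * q) * F := by rw [hq, one_mul]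
      _ = _ := by ring
  have hr := rate_pos hθ
  set x := rate θ * κ with hx
  have hx0 : 0 ≤ x := mul_nonneg hr.le hg.kappa_nonneg
  have hx1 : x ≤ 1 := by nlinarith [rate_le_one hθ, hg.kappa_le, hg.kappa_nonneg]
  have hq1 := hg.abs_coeff_green_le hθ hb0 hb hq
  rw [← hs, ← hc, ← hx] at hq1
  have hS' : ∀ n ≤ N, |coeff n S| ≤ 1 * wt s 1 n := fun n hn => by
    rw [one_mul]; exact (hS n hn).trans (wt_anti_exponent (by linarith) zero_le_one n)
  constructor
  · intro n hn
    rw [hFq]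
    have h1 := abs_coeff_mul_le_wt_one hs32 hx0 hx1 hS' hq1 hn
    have h2 := wt_le_one (s := s) (by linarith) hx0 n
    have h3 := wt_pos s hx0 n
    have h4 : 0 ≤ 3 * A₀ * 2 ^ (θ + 1) + 6 * c * 2 ^ θ := by positivity
    have h5 : 2 * c * c * wt s x n ≤ 2 * c * c := by
      nlinarith [mul_pos (zero_lt_one.trans_le hc1) (zero_lt_one.trans_le hc1)]
    rw [← hc] at h1
    linarith
  · intro hκ n hn hn1
    have hxp : 0 < x := by positivity
    have hV := greenTail_nonneg θ hx0 n
    have hn0 : (0 : ℝ) < n := by exact_mod_cast hn1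
    set V := greenTail θ x n with hVdef
    set B := (n : ℝ) ^ (-θ) with hB
    have hB0 : 0 ≤ B := by positivity
    -- Needed when the source carries the large index: it then gives n^{-θ}, while summing q costs
    -- 1/x.
    have hBV : B * (1 / x) ≤ V := by
      have h1 : 1 / x ≤ x ^ (1 / 4 - θ) := by
        rw [one_div, ← Real.rpow_neg_one]
        exact Real.rpow_le_rpow_of_exponent_ge hxp hx1 (by linarith)
      have h2 := wt_pos (θ + 1) hx0 n
      rw [hVdef, greenTail, ← hB]
      nlinarith
    rw [hFq, coeff_mul]
    have key : ∀ p ∈ antidiagonal n, |coeff p.1 S * coeff p.2 q| ≤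
        A₀ * (2 ^ (θ + 1) * V) * wt θ 1 p.1 + 2 ^ θ * B * (2 * c * wt s x p.2) := by
      rintro ⟨j, i⟩ hp
      rw [HasAntidiagonal.mem_antidiagonal] at hp
      simp only at hp ⊢
      have w1 := wt_pos θ zero_le_one j
      have w2 := wt_pos s hx0 i
      have p1 : 0 ≤ A₀ * (2 ^ (θ + 1) * V) * wt θ 1 j := by positivity
      have p2 : 0 ≤ 2 ^ θ * B * (2 * c * wt s x i) := by positivity
      rw [abs_mul]
      -- If i ≥ n/2, the decay of q at i is used and the source is summed; otherwise the decay of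
      -- the source at j is used and q is summed.
      rcases le_total j i with h | h
      · have h1 := (hq2 b κ N g q hg hb0 hb hq hκ i (by omega) (by omega)).trans
          (mul_le_mul_of_nonneg_left (greenTail_le_of_le_two_mul (by linarith) hx0
            (by omega : 1 ≤ i) hn1 (by omega : n ≤ 2 * i)) (by linarith))
        have := mul_le_mul (hS j (by omega)) h1 (abs_nonneg _) w1.le
        linarith
      · have h1 := (wt_le_of_le_two_mul (s := θ) (x := 1) (by linarith) zero_le_one
          (by omega : n ≤ 2 * j))
        have h2 := wt_one_le_rpow (s := θ) (by linarith) hn1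
        have h3 : wt θ 1 j ≤ 2 ^ θ * B := h1.trans (by gcongr)
        have := mul_le_mul ((hS j (by omega)).trans h3) (hq1 i (by omega)) (abs_nonneg _)
          (by positivity)
        linarith
    refine ((abs_sum_le_sum_abs _ _).trans (sum_le_sum key)).trans ?_
    rw [sum_add_distrib, ← mul_sum, ← mul_sum, ← mul_sum, sum_antidiagonal_fst,
      sum_antidiagonal_snd]
    have h1 := sum_wt_le (s := θ) (by linarith) one_pos le_rfl (n + 1)
    have h2 := sum_wt_le hs32 hxp hx1 (n + 1)
    calc _ ≤ A₀ * (2 ^ (θ + 1) * V) * (3 / 1) + 2 ^ θ * B * (2 * c * (3 / x)) := by gcongr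
      _ = 3 * A₀ * 2 ^ (θ + 1) * V + 6 * c * 2 ^ θ * (B * (1 / x)) := by ring
      _ ≤ 3 * A₀ * 2 ^ (θ + 1) * V + 6 * c * 2 ^ θ * V := by gcongr
      _ ≤ _ := by nlinarith [mul_pos (zero_lt_one.trans_le hc1) (zero_lt_one.trans_le hc1)]

/-- Bounds on the solution of a renewal equation whose kernel is a strict contraction. -/
lemma exists_abs_renewal_le_of_contraction {θ δ : ℝ} (hθ : 5 / 2 ≤ θ) (hδ : 0 < δ)
    (hδ1 : δ ≤ 1) : ∃ A b₁ : ℝ, 0 < A ∧ 0 < b₁ ∧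
    ∀ (N : ℕ) (g S f : ℕ → ℝ), g 0 = 0 → |g 1| ≤ 1 - δ →
      (∀ m ≤ N, 2 ≤ m → |g m| ≤ b₁ * wt θ 1 m) → |S 0| ≤ 1 →
      (∀ m ≤ N, 1 ≤ m → |S m| ≤ b₁ * wt θ 1 m) →
      (∀ n ≤ N, f n = S n + ∑ p ∈ antidiagonal n, g p.1 * f p.2) →
      ∀ n ≤ N, 1 ≤ n → |f n| ≤ A * (n : ℝ) ^ (-θ) := by
  have hθ0 : 0 < θ := by linarith
  -- With θ y = δ/4 the shift costs 1 + δ/2, and (1 - δ)(1 + δ/2) ≤ 1 - δ/2. The remaining δ/2 is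
  -- shared equally by the source and the rest of the kernel, which fixes `b₁`.
  set y := δ / (4 * θ) with hy
  have hy0 : 0 < y := by positivity
  have hy1 : y ≤ 1 := by rw [hy, div_le_one (by positivity)]; linarith
  have hθy : θ * y = δ / 4 := by rw [hy]; field_simp
  have hc1 := one_le_convConst hθ0.le
  have hbpos : 0 < δ / (4 * convConst θ) := by positivity
  refine ⟨y ^ (-θ), δ / (4 * convConst θ), by positivity, hbpos, ?_⟩
  set b₁ := δ / (4 * convConst θ) with hb₁
  have hbc : b₁ * convConst θ = δ / 4 := by rw [hb₁]; field_simp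
  intro N g S f hg0 hg1 hg hS0 hS hf n hn hn1
  have hw := fun n => (wt_pos θ hy0.le n).le
  have hw1 := fun n => (wt_pos θ zero_le_one n).le
  have main : ∀ n ≤ N, |f n| ≤ wt θ y n := by
    refine abs_le_of_supersolution (c := 1) one_pos
      (σ := fun n => if n = 0 then 1 else b₁ * wt θ 1 n)
      (τ := fun j => if j = 0 then 0 else (if j = 1 then 1 - δ else 0) + b₁ * wt θ 1 j)
      (fun n hn => by rw [one_mul]; exact hf n hn) hg0 ?_ ?_ hw ?_
    · intro j hj
      have := mul_nonneg hbpos.le (hw1 j)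
      split_ifs with h h'
      · simp [h, hg0]
      · subst h'; linarith
      · rw [zero_add]; exact hg j hj (by omega)
    · intro n hn
      split_ifs with h
      · rw [h]; exact hS0
      · exact hS n hn (by omega)
    · intro n hn
      cases n with
      | zero => simp
      | succ n =>
        have e1 : ∑ p ∈ antidiagonal (n + 1),
            (if p.1 = 0 then 0 else (if p.1 = 1 then 1 - δ else 0) + b₁ * wt θ 1 p.1) *
              wt θ y p.2 ≤
            ∑ p ∈ antidiagonal (n + 1), (if p.1 = 1 then 1 - δ else 0) * wt θ y p.2 +
              b₁ * ∑ p ∈ antidiagonal (n + 1), wt θ 1 p.1 * wt θ y p.2 := by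
          rw [mul_sum, ← sum_add_distrib]
          refine sum_le_sum fun p _ => ?_
          have := mul_nonneg hbpos.le (mul_nonneg (hw1 p.1) (hw p.2))
          split_ifs with h h'
          · omega
          · linarith
          · linarith
          · linarith
        have e2 : ∑ p ∈ antidiagonal (n + 1), (if p.1 = 1 then 1 - δ else 0) * wt θ y p.2 =
            (1 - δ) * wt θ y n := by
          rw [sum_eq_single ((1, n) : ℕ × ℕ)]
          · simp
          · rintro ⟨j, i⟩ hp hne
            rw [HasAntidiagonal.mem_antidiagonal] at hp
            have : j ≠ 1 := by
              rintro rfl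
              exact hne (by simp only [Prod.mk.injEq, true_and]; simp only at hp; omega)
            simp [this]
          · intro h; exact absurd (by simp [add_comm]) h
        have e3 := mul_le_mul_of_nonneg_left
          (sum_wt_one_mul_wt_le (s := θ) (by linarith) hy0.le hy1 (n + 1)) hbpos.le
        rw [← mul_assoc, hbc] at e3
        have e4 := wt_pred_le hθ0 hy0.le hθy.le (by linarith) n
        have e5 : b₁ * wt θ 1 (n + 1) ≤ δ / 4 * wt θ y (n + 1) := by
          have h1 : b₁ ≤ δ / 4 := by nlinarith
          exact mul_le_mul h1 (wt_anti_param hθ0.le hy0.le hy1 _) (hw1 _) (by positivity)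
        have e6 : (1 - δ) * wt θ y n ≤ (1 - δ / 2) * wt θ y (n + 1) := by
          calc _ ≤ (1 - δ) * ((1 + 2 * (δ / 4)) * wt θ y (n + 1)) := by
                gcongr
            _ ≤ _ := by nlinarith [mul_nonneg (sq_nonneg δ) (hw (n + 1))]
        rw [if_neg (Nat.succ_ne_zero n)]
        linarith
  have hn0 : (0 : ℝ) < n := by exact_mod_cast hn1
  refine (main n hn).trans ?_
  rw [← Real.mul_rpow hy0.le hn0.le]
  exact Real.rpow_le_rpow_of_nonpos (by positivity) (by linarith) (by linarith)

/-- Comparison of the solutions of two renewal equations. -/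
lemma abs_coeff_sub_le {g g' : ℕ → ℝ} {S S' F F' : PowerSeries ℝ} {s A M : ℝ} {N : ℕ}
    (hs : 3 / 2 ≤ s) (hM : 0 ≤ M) (hg0 : g 0 = 0) (hg0' : g' 0 = 0)
    (hF : (1 - PowerSeries.mk g) * F = S) (hF' : (1 - PowerSeries.mk g') * F' = S')
    (hq : ∀ n ≤ N, |coeff n (1 - PowerSeries.mk g')⁻¹| ≤ A) (hFA : ∀ n ≤ N, |coeff n F| ≤ A)
    (hg : ∀ m ≤ N, |g m - g' m| ≤ M * wt s 1 m)
    (hS0 : coeff 0 S = coeff 0 S') (hS : ∀ n ≤ N, |coeff n S - coeff n S'| ≤ M * wt s 1 n) :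
    ∀ n ≤ N, |coeff n F - coeff n F'| ≤ A * (1 + 3 * A) * M * n := by
  have hA : 0 ≤ A := (abs_nonneg _).trans (hFA 0 (Nat.zero_le _))
  set q := (1 - PowerSeries.mk g')⁻¹
  have hq1 : (1 - PowerSeries.mk g') * q = 1 := one_sub_mk_mul_inv hg0'
  set T := S - S' + (PowerSeries.mk g - PowerSeries.mk g') * F with hT
  have hFF : F - F' = T * q := by
    calc F - F' = ((1 - PowerSeries.mk g') * q) * (F - F') := by rw [hq1, one_mul]
      _ = _ := by rw [hT, ← hF, ← hF']; ring
  -- As T has no constant term, the convolution with the bounded Green function has only n nonzero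
  -- terms, hence the factor n and not n + 1.
  have hT0 : coeff 0 T = 0 := by
    rw [hT, map_add, map_sub, hS0, coeff_mul]
    simp [hg0, hg0']
  have hTb : ∀ n ≤ N, |coeff n T| ≤ (1 + 3 * A) * M := by
    intro n hn
    rw [hT, map_add, map_sub]
    refine (abs_add_le _ _).trans ?_
    have h1 : |coeff n ((PowerSeries.mk g - PowerSeries.mk g') * F)| ≤ 3 * A * M := by
      refine (abs_coeff_mul_le (α := fun m => M * wt s 1 m) (β := fun _ => A)
        (fun n hn => by simpa using hg n hn) hFA hn).trans ?_
      rw [← sum_mul, sum_antidiagonal_fst (fun m => M * wt s 1 m), ← mul_sum]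
      have := sum_wt_le hs one_pos le_rfl (n + 1)
      calc _ ≤ M * (3 / 1) * A := by gcongr
        _ = _ := by ring
    have h2 : M * wt s 1 n ≤ M := mul_le_of_le_one_right hM (wt_le_one (by linarith) zero_le_one n)
    linarith [hS n hn]
  intro n hn
  rw [← map_sub, hFF]
  have hTb' : ∀ n ≤ N, |coeff n T| ≤ if n = 0 then 0 else (1 + 3 * A) * M := by
    intro n hn
    split_ifs with h
    · rw [h, hT0, abs_zero]
    · exact hTb n hn
  refine (abs_coeff_mul_le hTb' hq hn).trans (le_of_eq ?_)
  rw [← sum_mul, sum_antidiagonal_fst (fun j => if j = 0 then 0 else (1 + 3 * A) * M),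
    sum_range_succ']
  simp; ring

end Renewal

/-! ### Laplacians through second differences, and Fourier series on the cube. -/

section Fourier

open Finset

/-- Symmetric second differences converge to the second derivative. -/
lemma tendsto_second_difference {E : Type*} [NormedAddCommGroup E] [NormedSpace ℝ E] {h : E → ℝ}
    (hh : ContDiffAt ℝ 2 h 0) (v : E) :
    Tendsto (fun t : ℝ => (h (t • v) + h (-t • v) - 2 * h 0) / t ^ 2) (𝓝[>] 0)
      (𝓝 (iteratedFDeriv ℝ 2 h 0 ![v, v])) := by
  have hev : ∀ᶠ k in 𝓝 (0 : E), DifferentiableAt ℝ h k :=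
    (hh.eventually (by simp)).mono fun k hk => hk.differentiableAt (by norm_num)
  have hd2 : DifferentiableAt ℝ (fderiv ℝ h) 0 :=
    (hh.fderiv_right (m := 1) (by norm_num)).differentiableAt (by norm_num)
  have hlin : ∀ c : ℝ, Tendsto (fun t : ℝ => (c * t) • v) (𝓝 0) (𝓝 0) := fun c => by
    have : Continuous fun t : ℝ => (c * t) • v := by fun_prop
    simpa using this.tendsto 0
  let u : ℝ → ℝ := fun t => fderiv ℝ h (t • v) v
  have hder : ∀ t : ℝ, DifferentiableAt ℝ h (t • v) →
      HasDerivAt (fun t : ℝ => h (t • v)) (u t) t := by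
    intro t ht
    have h1 : HasDerivAt (fun t : ℝ => t • v) v t := by
      simpa using (hasDerivAt_id t).smul_const v
    exact ht.hasFDerivAt.comp_hasDerivAt t h1
  have hu : HasDerivAt u (iteratedFDeriv ℝ 2 h 0 ![v, v]) 0 := by
    have h1 : HasDerivAt (fun t : ℝ => t • v) v 0 := by
      simpa using (hasDerivAt_id (0 : ℝ)).smul_const v
    have h2 : HasFDerivAt (fderiv ℝ h) (fderiv ℝ (fderiv ℝ h) 0) ((0 : ℝ) • v) := by
      rw [zero_smul]; exact hd2.hasFDerivAt
    have h3 := h2.comp_hasDerivAt (0 : ℝ) h1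
    rw [iteratedFDeriv_two_apply]
    exact (ContinuousLinearMap.apply ℝ ℝ v).hasFDerivAt.comp_hasDerivAt (0 : ℝ) h3
  have hψ : ∀ᶠ t in 𝓝[>] (0 : ℝ),
      HasDerivAt (fun t : ℝ => h (t • v) + h (-t • v) - 2 * h 0) (u t - u (-t)) t := by
    refine nhdsWithin_le_nhds ?_
    have e1 : ∀ᶠ t in 𝓝 (0 : ℝ), DifferentiableAt ℝ h (t • v) := by
      simpa using (hlin 1).eventually hev
    have e2 : ∀ᶠ t in 𝓝 (0 : ℝ), DifferentiableAt ℝ h (-t • v) := by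
      simpa using (hlin (-1)).eventually hev
    filter_upwards [e1, e2] with t h1 h2
    have h3 := (hder (-t) h2).comp t (hasDerivAt_neg t)
    have h4 := ((hder t h1).add h3).sub_const (2 * h 0)
    exact h4.congr_deriv (by ring)
  have hsq : ∀ᶠ t in 𝓝[>] (0 : ℝ), HasDerivAt (fun t : ℝ => t ^ 2) (2 * t) t :=
    Eventually.of_forall fun t => by simpa using hasDerivAt_pow 2 t
  have hcont : ContinuousAt h 0 := hh.continuousAt
  -- One use of L'Hôpital suffices: the resulting quotient (u(t) - u(-t))/(2t) is a difference
  -- quotient at 0, so the second derivative is needed only at the origin.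
  refine HasDerivAt.lhopital_zero_nhdsGT hψ hsq ?_ ?_ ?_ ?_
  · filter_upwards [self_mem_nhdsWithin] with t ht
    have : (0 : ℝ) < t := ht
    positivity
  · refine tendsto_nhdsWithin_of_tendsto_nhds ?_
    have e1 : Tendsto (fun t : ℝ => h (t • v)) (𝓝 0) (𝓝 (h 0)) := by
      simpa [Function.comp_def] using hcont.tendsto.comp (hlin 1)
    have e2 : Tendsto (fun t : ℝ => h (-t • v)) (𝓝 0) (𝓝 (h 0)) := by
      simpa [Function.comp_def] using hcont.tendsto.comp (hlin (-1))
    have := (e1.add e2).sub_const (2 * h 0)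
    rwa [show h 0 + h 0 - 2 * h 0 = 0 by ring] at this
  · refine tendsto_nhdsWithin_of_tendsto_nhds ?_
    have : Continuous fun t : ℝ => t ^ 2 := by fun_prop
    simpa using this.tendsto 0
  · have h1 : HasDerivAt (fun t => u t - u (-t)) (2 * iteratedFDeriv ℝ 2 h 0 ![v, v]) 0 := by
      have hneg : HasDerivAt (fun t => u (-t)) (-iteratedFDeriv ℝ 2 h 0 ![v, v]) 0 := by
        have := HasDerivAt.comp (0 : ℝ) (h₂ := u) (by simpa using hu) (hasDerivAt_neg (0 : ℝ))
        simpa [Function.comp_def] using this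
      exact (hu.sub hneg).congr_deriv (by ring)
    have h2 := (hasDerivAt_iff_tendsto_slope.1 h1).mono_left
      (nhdsWithin_mono _ (fun t (ht : 0 < t) => ht.ne' : Set.Ioi (0 : ℝ) ⊆ {0}ᶜ))
    have h3 := h2.div_const 2
    rw [mul_div_cancel_left₀ _ two_ne_zero] at h3
    refine h3.congr fun t => ?_
    simp [slope_def_field]
    ring

/-- The sum over coordinate directions of the second differences of `h` at the origin. -/
def secondDiff {d : ℕ} (h : Dual d → ℝ) (t : ℝ) : ℝ :=
  ∑ i, (h (t • EuclideanSpace.basisFun (Fin d) ℝ i) +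
    h (-t • EuclideanSpace.basisFun (Fin d) ℝ i) - 2 * h 0)

lemma tendsto_secondDiff {d : ℕ} {h : Dual d → ℝ} (hh : ContDiffAt ℝ 2 h 0) :
    Tendsto (fun t : ℝ => secondDiff h t / t ^ 2) (𝓝[>] 0) (𝓝 (lapZero h)) := by
  have e : lapZero h = ∑ i, iteratedFDeriv ℝ 2 h 0
      ![EuclideanSpace.basisFun (Fin d) ℝ i, EuclideanSpace.basisFun (Fin d) ℝ i] := by
    unfold lapZero
    rw [InnerProductSpace.laplacian_eq_iteratedFDeriv_orthonormalBasis h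
      (EuclideanSpace.basisFun (Fin d) ℝ)]
  rw [e]
  simp only [secondDiff, sum_div]
  exact tendsto_finsetSum _ fun i _ => tendsto_second_difference hh _

/-- Domination of increments by `M a(k)` gives domination of the Laplacian by `M σ²`. -/
lemma abs_lapZero_le {d : ℕ} {D : (Fin d → ℤ) → ℝ} {h : Dual d → ℝ} {M : ℝ}
    (hh : ContDiffAt ℝ 2 h 0) (hD : ContDiffAt ℝ 2 (Dhat D) 0) (hD0 : Dhat D 0 = 1)
    (hM : ∀ᶠ k in 𝓝 (0 : Dual d), |h k - h 0| ≤ M * a D k) :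
    |lapZero h| ≤ M * sigmaSq D := by
  have h1 := (tendsto_secondDiff hh).abs
  have h2 := ((tendsto_secondDiff hD).neg).const_mul M
  refine le_of_tendsto_of_tendsto h1 h2 ?_
  have hlin : ∀ (c : ℝ) (v : Dual d), Tendsto (fun t : ℝ => (c * t) • v) (𝓝[>] 0) (𝓝 0) :=
    fun c v => by
      have : Continuous fun t : ℝ => (c * t) • v := by fun_prop
      exact tendsto_nhdsWithin_of_tendsto_nhds (by simpa using this.tendsto 0)
  have hE : ∀ i : Fin d, ∀ᶠ t in 𝓝[>] (0 : ℝ),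
      |h (t • EuclideanSpace.basisFun (Fin d) ℝ i) - h 0| ≤
        M * a D (t • EuclideanSpace.basisFun (Fin d) ℝ i) ∧
      |h (-t • EuclideanSpace.basisFun (Fin d) ℝ i) - h 0| ≤
        M * a D (-t • EuclideanSpace.basisFun (Fin d) ℝ i) := fun i => by
    have e1 := (hlin 1 (EuclideanSpace.basisFun (Fin d) ℝ i)).eventually hM
    have e2 := (hlin (-1) (EuclideanSpace.basisFun (Fin d) ℝ i)).eventually hM
    simp only [one_mul, neg_one_mul] at e1 e2
    exact e1.and e2
  filter_upwards [eventually_all.2 hE, self_mem_nhdsWithin] with t ht ht0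
  have ht0 : (0 : ℝ) < t := ht0
  rw [abs_div, abs_of_pos (by positivity : (0 : ℝ) < t ^ 2), ← neg_div, ← mul_div_assoc]
  gcongr
  unfold secondDiff
  rw [← sum_neg_distrib, mul_sum]
  refine (abs_sum_le_sum_abs _ _).trans (sum_le_sum fun i _ => ?_)
  obtain ⟨q1, q2⟩ := ht i
  have := abs_add_le (h (t • EuclideanSpace.basisFun (Fin d) ℝ i) - h 0)
    (h (-t • EuclideanSpace.basisFun (Fin d) ℝ i) - h 0)
  rw [show h (t • EuclideanSpace.basisFun (Fin d) ℝ i) - h 0 +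
    (h (-t • EuclideanSpace.basisFun (Fin d) ℝ i) - h 0) =
    h (t • EuclideanSpace.basisFun (Fin d) ℝ i) +
      h (-t • EuclideanSpace.basisFun (Fin d) ℝ i) - 2 * h 0 by ring] at this
  refine this.trans ((add_le_add q1 q2).trans (le_of_eq ?_))
  -- Since D̂(0) = 1, the sum a(te_i) + a(-te_i) is minus the second difference of D̂; in the limit
  -- this produces σ².
  simp only [a, hD0]; ring

/-- The character `k ↦ exp(i k·x)`. -/
def chi {d : ℕ} (x : Fin d → ℤ) (k : Dual d) : ℂ :=
  Complex.exp (Complex.I * ((∑ i, k i * (x i : ℝ) : ℝ) : ℂ))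

lemma fourier_eq {d : ℕ} (D : (Fin d → ℤ) → ℝ) (k : Dual d) :
    fourier D k = ∑' x, (D x : ℂ) * chi x k := rfl

lemma norm_chi {d : ℕ} (x : Fin d → ℤ) (k : Dual d) : ‖chi x k‖ = 1 := by
  unfold chi; rw [mul_comm]; exact Complex.norm_exp_ofReal_mul_I _

lemma continuous_chi {d : ℕ} (x : Fin d → ℤ) : Continuous (chi x) := by
  unfold chi; fun_prop

lemma chi_mul_chi {d : ℕ} (x y : Fin d → ℤ) (k : Dual d) : chi x k * chi y k = chi (x + y) k := by
  unfold chi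
  rw [← Complex.exp_add, ← mul_add, ← Complex.ofReal_add, ← sum_add_distrib]
  congr 3
  exact sum_congr rfl fun i _ => by simp; ring

lemma cube_eq_preimage (d : ℕ) :
    cube d = WithLp.ofLp ⁻¹' (Set.univ.pi fun _ : Fin d => Set.Icc (-Real.pi) Real.pi) := by
  ext k
  simp only [cube, Set.mem_ofPred_eq, Set.mem_preimage, Set.mem_univ_pi, Set.mem_Icc, abs_le]

lemma measurableSet_cube (d : ℕ) : MeasurableSet (cube d) := by
  rw [cube_eq_preimage]
  exact (MeasurableSet.univ_pi fun _ => measurableSet_Icc).preimage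
    (PiLp.volume_preserving_ofLp (Fin d)).measurable

lemma integral_char_one (n : ℤ) :
    ∫ t in Set.Icc (-Real.pi) Real.pi, Complex.exp (Complex.I * ((t * (n : ℝ) : ℝ) : ℂ)) =
      if n = 0 then ((2 * Real.pi : ℝ) : ℂ) else 0 := by
  have hπ := Real.pi_pos
  rw [integral_Icc_eq_integral_Ioc, ← intervalIntegral.integral_of_le (by linarith)]
  split_ifs with hn
  · subst hn
    simp; ring
  · have e : (fun t : ℝ => Complex.exp (Complex.I * ((t * (n : ℝ) : ℝ) : ℂ))) =
        fun t : ℝ => Complex.exp ((Complex.I * n) * (t : ℂ)) := by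
      ext t; congr 1; push_cast; ring
    rw [e, integral_exp_mul_complex (by simp [hn])]
    have h1 : Complex.exp (Complex.I * n * (Real.pi : ℝ)) =
        Complex.exp (Complex.I * n * ((-Real.pi : ℝ) : ℂ)) := by
      rw [Complex.exp_eq_exp_iff_exists_int]
      exact ⟨n, by push_cast; ring⟩
    rw [h1, sub_self, zero_div]

lemma integral_chi {d : ℕ} (x : Fin d → ℤ) :
    ∫ k in cube d, chi x k = if x = 0 then (((2 * Real.pi) ^ d : ℝ) : ℂ) else 0 := by
  have h1 : ∫ k in cube d, chi x k =
      ∫ k in Set.univ.pi (fun _ : Fin d => Set.Icc (-Real.pi) Real.pi),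
        ∏ i, Complex.exp (Complex.I * ((k i * (x i : ℝ) : ℝ) : ℂ)) := by
    rw [cube_eq_preimage]
    rw [← (PiLp.volume_preserving_ofLp (Fin d)).setIntegral_preimage_emb
      (MeasurableEquiv.toLp 2 (Fin d → ℝ)).symm.measurableEmbedding]
    refine setIntegral_congr_fun ?_ fun k _ => ?_
    · exact (MeasurableSet.univ_pi fun _ => measurableSet_Icc).preimage
        (PiLp.volume_preserving_ofLp (Fin d)).measurable
    · simp only [chi]
      rw [← Complex.exp_sum, ← mul_sum]
      push_cast
      rfl
  rw [h1, volume_pi, Measure.restrict_pi_pi, integral_fintype_prod_eq_prod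
    (fun i (t : ℝ) => Complex.exp (Complex.I * ((t * (x i : ℝ) : ℝ) : ℂ)))]
  simp only [integral_char_one]
  split_ifs with hx
  · subst hx; simp
  · obtain ⟨i, hi⟩ := Function.ne_iff.1 hx
    exact prod_eq_zero (mem_univ i) (by rw [if_neg]; simpa using hi)

instance isFiniteMeasure_cube (d : ℕ) : IsFiniteMeasure (volume.restrict (cube d)) := by
  constructor
  rw [Measure.restrict_apply_univ, cube_eq_preimage,
    (PiLp.volume_preserving_ofLp (Fin d)).measure_preimage
      (MeasurableSet.univ_pi fun _ => measurableSet_Icc).nullMeasurableSet, volume_pi, Measure.pi_pi]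
  exact ENNReal.prod_lt_top fun i _ => by simp

section Parseval

variable {d : ℕ} {D : (Fin d → ℤ) → ℝ}

lemma norm_mul_chi (hD : ∀ x, 0 ≤ D x) (x : Fin d → ℤ) (k : Dual d) :
    ‖(D x : ℂ) * chi x k‖ = D x := by
  rw [norm_mul, norm_chi, mul_one, Complex.norm_real, Real.norm_of_nonneg (hD x)]

lemma continuous_fourier (hD : ∀ x, 0 ≤ D x) (hs : Summable D) : Continuous (fourier D) :=
  continuous_tsum (fun x => continuous_const.mul (continuous_chi x)) hs
    fun x k => (norm_mul_chi hD x k).le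

lemma norm_fourier_le (hD : ∀ x, 0 ≤ D x) (hs : HasSum D 1) (k : Dual d) : ‖fourier D k‖ ≤ 1 := by
  rw [fourier_eq, ← hs.tsum_eq]
  refine (norm_tsum_le_tsum_norm (by simpa only [norm_mul_chi hD] using hs.summable)).trans ?_
  simp only [norm_mul_chi hD, le_refl]

lemma continuous_Dhat (hD : ∀ x, 0 ≤ D x) (hs : Summable D) : Continuous (Dhat D) :=
  Complex.continuous_re.comp (continuous_fourier hD hs)

lemma abs_Dhat_le (hD : ∀ x, 0 ≤ D x) (hs : HasSum D 1) (k : Dual d) : |Dhat D k| ≤ 1 :=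
  (Complex.abs_re_le_norm _).trans (norm_fourier_le hD hs k)

lemma Dhat_zero (hs : HasSum D 1) : Dhat D 0 = 1 := by
  have : fourier D 0 = ((1 : ℝ) : ℂ) := by
    rw [← hs.tsum_eq, Complex.ofReal_tsum]
    simp [fourier]
  rw [Dhat, this, Complex.ofReal_re]

/-- Integrating the Fourier series against a bounded continuous function term by term. -/
lemma hasSum_integral_fourier_mul (hD : ∀ x, 0 ≤ D x) (hs : Summable D) {φ : Dual d → ℂ}
    (hφ : Continuous φ) (hφ1 : ∀ k, ‖φ k‖ ≤ 1) :
    HasSum (fun x => (D x : ℂ) * ∫ k in cube d, chi x k * φ k)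
      (∫ k in cube d, fourier D k * φ k) := by
  have hb : ∀ x k, ‖(D x : ℂ) * chi x k * φ k‖ ≤ D x := fun x k => by
    rw [norm_mul, norm_mul_chi hD]
    exact mul_le_of_le_one_right (hD x) (hφ1 k)
  have hint : ∀ x, Integrable (fun k => (D x : ℂ) * chi x k * φ k) (volume.restrict (cube d)) :=
    fun x => Integrable.of_bound
      ((continuous_const.mul (continuous_chi x)).mul hφ).aestronglyMeasurable (D x)
      (Eventually.of_forall (hb x))
  have hsum : Summable fun x =>
      ∫ k, ‖(D x : ℂ) * chi x k * φ k‖ ∂(volume.restrict (cube d)) := by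
    refine Summable.of_nonneg_of_le (fun x => integral_nonneg fun k => norm_nonneg _) (fun x => ?_)
      (hs.mul_right ((volume.restrict (cube d)).real Set.univ))
    calc _ ≤ ∫ _, D x ∂(volume.restrict (cube d)) :=
          integral_mono (hint x).norm (integrable_const _) (hb x)
      _ = _ := by rw [integral_const, smul_eq_mul, mul_comm]
  have h := hasSum_integral_of_summable_integral_norm hint hsum
  simp only [fourier_eq, ← tsum_mul_right, ← integral_const_mul, ← mul_assoc]
  exact h

lemma integral_fourier_mul_chi (hD : ∀ x, 0 ≤ D x) (hs : Summable D) (y : Fin d → ℤ) :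
    ∫ k in cube d, chi y k * fourier D k = (((2 * Real.pi) ^ d * D (-y) : ℝ) : ℂ) := by
  have h := hasSum_integral_fourier_mul hD hs (continuous_chi y) fun k => (norm_chi y k).le
  simp only [chi_mul_chi, integral_chi] at h
  have h2 : HasSum (fun x => (D x : ℂ) * if x + y = 0 then (((2 * Real.pi) ^ d : ℝ) : ℂ) else 0)
      ((D (-y) : ℂ) * if -y + y = 0 then (((2 * Real.pi) ^ d : ℝ) : ℂ) else 0) :=
    hasSum_single (-y) fun x hx => by
      rw [if_neg, mul_zero]
      intro h; exact hx (eq_neg_of_add_eq_zero_left h)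
  have h3 := h.unique h2
  simp only [mul_comm (chi y _)]
  rw [h3]
  simp; ring

/-- One half of Parseval's identity for a real Fourier transform, with a supremum bound. -/
lemma lintegral_Dhat_sq_le (hD : ∀ x, 0 ≤ D x) (hs : HasSum D 1) {B : ℝ} (hB : ∀ x, D x ≤ B)
    (hreal : ∀ k ∈ cube d, fourier D k = (Dhat D k : ℂ)) :
    ∫⁻ k in cube d, ‖Dhat D k ^ 2‖ₑ ≤ ENNReal.ofReal ((2 * Real.pi) ^ d * B) := by
  have hDc := continuous_Dhat hD hs.summable
  have hint : Integrable (fun k => Dhat D k ^ 2) (volume.restrict (cube d)) :=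
    Integrable.of_bound (hDc.pow 2).aestronglyMeasurable 1 (Eventually.of_forall fun k => by
      rw [norm_pow, Real.norm_eq_abs]
      exact pow_le_one₀ (abs_nonneg _) (abs_Dhat_le hD hs k))
  rw [← ofReal_integral_norm_eq_lintegral_enorm hint]
  refine ENNReal.ofReal_le_ofReal ?_
  have e1 : ∫ k in cube d, ‖Dhat D k ^ 2‖ = ∫ k in cube d, Dhat D k ^ 2 := by
    congr 1; ext k; exact Real.norm_of_nonneg (sq_nonneg _)
  rw [e1]
  -- Pairing D̂ with itself and using orthogonality leaves (2π)^d ∑ D(x)D(-x). One factor is bounded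
  -- by B and the other sums to 1; no symmetry of D is needed.
  have h := hasSum_integral_fourier_mul hD hs.summable (continuous_fourier hD hs.summable)
    (norm_fourier_le hD hs)
  simp only [integral_fourier_mul_chi hD hs.summable] at h
  have e2 : ∫ k in cube d, fourier D k * fourier D k = ((∫ k in cube d, Dhat D k ^ 2 : ℝ) : ℂ) := by
    rw [← integral_complex_ofReal]
    refine setIntegral_congr_fun (measurableSet_cube d) fun k hk => ?_
    simp only [hreal k hk]
    push_cast; ring
  rw [e2] at h
  have h2 : HasSum (fun x => D x * ((2 * Real.pi) ^ d * D (-x))) (∫ k in cube d, Dhat D k ^ 2) := by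
    rw [← Complex.hasSum_ofReal]
    simpa using h
  have h3 := hs.mul_right ((2 * Real.pi) ^ d * B)
  rw [one_mul] at h3
  refine hasSum_le (fun x => ?_) h2 h3
  have := hD x
  have := hB (-x)
  gcongr

end Parseval

end Fourier

/-! ### Integrals over `k` of the Green function decay. -/

section Scaling

open Finset

lemma lintegral_comp_smul {d : ℕ} (φ : Dual d → ℝ≥0∞) {r : ℝ} (hr : 0 < r) :
    ∫⁻ k, φ (r • k) = ENNReal.ofReal ((r ^ d)⁻¹) * ∫⁻ k, φ k := by
  have h1 := Measure.map_addHaar_smul (volume : Measure (Dual d)) hr.ne'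
  have h2 := (measurableEmbedding_const_smul₀ (α := Dual d) hr.ne').lintegral_map
    (μ := volume) φ
  rw [← h2, h1, lintegral_smul_measure, finrank_euclideanSpace_fin, abs_of_pos (by positivity)]
  rfl

/-- In polar coordinates the integrand is r^{-1/2}. Without the exponent 1/4 it would be r^{-1},
which diverges logarithmically. -/
lemma integrableOn_norm_sq_rpow {d : ℕ} (hd : 0 < d) (r : ℝ) :
    IntegrableOn (fun k : Dual d => (‖k‖ ^ 2) ^ (1 / 4 - (d : ℝ) / 2)) (Metric.ball 0 r) := by
  have : Nonempty (Fin d) := ⟨⟨0, hd⟩⟩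
  rw [integrableOn_fun_norm_addHaar (volume : Measure (Dual d))
    (f := fun y : ℝ => (y ^ 2) ^ (1 / 4 - (d : ℝ) / 2)), finrank_euclideanSpace_fin]
  rcases le_or_gt r 0 with hr | hr
  · simp [Set.Ioo_eq_empty_of_le hr]
  refine ((intervalIntegral.integrableOn_Ioo_rpow_iff hr (s := -1 / 2)).2 (by norm_num)).congr_fun
    (fun y hy => ?_) measurableSet_Ioo
  have hy0 : 0 < y := hy.1
  simp only [smul_eq_mul]
  rw [← Real.rpow_natCast, ← Real.rpow_natCast, ← Real.rpow_mul hy0.le, ← Real.rpow_add hy0]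
  congr 1
  rw [Nat.cast_sub hd]; push_cast; ring

/-- Scaling `k` by √c L in the first term of `greenTail`, where n^{-d/2} is already explicit, and by
√(cn) L in the second, reduces both to fixed finite integrals times L^{-d} n^{-d/2}. -/
lemma exists_lintegral_greenTail_le {d : ℕ} (hd : 0 < d) {c : ℝ} (hc : 0 < c) (ρ : ℝ) :
    ∃ B : ℝ, 0 ≤ B ∧ ∀ L : ℝ, 0 < L → ∀ n : ℕ, 1 ≤ n →
      ∫⁻ k in Metric.ball (0 : Dual d) (ρ / L),
        ENNReal.ofReal (greenTail ((d : ℝ) / 2) (c * L ^ 2 * ‖k‖ ^ 2) n) ≤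
      ENNReal.ofReal (B * beta d L * (n : ℝ) ^ (-(d : ℝ) / 2)) := by
  let φ₁ : Dual d → ℝ≥0∞ := (Metric.ball (0 : Dual d) (√c * ρ)).indicator
    fun k => ENNReal.ofReal ((‖k‖ ^ 2) ^ (1 / 4 - (d : ℝ) / 2))
  let φ₂ : Dual d → ℝ≥0∞ := fun k => ENNReal.ofReal ((1 + ‖k‖ ^ 2) ^ (-((d : ℝ) / 2 + 1)))
  have hφ₁ : ∫⁻ k, φ₁ k ≠ ∞ := by
    have h := (integrableOn_norm_sq_rpow hd (√c * ρ)).lintegral_lt_top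
    rw [lintegral_indicator measurableSet_ball]
    exact h.ne
  have hφ₂ : ∫⁻ k, φ₂ k ≠ ∞ := by
    have h := (integrable_rpow_neg_one_add_norm_sq (E := Dual d) (μ := volume) (r := d + 2)
      (by rw [finrank_euclideanSpace_fin]; linarith)).lintegral_lt_top
    refine ne_of_lt (lt_of_le_of_lt (le_of_eq ?_) h)
    congr 1; ext k
    simp only [φ₂]
    congr 2; ring
  have hsc : 0 < √c := Real.sqrt_pos.2 hc
  set I₁ := (∫⁻ k, φ₁ k).toReal
  set I₂ := (∫⁻ k, φ₂ k).toReal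
  refine ⟨(√c ^ d)⁻¹ * I₁ + (√c ^ d)⁻¹ * I₂, by positivity, fun L hL n hn => ?_⟩
  have hn0 : (0 : ℝ) < n := by exact_mod_cast hn
  have hsn : 0 < √(n : ℝ) := Real.sqrt_pos.2 hn0
  have hnpow : (√(n : ℝ) ^ d)⁻¹ = (n : ℝ) ^ (-(d : ℝ) / 2) := by
    rw [Real.sqrt_eq_rpow, ← Real.rpow_natCast, ← Real.rpow_mul hn0.le, ← Real.rpow_neg hn0.le]
    congr 1; ring
  set ν := (n : ℝ) ^ (-(d : ℝ) / 2) with hν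
  have hν0 : 0 < ν := by positivity
  have hsplit : ∀ k ∈ Metric.ball (0 : Dual d) (ρ / L),
      ENNReal.ofReal (greenTail ((d : ℝ) / 2) (c * L ^ 2 * ‖k‖ ^ 2) n) ≤
      ENNReal.ofReal ν * φ₁ ((√c * L) • k) + φ₂ ((√c * L * √(n : ℝ)) • k) := by
    intro k hk
    rw [mem_ball_zero_iff, lt_div_iff₀ hL] at hk
    have e1 : ‖(√c * L) • k‖ ^ 2 = c * L ^ 2 * ‖k‖ ^ 2 := by
      rw [norm_smul, Real.norm_of_nonneg (by positivity), mul_pow, mul_pow, Real.sq_sqrt hc.le]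
    have e2 : ‖(√c * L * √(n : ℝ)) • k‖ ^ 2 = c * L ^ 2 * ‖k‖ ^ 2 * n := by
      rw [norm_smul, Real.norm_of_nonneg (by positivity), mul_pow, mul_pow, mul_pow,
        Real.sq_sqrt hc.le, Real.sq_sqrt hn0.le]; ring
    have hmem : (√c * L) • k ∈ Metric.ball (0 : Dual d) (√c * ρ) := by
      rw [mem_ball_zero_iff, norm_smul, Real.norm_of_nonneg (by positivity)]
      nlinarith
    simp only [φ₁, φ₂, Set.indicator_of_mem hmem, e1, e2, greenTail, wt]
    rw [← ENNReal.ofReal_mul hν0.le, ← ENNReal.ofReal_add (by positivity) (by positivity), hν,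
      neg_div]
  have hm₁ : Measurable φ₁ := by
    refine Measurable.indicator ?_ measurableSet_ball
    fun_prop
  calc _ ≤ ∫⁻ k in Metric.ball (0 : Dual d) (ρ / L),
        (ENNReal.ofReal ν * φ₁ ((√c * L) • k) + φ₂ ((√c * L * √(n : ℝ)) • k)) :=
        setLIntegral_mono' measurableSet_ball hsplit
    _ ≤ ∫⁻ k, (ENNReal.ofReal ν * φ₁ ((√c * L) • k) + φ₂ ((√c * L * √(n : ℝ)) • k)) :=
        setLIntegral_le_lintegral _ _
    _ = ENNReal.ofReal ν * (ENNReal.ofReal (((√c * L) ^ d)⁻¹) * ∫⁻ k, φ₁ k) +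
        ENNReal.ofReal (((√c * L * √(n : ℝ)) ^ d)⁻¹) * ∫⁻ k, φ₂ k := by
        have hm : Measurable fun k : Dual d => φ₁ ((√c * L) • k) :=
          hm₁.comp (measurable_const_smul _)
        rw [lintegral_add_left (hm.const_mul _), lintegral_const_mul _ hm,
          lintegral_comp_smul φ₁ (by positivity), lintegral_comp_smul φ₂ (by positivity)]
    _ = ENNReal.ofReal (ν * (((√c * L) ^ d)⁻¹ * I₁) + ((√c * L * √(n : ℝ)) ^ d)⁻¹ * I₂) := by
        rw [← ENNReal.ofReal_toReal hφ₁, ← ENNReal.ofReal_toReal hφ₂,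
          ← ENNReal.ofReal_mul (by positivity), ← ENNReal.ofReal_mul (by positivity),
          ← ENNReal.ofReal_mul (by positivity), ← ENNReal.ofReal_add (by positivity) (by positivity)]
    _ = _ := by
        congr 1
        rw [mul_pow, mul_pow, mul_pow, mul_inv, mul_inv, mul_inv, hnpow, beta]
        ring

end Scaling

/-! ### The recursion as a renewal equation, and consequences of the assumption on D. -/

section Kernel

open Finset

section Sequences

variable {d : ℕ} {f g e : ℕ → Dual d → ℝ → ℝ}

/-- The kernel of the recursion at fixed `k` and `z`, extended by zero. -/
def kernelSeq (g : ℕ → Dual d → ℝ → ℝ) (k : Dual d) (z : ℝ) (m : ℕ) : ℝ :=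
  if m = 0 then 0 else g m k z

/-- The source term of the recursion at fixed `k` and `z`, including the initial value. -/
def sourceSeq (e : ℕ → Dual d → ℝ → ℝ) (k : Dual d) (z : ℝ) (n : ℕ) : ℝ :=
  if n = 0 then 1 else e n k z

lemma Recursion.eq_antidiagonal (h : Recursion f g e) {z : ℝ} (hz : 0 < z) {k : Dual d}
    (hk : k ∈ cube d) (n : ℕ) :
    f n k z = sourceSeq e k z n +
      ∑ p ∈ antidiagonal n, kernelSeq g k z p.1 * f p.2 k z := by
  obtain ⟨h0, h1⟩ := h z hz k hk
  cases n with
  | zero => simp [sourceSeq, kernelSeq, h0]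
  | succ n =>
    rw [h1 n, Nat.sum_antidiagonal_eq_sum_range_succ_mk, add_comm (sourceSeq e k z (n + 1))]
    congr 1
    have hsub : Icc 1 (n + 1) ⊆ range (n + 1 + 1) := fun m hm => by
      rw [mem_Icc] at hm; rw [mem_range]; omega
    rw [← sum_subset hsub]
    · refine sum_congr rfl fun m hm => ?_
      rw [mem_Icc] at hm
      simp [kernelSeq, show m ≠ 0 by omega]
    · intro m _ hm
      have : m = 0 := by
        by_contra h
        exact hm (by rw [mem_Icc]; simp only [mem_range] at *; omega)
      simp [kernelSeq, this]

lemma Recursion.powerSeries (h : Recursion f g e) {z : ℝ} (hz : 0 < z) {k : Dual d}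
    (hk : k ∈ cube d) :
    (1 - PowerSeries.mk (kernelSeq g k z)) * PowerSeries.mk (fun n => f n k z) =
      PowerSeries.mk (sourceSeq e k z) := by
  ext n
  rw [sub_mul, one_mul, map_sub, PowerSeries.coeff_mul]
  simp only [PowerSeries.coeff_mk]
  rw [h.eq_antidiagonal hz hk n]
  ring

lemma zero_mem_cube (d : ℕ) : (0 : Dual d) ∈ cube d := fun i => by simpa using Real.pi_pos.le

lemma cube_mem_nhds (d : ℕ) : cube d ∈ 𝓝 (0 : Dual d) := by
  refine mem_of_superset (Metric.ball_mem_nhds 0 Real.pi_pos) fun k hk i => ?_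
  rw [mem_ball_zero_iff] at hk
  exact (PiLp.norm_apply_le k i).trans hk.le

variable {ε C c₁ c₂ η L : ℝ} {D : (Fin d → ℤ) → ℝ}

lemma AssumptionD.fourier_eq_Dhat (h : AssumptionD ε C c₁ c₂ η L D f e) {k : Dual d}
    (hk : k ∈ cube d) : fourier D k = (Dhat D k : ℂ) := by
  have h1 := h.f_one 1 one_pos k hk
  rw [Complex.ofReal_one, one_mul] at h1
  rw [Dhat, ← h1, Complex.ofReal_re]

lemma AssumptionD.f_one_eq (h : AssumptionD ε C c₁ c₂ η L D f e) {k : Dual d}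
    (hk : k ∈ cube d) {z : ℝ} (hz : 0 < z) : f 1 k z = z * Dhat D k := by
  have h1 := h.f_one z hz k hk
  rw [h.fourier_eq_Dhat hk] at h1
  exact_mod_cast h1

lemma AssumptionD.g_one_eq (h : AssumptionD ε C c₁ c₂ η L D f e) (hr : Recursion f g e)
    {k : Dual d} (hk : k ∈ cube d) {z : ℝ} (hz : 0 < z) : g 1 k z = z * Dhat D k := by
  obtain ⟨h0, h1⟩ := hr z hz k hk
  have h2 := h1 0
  simp only [zero_add, Icc_self, sum_singleton, Nat.sub_self, h0, mul_one,
    h.e_one z hz k hk, add_zero] at h2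
  rw [← h2, h.f_one_eq hk hz]

lemma AssumptionD.contDiffAt_Dhat (h : AssumptionD ε C c₁ c₂ η L D f e)
    (hS : AssumptionS f g e) : ContDiffAt ℝ 2 (Dhat D) 0 := by
  refine (hS.smooth_f 1 1 one_pos).congr_of_eventuallyEq ?_
  filter_upwards [cube_mem_nhds d] with k hk
  rw [h.f_one_eq hk one_pos, one_mul]

lemma AssumptionD.Dhat_zero (h : AssumptionD ε C c₁ c₂ η L D f e) : Dhat D 0 = 1 :=
  LaceRec.Dhat_zero h.normalised

lemma AssumptionD.a_nonneg (h : AssumptionD ε C c₁ c₂ η L D f e) (k : Dual d) : 0 ≤ a D k := by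
  have := abs_le.1 (abs_Dhat_le h.nonneg h.normalised k)
  unfold a; linarith

/-- The zero function has increments dominated by a(k) ≥ 0, so the Laplacian comparison with M = 1
reads 0 ≤ σ². -/
lemma AssumptionD.sigmaSq_nonneg (h : AssumptionD ε C c₁ c₂ η L D f e)
    (hS : AssumptionS f g e) : 0 ≤ sigmaSq D := by
  have := abs_lapZero_le (D := D) (h := fun _ => (0 : ℝ)) (M := 1) contDiffAt_const
    (h.contDiffAt_Dhat hS) h.Dhat_zero (Eventually.of_forall fun k => by
      simpa using h.a_nonneg k)
  rw [one_mul] at this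
  exact (abs_nonneg _).trans this

end Sequences

/-- Smallness with parameter `b` of `e_m` and `g_m`, `2 ≤ m ≤ N`, at a nearly critical `z`. -/
structure Controlled {d : ℕ} (b : ℝ) (D : (Fin d → ℤ) → ℝ) (g e : ℕ → Dual d → ℝ → ℝ)
    (N : ℕ) (z : ℝ) : Prop where
  near_one : |z - 1| ≤ b
  e_sup : ∀ m ≤ N, 2 ≤ m → ∀ k ∈ cube d, |e m k z| ≤ b * (m : ℝ) ^ (-((d : ℝ) / 2))
  e_diff : ∀ m ≤ N, 2 ≤ m → ∀ k ∈ cube d,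
    |e m k z - e m 0 z| ≤ b * a D k * (m : ℝ) ^ (-((d : ℝ) / 2 - 1))
  g_sup : ∀ m ≤ N, 2 ≤ m → ∀ k ∈ cube d, |g m k z| ≤ b * (m : ℝ) ^ (-((d : ℝ) / 2))
  g_diff : ∀ m ≤ N, 2 ≤ m → ∀ k ∈ cube d,
    |g m k z - g m 0 z| ≤ b * a D k * (m : ℝ) ^ (-((d : ℝ) / 2 - 1))
  crit : |1 - ∑ m ∈ Icc 1 N, g m 0 z| ≤ b * (N : ℝ) ^ (-((d : ℝ) / 2 - 1))

lemma sum_range_kernelSeq {d : ℕ} (g : ℕ → Dual d → ℝ → ℝ) (k : Dual d) (z : ℝ) (N : ℕ) :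
    ∑ m ∈ range (N + 1), kernelSeq g k z m = ∑ m ∈ Icc 1 N, g m k z := by
  induction N with
  | zero => simp [kernelSeq]
  | succ N ih =>
    rw [sum_range_succ, ih, sum_Icc_succ_top (by omega)]
    simp [kernelSeq]

/-- Follows from 1 + 1/x ≤ (1 + 1/x)^{θ-1}, valid as θ ≥ 2. It telescopes tails of the kernel and
also makes the induction intervals nested. -/
lemma rpow_succ_le_sub {θ x : ℝ} (hθ : 2 ≤ θ) (hx : 0 < x) :
    (x + 1) ^ (-θ) ≤ x ^ (-(θ - 1)) - (x + 1) ^ (-(θ - 1)) := by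
  have hx1 : 0 < x + 1 := by linarith
  have h1 : (x + 1) ^ (-(θ - 1)) = (x + 1) ^ (-θ) * (x + 1) := by
    nth_rw 3 [← Real.rpow_one (x + 1)]
    rw [← Real.rpow_add hx1]; congr 1; ring
  have h2 : 1 + 1 / x ≤ (1 + 1 / x) ^ (θ - 1) :=
    Real.self_le_rpow_of_one_le (by have : 0 < 1 / x := by positivity
                                    linarith) (by linarith)
  have h3 : x ^ (-(θ - 1)) = (x + 1) ^ (-(θ - 1)) * (1 + 1 / x) ^ (θ - 1) := by
    have : 1 + 1 / x = (x + 1) / x := by field_simp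
    rw [this, Real.div_rpow hx1.le hx.le, Real.rpow_neg hx1.le, Real.rpow_neg hx.le]
    field_simp
  have h4 : 0 < (x + 1) ^ (-θ) := by positivity
  have h5 : (x + 1) ^ (-(θ - 1)) * (1 + 1 / x) ≤ x ^ (-(θ - 1)) := by
    rw [h3]; gcongr
  rw [h1] at h5 ⊢
  have h6 : (x + 1) ^ (-θ) * (x + 1) * (1 + 1 / x) =
      (x + 1) ^ (-θ) * (x + 1) + (x + 1) ^ (-θ) + (x + 1) ^ (-θ) / x := by
    field_simp
    ring
  have h7 : 0 < (x + 1) ^ (-θ) / x := by positivity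
  linarith

lemma sum_Ico_wt_le {θ : ℝ} (hθ : 2 ≤ θ) (j N : ℕ) :
    ∑ m ∈ Ico (j + 1) (N + 1), wt θ 1 m ≤ wt (θ - 1) 1 j := by
  rcases Nat.lt_or_ge N j with h | h
  · rw [Ico_eq_empty (by omega)]; simpa using (wt_pos _ zero_le_one j).le
  suffices H : ∑ m ∈ Ico (j + 1) (N + 1), wt θ 1 m ≤ wt (θ - 1) 1 j - wt (θ - 1) 1 N from
    H.trans (by linarith [wt_pos (θ - 1) zero_le_one N])
  induction N, h using Nat.le_induction with
  | base => simp
  | succ N hN ih =>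
    rw [sum_Ico_succ_top (by omega)]
    have h := rpow_succ_le_sub hθ (x := 1 + (N : ℝ)) (by positivity)
    have h2 : wt θ 1 (N + 1) ≤ wt (θ - 1) 1 N - wt (θ - 1) 1 (N + 1) := by
      unfold wt
      push_cast
      simpa [add_assoc] using h
    linarith

end Kernel

/-! ### The kernel at `k` as a renewal kernel with mass defect comparable to a(k). -/

section KernelBounds

open Finset

/-- The smallness needed of the parameter in `Controlled` for the renewal bounds. -/
def controlConst (θ : ℝ) : ℝ := smallness θ / (12 * 2 ^ (θ + 1))

lemma controlConst_pos {θ : ℝ} (hθ : 5 / 2 ≤ θ) : 0 < controlConst θ := by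
  have := smallness_pos hθ
  unfold controlConst; positivity

/-- The four inequalities serve in turn the smallness of the kernel tail, the normalisation of the
source, the comparison of the mass defect with a(k), and the closeness of z to 1. -/
lemma controlConst_mul_le {θ : ℝ} (hθ : 5 / 2 ≤ θ) :
    controlConst θ * 2 ^ (θ + 1) ≤ smallness θ ∧ controlConst θ * 2 ^ θ ≤ 1 ∧
      3 * (controlConst θ * 2 ^ (θ - 1)) ≤ 1 / 4 ∧ controlConst θ ≤ 1 / 4 := by
  have h1 : controlConst θ * (12 * 2 ^ (θ + 1)) = smallness θ := by
    unfold controlConst; field_simp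
  have h2 := smallness_le_one hθ
  have h3 := controlConst_pos hθ
  have h4 : (2 : ℝ) ^ (θ + 1) = 2 * 2 ^ θ := by
    rw [Real.rpow_add (by norm_num), Real.rpow_one]; ring
  have h5 : (2 : ℝ) ^ θ = 2 * 2 ^ (θ - 1) := by
    rw [Real.rpow_sub (by norm_num), Real.rpow_one]; ring
  have h6 : (1 : ℝ) ≤ 2 ^ (θ - 1) := Real.one_le_rpow (by norm_num) (by linarith)
  have h7 : 0 ≤ controlConst θ * 2 ^ (θ - 1) := by positivity
  rw [h4, h5] at h1 ⊢
  refine ⟨?_, ?_, ?_, ?_⟩ <;> nlinarith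

section

variable {d : ℕ} {f g e : ℕ → Dual d → ℝ → ℝ} {ε C c₁ c₂ η L b z : ℝ} {D : (Fin d → ℤ) → ℝ}
  {N : ℕ}

lemma Controlled.z_pos (hc : Controlled b D g e N z) (hb : b ≤ 1 / 4) : 3 / 4 ≤ z ∧ z ≤ 5 / 4 := by
  have := abs_le.1 hc.near_one
  constructor <;> linarith

lemma Controlled.abs_kernelSeq_sub_le (hθ : 5 / 2 ≤ (d : ℝ) / 2)
    (hr : Recursion f g e) (hD : AssumptionD ε C c₁ c₂ η L D f e)
    (hc : Controlled b D g e N z) (hb : b ≤ 1 / 4) {k : Dual d} (hk : k ∈ cube d)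
    {m : ℕ} (hm : m ≤ N) :
    |kernelSeq g k z m - kernelSeq g 0 z m| ≤
      2 * 2 ^ ((d : ℝ) / 2 - 1) * a D k * wt ((d : ℝ) / 2 - 1) 1 m := by
  obtain ⟨hz1, hz2⟩ := hc.z_pos hb
  have ha := hD.a_nonneg k
  have hs : 0 ≤ (d : ℝ) / 2 - 1 := by linarith
  have hw := wt_pos ((d : ℝ) / 2 - 1) zero_le_one m
  rcases Nat.eq_zero_or_pos m with rfl | hm0
  · simp only [kernelSeq, if_true, sub_self, abs_zero]; positivity
  have hpow := rpow_le_wt_one hs hm0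
  rcases Nat.lt_or_ge 1 m with hm1 | hm1
  · simp only [kernelSeq, if_neg hm0.ne']
    refine (hc.g_diff m hm hm1 k hk).trans ?_
    calc _ ≤ 2 * a D k * (2 ^ ((d : ℝ) / 2 - 1) * wt ((d : ℝ) / 2 - 1) 1 m) := by
          gcongr; linarith
      _ = _ := by ring
  · obtain rfl : m = 1 := by omega
    simp only [kernelSeq, one_ne_zero, if_false]
    rw [hD.g_one_eq hr hk (by linarith), hD.g_one_eq hr (zero_mem_cube d) (by linarith),
      hD.Dhat_zero]
    have e1 : z * Dhat D k - z * 1 = -(z * a D k) := by unfold a; ring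
    rw [e1, abs_neg, abs_of_nonneg (by positivity)]
    simp only [Nat.cast_one, Real.one_rpow] at hpow
    calc z * a D k ≤ 2 * a D k * 1 := by nlinarith
      _ ≤ 2 * a D k * (2 ^ ((d : ℝ) / 2 - 1) * wt ((d : ℝ) / 2 - 1) 1 1) := by gcongr
      _ = _ := by ring

lemma Controlled.abs_sourceSeq_sub_le (hθ : 5 / 2 ≤ (d : ℝ) / 2)
    (hD : AssumptionD ε C c₁ c₂ η L D f e)
    (hc : Controlled b D g e N z) (hb : b ≤ 1 / 4) {k : Dual d} (hk : k ∈ cube d)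
    {m : ℕ} (hm : m ≤ N) :
    |sourceSeq e k z m - sourceSeq e 0 z m| ≤
      2 * 2 ^ ((d : ℝ) / 2 - 1) * a D k * wt ((d : ℝ) / 2 - 1) 1 m := by
  obtain ⟨hz1, hz2⟩ := hc.z_pos hb
  have ha := hD.a_nonneg k
  have hs : 0 ≤ (d : ℝ) / 2 - 1 := by linarith
  have hw := wt_pos ((d : ℝ) / 2 - 1) zero_le_one m
  rcases Nat.eq_zero_or_pos m with rfl | hm0
  · simp only [sourceSeq, if_true, sub_self, abs_zero]; positivity
  have hpow := rpow_le_wt_one hs hm0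
  rcases Nat.lt_or_ge 1 m with hm1 | hm1
  · simp only [sourceSeq, if_neg hm0.ne']
    refine (hc.e_diff m hm hm1 k hk).trans ?_
    calc _ ≤ 2 * a D k * (2 ^ ((d : ℝ) / 2 - 1) * wt ((d : ℝ) / 2 - 1) 1 m) := by
          gcongr; linarith
      _ = _ := by ring
  · obtain rfl : m = 1 := by omega
    simp only [sourceSeq, one_ne_zero, if_false]
    rw [hD.e_one z (by linarith) k hk, hD.e_one z (by linarith) 0 (zero_mem_cube d)]
    simp only [sub_self, abs_zero]; positivity

lemma Controlled.abs_sourceSeq_le (hθ : 5 / 2 ≤ (d : ℝ) / 2)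
    (hD : AssumptionD ε C c₁ c₂ η L D f e)
    (hc : Controlled b D g e N z) (hb0 : 0 ≤ b) (hb : b ≤ 1 / 4) {k : Dual d} (hk : k ∈ cube d)
    {m : ℕ} (hm : m ≤ N) (hm0 : 1 ≤ m) :
    |sourceSeq e k z m| ≤ b * 2 ^ ((d : ℝ) / 2) * wt ((d : ℝ) / 2) 1 m := by
  obtain ⟨hz1, hz2⟩ := hc.z_pos hb
  have hw := wt_pos ((d : ℝ) / 2) zero_le_one m
  have hpow := rpow_le_wt_one (s := (d : ℝ) / 2) (by linarith) hm0
  rw [sourceSeq, if_neg (by omega)]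
  rcases Nat.lt_or_ge 1 m with hm1 | hm1
  · refine (hc.e_sup m hm hm1 k hk).trans ?_
    rw [mul_assoc]; gcongr
  · obtain rfl : m = 1 := by omega
    rw [hD.e_one z (by linarith) k hk, abs_zero]; positivity

lemma Controlled.abs_kernelSeq_le (hθ : 5 / 2 ≤ (d : ℝ) / 2)
    (hc : Controlled b D g e N z) (hb0 : 0 ≤ b) {k : Dual d} (hk : k ∈ cube d)
    {m : ℕ} (hm : m ≤ N) (hm2 : 2 ≤ m) :
    |kernelSeq g k z m| ≤ b * 2 ^ ((d : ℝ) / 2) * wt ((d : ℝ) / 2) 1 m := by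
  have hpow := rpow_le_wt_one (s := (d : ℝ) / 2) (by linarith) (by omega : 1 ≤ m)
  rw [kernelSeq, if_neg (by omega), mul_assoc]
  exact (hc.g_sup m hm hm2 k hk).trans (by gcongr)

/-- The mass defect of the kernel at `k`, relative to `k = 0`. -/
def massDefect {d : ℕ} (g : ℕ → Dual d → ℝ → ℝ) (N : ℕ) (k : Dual d) (z : ℝ) : ℝ :=
  ∑ m ∈ range (N + 1), (kernelSeq g 0 z m - kernelSeq g k z m)

/-- The term m = 1 contributes exactly z a(k) with 3/4 ≤ z ≤ 5/4; all later terms together change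
this by at most a(k)/4. -/
lemma Controlled.abs_massDefect_sub_le (hθ : 5 / 2 ≤ (d : ℝ) / 2)
    (hr : Recursion f g e) (hD : AssumptionD ε C c₁ c₂ η L D f e)
    (hc : Controlled b D g e N z) (hb0 : 0 ≤ b) (hb : b ≤ controlConst ((d : ℝ) / 2))
    (hN : 1 ≤ N) {k : Dual d} (hk : k ∈ cube d) :
    a D k / 2 ≤ massDefect g N k z ∧ massDefect g N k z ≤ 2 * a D k := by
  obtain ⟨-, -, hb3, hb4⟩ := controlConst_mul_le hθ
  obtain ⟨hz1, hz2⟩ := hc.z_pos (hb.trans hb4)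
  have ha := hD.a_nonneg k
  have hs : 0 ≤ (d : ℝ) / 2 - 1 := by linarith
  have e1 : massDefect g N k z = ∑ m ∈ Ico 2 (N + 1), (kernelSeq g 0 z m - kernelSeq g k z m) +
      z * a D k := by
    unfold massDefect
    rw [← sum_range_add_sum_Ico _ (by omega : 2 ≤ N + 1), sum_range_succ, sum_range_one]
    simp only [kernelSeq, if_true, one_ne_zero, if_false]
    rw [hD.g_one_eq hr hk (by linarith), hD.g_one_eq hr (zero_mem_cube d) (by linarith),
      hD.Dhat_zero]
    unfold a; ring
  have e2 : |∑ m ∈ Ico 2 (N + 1), (kernelSeq g 0 z m - kernelSeq g k z m)| ≤ a D k / 4 := by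
    refine (abs_sum_le_sum_abs _ _).trans ?_
    calc _ ≤ ∑ m ∈ Ico 2 (N + 1), b * a D k * (2 ^ ((d : ℝ) / 2 - 1) *
          wt ((d : ℝ) / 2 - 1) 1 m) := by
          refine sum_le_sum fun m hm => ?_
          rw [mem_Ico] at hm
          rw [abs_sub_comm]
          simp only [kernelSeq, if_neg (by omega : m ≠ 0)]
          refine (hc.g_diff m (by omega) hm.1 k hk).trans ?_
          gcongr
          exact rpow_le_wt_one hs (by omega)
      _ ≤ ∑ m ∈ range (N + 1), b * a D k * (2 ^ ((d : ℝ) / 2 - 1) *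
          wt ((d : ℝ) / 2 - 1) 1 m) := by
          refine sum_le_sum_of_subset_of_nonneg (fun m hm => ?_) fun m _ _ => ?_
          · rw [mem_Ico] at hm; rw [mem_range]; omega
          · have := wt_pos ((d : ℝ) / 2 - 1) zero_le_one m
            positivity
      _ = b * a D k * 2 ^ ((d : ℝ) / 2 - 1) *
          ∑ m ∈ range (N + 1), wt ((d : ℝ) / 2 - 1) 1 m := by
          rw [mul_sum]; exact sum_congr rfl fun _ _ => by ring
      _ ≤ b * a D k * 2 ^ ((d : ℝ) / 2 - 1) * (3 / 1) := by
          gcongr; exact sum_wt_le (by linarith) one_pos le_rfl _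
      _ = a D k * (3 * (b * 2 ^ ((d : ℝ) / 2 - 1))) := by ring
      _ ≤ a D k * (1 / 4) := by
          gcongr
          refine le_trans ?_ hb3
          gcongr
      _ = _ := by ring
  have e3 := abs_le.1 e2
  constructor <;> nlinarith

/-- Because the mass defect is cut off at the same N as the criticality bound, 1 - κ - ∑_{m≤j}
g_m(k) is exactly the criticality error at k = 0 plus ∑_{j<m≤N} g_m(k). The first is monotone in the
cutoff and j ≤ N; the second is a small tail. -/
lemma Controlled.renewalKernel (hθ : 5 / 2 ≤ (d : ℝ) / 2)
    (hr : Recursion f g e) (hD : AssumptionD ε C c₁ c₂ η L D f e)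
    (hc : Controlled b D g e N z) (hb0 : 0 ≤ b) (hb : b ≤ controlConst ((d : ℝ) / 2))
    (hN : 1 ≤ N) {k : Dual d} (hk : k ∈ cube d) (hak : a D k ≤ 1 / 4) :
    RenewalKernel ((d : ℝ) / 2) (b * 2 ^ ((d : ℝ) / 2 + 1)) (massDefect g N k z) N
      (kernelSeq g k z) := by
  obtain ⟨-, -, hb3, hb4⟩ := controlConst_mul_le hθ
  obtain ⟨hz1, hz2⟩ := hc.z_pos (hb.trans hb4)
  have ha := hD.a_nonneg k
  obtain ⟨hm1, hm2⟩ := hc.abs_massDefect_sub_le hθ hr hD hb0 hb hN hk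
  set θ := (d : ℝ) / 2 with hθdef
  have hpow1 : (2 : ℝ) ^ (θ + 1) = 2 ^ θ + 2 ^ θ := by
    rw [Real.rpow_add (by norm_num), Real.rpow_one]; ring
  have hpow2 : (2 : ℝ) ^ (θ - 1) ≤ 2 ^ θ :=
    Real.rpow_le_rpow_of_exponent_le (by norm_num) (by linarith)
  refine ⟨by linarith, by linarith, by simp [kernelSeq], ?_, ?_, ?_⟩
  · simp only [kernelSeq, one_ne_zero, if_false]
    rw [hD.g_one_eq hr hk (by linarith), abs_mul, abs_of_pos (by linarith)]
    have := abs_Dhat_le hD.nonneg hD.normalised k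
    nlinarith [abs_nonneg (Dhat D k)]
  · intro m hm hm2
    refine (hc.abs_kernelSeq_le hθ hb0 hk hm hm2).trans ?_
    have := wt_pos θ zero_le_one m
    rw [hpow1]
    have : 0 ≤ b * 2 ^ θ * wt θ 1 m := by positivity
    linarith
  · intro j hj hj1
    have e1 : 1 - massDefect g N k z - ∑ m ∈ range (j + 1), kernelSeq g k z m =
        (1 - ∑ m ∈ Icc 1 N, g m 0 z) + ∑ m ∈ Ico (j + 1) (N + 1), kernelSeq g k z m := by
      unfold massDefect
      rw [sum_sub_distrib, sum_range_kernelSeq,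
        ← sum_range_add_sum_Ico (kernelSeq g k z) (by omega : j + 1 ≤ N + 1)]
      ring
    rw [e1]
    have hj0 : (0 : ℝ) < j := by exact_mod_cast hj1
    have e2 : |1 - ∑ m ∈ Icc 1 N, g m 0 z| ≤ b * (2 ^ θ * wt (θ - 1) 1 j) := by
      refine hc.crit.trans ?_
      have h1 : (N : ℝ) ^ (-(θ - 1)) ≤ (j : ℝ) ^ (-(θ - 1)) :=
        Real.rpow_le_rpow_of_nonpos hj0 (by exact_mod_cast hj) (by linarith)
      have h2 := rpow_le_wt_one (s := θ - 1) (by linarith) hj1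
      have := wt_pos (θ - 1) zero_le_one j
      gcongr
      exact h1.trans (h2.trans (by gcongr))
    have e3 : |∑ m ∈ Ico (j + 1) (N + 1), kernelSeq g k z m| ≤ b * 2 ^ θ * wt (θ - 1) 1 j := by
      refine (abs_sum_le_sum_abs _ _).trans ?_
      calc _ ≤ ∑ m ∈ Ico (j + 1) (N + 1), b * 2 ^ θ * wt θ 1 m := by
            refine sum_le_sum fun m hm => ?_
            rw [mem_Ico] at hm
            exact hc.abs_kernelSeq_le hθ hb0 hk (by omega) (by omega)
        _ = b * 2 ^ θ * ∑ m ∈ Ico (j + 1) (N + 1), wt θ 1 m := by rw [mul_sum]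
        _ ≤ _ := by gcongr; exact sum_Ico_wt_le (by linarith) j N
    refine (abs_add_le _ _).trans ((add_le_add e2 e3).trans (le_of_eq ?_))
    rw [hpow1]; ring

end

end KernelBounds

/-! ### From small coefficients to the bounds on f_m. -/

section FunctionBounds

open Finset

lemma greenTail_anti {θ x y : ℝ} (hθ : 1 ≤ θ) (hx : 0 < x) (hxy : x ≤ y) (n : ℕ) :
    greenTail θ y n ≤ greenTail θ x n := by
  have h1 := wt_anti_param (s := θ + 1) (by linarith) hx.le hxy n
  have h2 : y ^ (1 / 4 - θ) ≤ x ^ (1 / 4 - θ) :=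
    Real.rpow_le_rpow_of_nonpos hx hxy (by linarith)
  unfold greenTail
  gcongr

lemma norm_le_of_forall_abs_le {d : ℕ} {k : Dual d} {r : ℝ} (hr : 0 ≤ r) (hk : ∀ i, |k i| ≤ r) :
    ‖k‖ ≤ d * r := by
  rw [EuclideanSpace.norm_eq]
  refine Real.sqrt_le_iff.2 ⟨by positivity, ?_⟩
  calc ∑ i, ‖k i‖ ^ 2 ≤ ∑ _i : Fin d, r ^ 2 := by
        refine sum_le_sum fun i _ => ?_
        rw [Real.norm_eq_abs]
        exact pow_le_pow_left₀ (abs_nonneg _) (hk i) 2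
    _ = d * r ^ 2 := by simp
    _ ≤ (d * r) ^ 2 := by
        rw [mul_pow]
        gcongr
        exact_mod_cast Nat.le_self_pow two_ne_zero d

/-- Pointwise bounds on `f_n(k;z)` in the range of small `a(k)`. -/
lemma exists_abs_f_le_of_small {d : ℕ} (hd : 4 < d) {c₁ : ℝ} (hc₁ : 0 < c₁) :
    ∃ A c : ℝ, 1 ≤ A ∧ 0 < c ∧ ∀ (ε C c₂ η L b z : ℝ) (D : (Fin d → ℤ) → ℝ)
      (f g e : ℕ → Dual d → ℝ → ℝ) (N : ℕ), Recursion f g e →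
      AssumptionD ε C c₁ c₂ η L D f e → Controlled b D g e N z → 0 ≤ b →
      b ≤ controlConst ((d : ℝ) / 2) → 1 ≤ N → 0 < L → ∀ k ∈ cube d, a D k ≤ min η (1 / 4) →
      (∀ n ≤ N, |f n k z| ≤ A) ∧
      (∀ n ≤ N, |f n k z - f n 0 z| ≤ A * a D k * n) ∧
      ‖k‖ < (d + 1 : ℝ) / L ∧
      ∀ n ≤ N, 1 ≤ n → |f n k z| ≤ A * greenTail ((d : ℝ) / 2) (c * L ^ 2 * ‖k‖ ^ 2) n := by
  have hθ : 5 / 2 ≤ (d : ℝ) / 2 := by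
    have : (5 : ℝ) ≤ d := by exact_mod_cast hd
    linarith
  obtain ⟨A, hA1, hA⟩ := exists_abs_renewal_le hθ
  set θ := (d : ℝ) / 2 with hθdef
  have hrate := rate_pos hθ
  have hA2 : A ≤ A * (1 + 3 * A) * (2 * 2 ^ (θ - 1)) := by
    have : (1 : ℝ) ≤ 2 ^ (θ - 1) := Real.one_le_rpow (by norm_num) (by linarith)
    have h2 : 1 ≤ (1 + 3 * A) * (2 * 2 ^ (θ - 1)) := by nlinarith
    rw [mul_assoc]
    exact le_mul_of_one_le_right (by linarith) h2
  set A' := A * (1 + 3 * A) * (2 * 2 ^ (θ - 1)) with hA'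
  -- The renewal parameter is x = rate · κ, and κ ≥ a(k)/2 ≥ c₁L²|k|²/2.
  refine ⟨A', rate θ * c₁ / 2, hA1.trans hA2, by positivity, ?_⟩
  intro ε C c₂ η L b z D f g e N hr hD hc hb0 hb hN hL k hk hak
  obtain ⟨hb1, hb2, hb3, hb4⟩ := controlConst_mul_le hθ
  obtain ⟨hz1, hz2⟩ := hc.z_pos (hb.trans hb4)
  have hz0 : 0 < z := by linarith
  have hak4 : a D k ≤ 1 / 4 := hak.trans (min_le_right _ _)
  have hakη : a D k ≤ η := hak.trans (min_le_left _ _)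
  have ha0 := hD.a_nonneg k
  have hbs : b * 2 ^ (θ + 1) ≤ smallness θ := le_trans (by gcongr) hb1
  have hsource : ∀ k ∈ cube d, ∀ n ≤ N,
      |PowerSeries.coeff n (PowerSeries.mk (sourceSeq e k z))| ≤ wt θ 1 n := by
    intro k hk n hn
    rw [PowerSeries.coeff_mk]
    rcases Nat.eq_zero_or_pos n with rfl | hn0
    · simp [sourceSeq]
    · refine (hc.abs_sourceSeq_le hθ hD hb0 (hb.trans hb4) hk hn hn0).trans ?_
      refine mul_le_of_le_one_left (wt_pos _ zero_le_one n).le (le_trans ?_ hb2)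
      gcongr
  have hker := hc.renewalKernel hθ hr hD hb0 hb hN hk hak4
  obtain ⟨hf1, hf2⟩ := hA _ _ N _ _ _ hker (by positivity) hbs (hr.powerSeries hz0 hk)
    (hsource k hk)
  simp only [PowerSeries.coeff_mk] at hf1 hf2
  obtain ⟨hκ1, hκ2⟩ := hc.abs_massDefect_sub_le hθ hr hD hb0 hb hN hk
  -- Since a(k) > η outside the cube of side 1/L, the condition a(k) ≤ η forces `k` into the region
  -- with quadratic bounds.
  have hsmall : ∀ i, |k i| ≤ L⁻¹ := fun i => by
    by_contra! h
    exact absurd (hD.large_k k hk ⟨i, h.le⟩) (not_lt.2 hakη)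
  refine ⟨fun n hn => (hf1 n hn).trans hA2, ?_, ?_, ?_⟩
  · have ha00 : a D (0 : Dual d) = 0 := by rw [a, hD.Dhat_zero, sub_self]
    have hker0 := hc.renewalKernel hθ hr hD hb0 hb hN (zero_mem_cube d) (by rw [ha00]; norm_num)
    -- The Green function at k = 0 is itself the solution with source 1, so the same uniform bound
    -- applies to it.
    have hq := (hA _ _ N _ 1 _ hker0 (by positivity) hbs (one_sub_mk_mul_inv hker0.zero)
      (fun n _ => by
        rw [PowerSeries.coeff_one]
        split_ifs with h
        · simp [h]
        · simpa using (wt_pos _ zero_le_one n).le)).1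
    have h := abs_coeff_sub_le (s := θ - 1) (M := 2 * 2 ^ (θ - 1) * a D k) (N := N) (by linarith)
      (by positivity) hker.zero hker0.zero (hr.powerSeries hz0 hk)
      (hr.powerSeries hz0 (zero_mem_cube d)) hq (by simpa using hf1)
      (fun m hm => hc.abs_kernelSeq_sub_le hθ hr hD (hb.trans hb4) hk hm)
      (by simp [sourceSeq])
      (fun m hm => by
        simpa only [PowerSeries.coeff_mk] using
          hc.abs_sourceSeq_sub_le hθ hD (hb.trans hb4) hk hm)
    intro n hn
    have h2 := h n hn
    simp only [PowerSeries.coeff_mk] at h2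
    refine h2.trans (le_of_eq ?_)
    rw [hA']; ring
  · refine (norm_le_of_forall_abs_le (by positivity) hsmall).trans_lt ?_
    rw [← div_eq_mul_inv]
    gcongr
    linarith
  · intro n hn hn1
    have hck := (hD.small_k k hk hsmall).1
    have hA'0 : 0 ≤ A' := by linarith
    -- At k = 0 the parameter is 0 and there need be no positive mass defect; the weight in
    -- `greenTail` alone equals 1, so the uniform bound is enough.
    rcases eq_or_ne k 0 with rfl | hk0
    · refine (hf1 n hn).trans ?_
      have : 1 ≤ greenTail θ (rate θ * c₁ / 2 * L ^ 2 * ‖(0 : Dual d)‖ ^ 2) n := by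
        simp [greenTail, wt]
        positivity
      nlinarith
    · have hkn : 0 < ‖k‖ := norm_pos_iff.2 hk0
      have hx0 : 0 < rate θ * c₁ / 2 * L ^ 2 * ‖k‖ ^ 2 := by positivity
      have hxle : rate θ * c₁ / 2 * L ^ 2 * ‖k‖ ^ 2 ≤ rate θ * massDefect g N k z := by
        have : c₁ * L ^ 2 * ‖k‖ ^ 2 / 2 ≤ massDefect g N k z := by linarith
        calc _ = rate θ * (c₁ * L ^ 2 * ‖k‖ ^ 2 / 2) := by ring
          _ ≤ _ := by gcongr
      have hκ : 0 < massDefect g N k z := by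
        by_contra! h
        nlinarith
      refine (hf2 hκ n hn hn1).trans ?_
      exact mul_le_mul hA2 (greenTail_anti (by linarith) hx0 hxle n)
        (greenTail_nonneg θ (by positivity) n) hA'0

/-- Pointwise bounds on `f_n(k;z)` in the range where `a(k)` is bounded below. -/
lemma exists_abs_f_le_of_large {d : ℕ} (hd : 4 < d) {η : ℝ} (hη : 0 < η) :
    ∃ A b₁ : ℝ, 0 < A ∧ 0 < b₁ ∧ ∀ (ε C c₁ c₂ L b z : ℝ) (D : (Fin d → ℤ) → ℝ)
      (f g e : ℕ → Dual d → ℝ → ℝ) (N : ℕ), Recursion f g e →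
      AssumptionD ε C c₁ c₂ η L D f e → Controlled b D g e N z → 0 ≤ b → b ≤ b₁ →
      ∀ k ∈ cube d, min η (1 / 4) < a D k →
      ∀ n ≤ N, 1 ≤ n → |f n k z| ≤ A * (n : ℝ) ^ (-((d : ℝ) / 2)) := by
  have hθ : 5 / 2 ≤ (d : ℝ) / 2 := by
    have : (5 : ℝ) ≤ d := by exact_mod_cast hd
    linarith
  have hm0 : 0 < min η (1 / 4) := by positivity
  have hm1 : min η (1 / 4) ≤ 1 / 4 := min_le_right _ _
  have hm2 : min η (1 / 4) ≤ η := min_le_left _ _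
  set η₁ := min η (1 / 4)
  obtain ⟨A, b₁, hA, hb₁, H⟩ := exists_abs_renewal_le_of_contraction (δ := η₁ / 2) hθ
    (by positivity) (by linarith)
  set θ := (d : ℝ) / 2
  refine ⟨A, min (η₁ / 2) (b₁ / 2 ^ θ), hA, by positivity, ?_⟩
  intro ε C c₁ c₂ L b z D f g e N hr hD hc hb0 hb k hk hak
  have hb1 : b ≤ η₁ / 2 := hb.trans (min_le_left _ _)
  have hb2 : b * 2 ^ θ ≤ b₁ := by
    rw [← le_div_iff₀ (by positivity)]; exact hb.trans (min_le_right _ _)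
  have hb4 : b ≤ 1 / 4 := by linarith
  obtain ⟨hz1, hz2⟩ := hc.z_pos hb4
  have hz0 : 0 < z := by linarith
  refine H N (kernelSeq g k z) (sourceSeq e k z) (fun n => f n k z) (by simp [kernelSeq]) ?_ ?_
    (by simp [sourceSeq]) ?_ (fun n _ => hr.eq_antidiagonal hz0 hk n)
  · simp only [kernelSeq, one_ne_zero, if_false]
    rw [hD.g_one_eq hr hk hz0, abs_mul, abs_of_pos hz0]
    -- Both bounds on a(k) are needed, as D̂ must avoid 1 and -1. Then z ≤ 1 + η₁/2 still leaves a
    -- contraction factor 1 - η₁/2.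
    have h1 : |Dhat D k| ≤ 1 - η₁ := by
      have h2 := hD.away_two k hk
      unfold a at hak h2
      rw [abs_le]; constructor <;> linarith
    have h3 : z ≤ 1 + η₁ / 2 := by
      have := abs_le.1 hc.near_one
      linarith
    calc z * |Dhat D k| ≤ (1 + η₁ / 2) * (1 - η₁) := by gcongr
      _ ≤ _ := by nlinarith
  · intro m hm hm2
    refine (hc.abs_kernelSeq_le hθ hb0 hk hm hm2).trans ?_
    have := wt_pos θ zero_le_one m
    gcongr
  · intro m hm hm1
    refine (hc.abs_sourceSeq_le hθ hD hb0 hb4 hk hm hm1).trans ?_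
    have := wt_pos θ zero_le_one m
    gcongr

/-- The bounds on `f_m(·;z)` for `m ≤ N`, from the smallness of `e_m` and `g_m` for `m ≤ N`. -/
lemma exists_fBounds {d : ℕ} (hd : 4 < d) (C : ℝ) {c₁ η : ℝ} (hc₁ : 0 < c₁) (hη : 0 < η) :
    ∃ K b₀ : ℝ, 1 < K ∧ 0 < b₀ ∧ b₀ ≤ 1 / 4 ∧ ∀ (ε c₂ L b z : ℝ) (D : (Fin d → ℤ) → ℝ)
      (f g e : ℕ → Dual d → ℝ → ℝ) (N : ℕ), Recursion f g e → AssumptionS f g e →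
      AssumptionD ε C c₁ c₂ η L D f e → Controlled b D g e N z → 0 ≤ b → b ≤ b₀ → 1 ≤ N →
      0 < L → ∀ m ≤ N, 1 ≤ m → FBounds L D f K m z := by
  have hθ : 5 / 2 ≤ (d : ℝ) / 2 := by
    have : (5 : ℝ) ≤ d := by exact_mod_cast hd
    linarith
  obtain ⟨A, c, hA1, hc0, hsmall⟩ := exists_abs_f_le_of_small hd hc₁
  obtain ⟨A', b₁, hA', hb₁, hlarge⟩ := exists_abs_f_le_of_large hd hη
  obtain ⟨B, hB0, hB⟩ := exists_lintegral_greenTail_le (d := d) (by omega) hc0 (d + 1)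
  have hcc := controlConst_pos hθ
  have hπ : 0 < (2 * Real.pi) ^ d := by positivity
  set P := ((2 * Real.pi) ^ d)⁻¹ with hP
  have hP0 : 0 < P := by positivity
  -- A covers the bounds at k = 0, A'|C| the large-a(k) part of the L¹ norm, P·A·B its small-a(k)
  -- part, and 1 ensures K > 1. None of these involves C_e or C_g.
  refine ⟨A + 1 + A' * |C| + P * (A * B), min (controlConst ((d : ℝ) / 2)) b₁, ?_, by positivity,
    (min_le_left _ _).trans (controlConst_mul_le hθ).2.2.2, ?_⟩
  · have : 0 ≤ A' * |C| + P * (A * B) := by positivity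
    linarith
  set K := A + 1 + A' * |C| + P * (A * B) with hK
  have hAK : A ≤ K := by
    have : 0 ≤ A' * |C| + P * (A * B) := by positivity
    linarith
  intro ε c₂ L b z D f g e N hr hS hD hc hb0 hb hN hL m hm hm1
  have hbc : b ≤ controlConst ((d : ℝ) / 2) := hb.trans (min_le_left _ _)
  obtain ⟨hz1, hz2⟩ := hc.z_pos (hbc.trans (controlConst_mul_le hθ).2.2.2)
  have hz0 : 0 < z := by linarith
  have hsm := fun k hk hak => hsmall ε C c₂ η L b z D f g e N hr hD hc hb0 hbc hN hL k hk hak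
  have hla := fun k hk hak => hlarge ε C c₁ c₂ L b z D f g e N hr hD hc hb0
    (hb.trans (min_le_right _ _)) k hk hak
  have ha00 : a D (0 : Dual d) = 0 := by rw [a, hD.Dhat_zero, sub_self]
  have hβ : 0 < beta d L := by unfold beta; positivity
  have hm0 : (0 : ℝ) < m := by exact_mod_cast hm1
  refine ⟨?_, ?_, ?_⟩
  · set ν := (m : ℝ) ^ (-(d : ℝ) / 2) with hν
    have hν0 : 0 < ν := by positivity
    set S := Metric.ball (0 : Dual d) ((d + 1 : ℝ) / L) with hSdef
    set φ : Dual d → ℝ≥0∞ := fun k =>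
      ENNReal.ofReal (greenTail ((d : ℝ) / 2) (c * L ^ 2 * ‖k‖ ^ 2) m) with hφ
    -- For small a(k) the factor D̂² is bounded by 1 and the ball supplies β. For large a(k) the
    -- bound on f_m is uniform in `k`, and β comes from the integral of D̂².
    have hpt : ∀ k ∈ cube d, ‖Dhat D k ^ 2 * f m k z‖ₑ ≤
        ENNReal.ofReal (A' * ν) * ‖Dhat D k ^ 2‖ₑ +
          S.indicator (fun k => ENNReal.ofReal A * φ k) k := by
      intro k hk
      rcases le_or_gt (a D k) (min η (1 / 4)) with hak | hak
      · obtain ⟨-, -, hkS, hfk⟩ := hsm k hk hak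
        have hmem : k ∈ S := by rw [hSdef, mem_ball_zero_iff]; exact hkS
        rw [Set.indicator_of_mem hmem]
        refine le_trans ?_ le_add_self
        rw [hφ, ← ENNReal.ofReal_mul (by linarith), Real.enorm_eq_ofReal_abs]
        refine ENNReal.ofReal_le_ofReal ?_
        rw [abs_mul]
        refine le_trans ?_ (hfk m hm hm1)
        refine mul_le_of_le_one_left (abs_nonneg _) ?_
        rw [abs_pow]
        exact pow_le_one₀ (abs_nonneg _) (abs_Dhat_le hD.nonneg hD.normalised k)
      · refine le_trans ?_ le_self_add
        rw [enorm_mul, mul_comm]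
        gcongr
        rw [Real.enorm_eq_ofReal_abs]
        refine ENNReal.ofReal_le_ofReal ((hla k hk hak m hm hm1).trans (le_of_eq ?_))
        rw [hν, neg_div]
    have hDm : Measurable fun k : Dual d => ENNReal.ofReal (A' * ν) * ‖Dhat D k ^ 2‖ₑ :=
      (((continuous_Dhat hD.nonneg hD.normalised.summable).measurable.pow_const 2).enorm).const_mul _
    have hDm' : Measurable fun k : Dual d => ‖Dhat D k ^ 2‖ₑ :=
      ((continuous_Dhat hD.nonneg hD.normalised.summable).measurable.pow_const 2).enorm
    have h1 : ∫⁻ k in cube d, ‖Dhat D k ^ 2 * f m k z‖ₑ ≤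
        ENNReal.ofReal (A' * ν) * ENNReal.ofReal ((2 * Real.pi) ^ d * (|C| * beta d L)) +
        ENNReal.ofReal A * ENNReal.ofReal (B * beta d L * ν) := by
      calc _ ≤ ∫⁻ k in cube d, (ENNReal.ofReal (A' * ν) * ‖Dhat D k ^ 2‖ₑ +
            S.indicator (fun k => ENNReal.ofReal A * φ k) k) :=
            setLIntegral_mono' (measurableSet_cube d) hpt
        _ = ENNReal.ofReal (A' * ν) * (∫⁻ k in cube d, ‖Dhat D k ^ 2‖ₑ) +
            ∫⁻ k in cube d, S.indicator (fun k => ENNReal.ofReal A * φ k) k := by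
            rw [lintegral_add_left hDm, lintegral_const_mul _ hDm']
        _ ≤ ENNReal.ofReal (A' * ν) * (∫⁻ k in cube d, ‖Dhat D k ^ 2‖ₑ) +
            ENNReal.ofReal A * ∫⁻ k in S, φ k := by
            gcongr
            refine (setLIntegral_le_lintegral _ _).trans ?_
            rw [lintegral_indicator measurableSet_ball,
              lintegral_const_mul' _ _ ENNReal.ofReal_ne_top]
        _ ≤ _ := by
            gcongr
            · refine lintegral_Dhat_sq_le hD.nonneg hD.normalised (fun x => ?_)
                fun k hk => hD.fourier_eq_Dhat hk
              refine (hD.sup_le x).trans ?_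
              gcongr
              exact le_abs_self C
            · exact hB L hL m hm1
    unfold normOne
    refine (mul_le_mul_right h1 _).trans ?_
    rw [← ENNReal.ofReal_mul (by positivity), ← ENNReal.ofReal_mul (by linarith),
      ← ENNReal.ofReal_add (by positivity) (by positivity), ← hP, ← ENNReal.ofReal_mul hP0.le]
    refine ENNReal.ofReal_le_ofReal ?_
    have e1 : P * (A' * ν * ((2 * Real.pi) ^ d * (|C| * beta d L)) + A * (B * beta d L * ν)) =
        (A' * |C| + P * (A * B)) * (beta d L * ν) := by
      have : P * (2 * Real.pi) ^ d = 1 := inv_mul_cancel₀ hπ.ne'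
      linear_combination (A' * ν * |C| * beta d L) * this
    rw [e1, mul_assoc K]
    gcongr
    linarith
  · exact ((hsm 0 (zero_mem_cube d) (by rw [ha00]; positivity)).1 m hm).trans hAK
  · have hcont : Tendsto (a D) (𝓝 0) (𝓝 0) := by
      have : Continuous (a D) := continuous_const.sub
        (continuous_Dhat hD.nonneg hD.normalised.summable)
      simpa only [ha00] using this.tendsto (0 : Dual d)
    have hev : ∀ᶠ k in 𝓝 (0 : Dual d), a D k < min η (1 / 4) :=
      hcont.eventually (gt_mem_nhds (by positivity))
    have h := abs_lapZero_le (D := D) (M := A * m) (hS.smooth_f m z hz0) (hD.contDiffAt_Dhat hS)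
      hD.Dhat_zero (by
        filter_upwards [hev, cube_mem_nhds d] with k hak hk
        refine ((hsm k hk hak.le).2.1 m hm).trans (le_of_eq ?_)
        ring)
    refine h.trans ?_
    have := hD.sigmaSq_nonneg hS
    calc A * m * sigmaSq D = A * (sigmaSq D * m) := by ring
      _ ≤ K * (sigmaSq D * m) := by gcongr
      _ = _ := by ring

end FunctionBounds

/-! ### Bounds on e_m and g_m in the form used by the induction. -/

section CoefficientBounds

open Finset

section

variable {d : ℕ} {f g e : ℕ → Dual d → ℝ → ℝ} {ε C c₁ c₂ η L : ℝ} {D : (Fin d → ℤ) → ℝ}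

lemma beta_pos (d : ℕ) (hL : 0 < L) : 0 < beta d L := by unfold beta; positivity

lemma rpow_exponent_eq (d : ℕ) : -((d : ℝ) - 2) / 2 = -((d : ℝ) / 2 - 1) := by ring

lemma EBounds.sup_le {Γ c : ℝ} {m : ℕ} {z : ℝ} (h : EBounds L D e c m z) (hΓ : c ≤ Γ)
    (hL : 0 < L) {k : Dual d} (hk : k ∈ cube d) :
    |e m k z| ≤ Γ * beta d L * (m : ℝ) ^ (-((d : ℝ) / 2)) := by
  have := beta_pos d hL
  refine (h.sup k hk).trans ?_
  rw [neg_div]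
  gcongr

lemma EBounds.diff_le {Γ c : ℝ} {m : ℕ} {z : ℝ} (h : EBounds L D e c m z) (hΓ : c ≤ Γ)
    (hD : AssumptionD ε C c₁ c₂ η L D f e) (hL : 0 < L) {k : Dual d} (hk : k ∈ cube d) :
    |e m k z - e m 0 z| ≤ Γ * beta d L * a D k * (m : ℝ) ^ (-((d : ℝ) / 2 - 1)) := by
  have := beta_pos d hL
  have := hD.a_nonneg k
  refine (h.diff k hk).trans ?_
  rw [rpow_exponent_eq, mul_right_comm c]
  gcongr

lemma GBounds.sup_le {Γ c : ℝ} {m : ℕ} {z : ℝ} (h : GBounds ε L D g c m z) (hΓ : c ≤ Γ)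
    (hL : 0 < L) {k : Dual d} (hk : k ∈ cube d) :
    |g m k z| ≤ Γ * beta d L * (m : ℝ) ^ (-((d : ℝ) / 2)) := by
  have := beta_pos d hL
  refine (h.sup k hk).trans ?_
  rw [neg_div]
  gcongr

/-- The Taylor bound with ε' = 0 and the Laplacian bound each contribute one Γβ a(k), the factor σ²
cancelling σ^{-2}. -/
lemma GBounds.diff_le {Γ c : ℝ} {m : ℕ} {z : ℝ} (h : GBounds ε L D g c m z) (hΓ : c ≤ Γ)
    (hΓ0 : 0 ≤ Γ) (hε : 0 ≤ ε) (hD : AssumptionD ε C c₁ c₂ η L D f e) (hσ : 0 ≤ sigmaSq D) (hL : 0 < L)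
    {k : Dual d} (hk : k ∈ cube d) :
    |g m k z - g m 0 z| ≤ 2 * Γ * beta d L * a D k * (m : ℝ) ^ (-((d : ℝ) / 2 - 1)) := by
  have hβ := beta_pos d hL
  have ha := hD.a_nonneg k
  have h1 := h.taylor 0 ⟨le_rfl, hε⟩ k hk
  have h2 := h.lap
  rw [mul_zero, sub_zero, add_zero, Real.rpow_one, rpow_exponent_eq] at h1
  rw [rpow_exponent_eq] at h2
  set p := (m : ℝ) ^ (-((d : ℝ) / 2 - 1))
  have hp : 0 ≤ p := by positivity
  have hc : 0 ≤ Γ * beta d L * p := by positivity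
  have h3 : |a D k * (sigmaSq D)⁻¹ * lapZero (fun k => g m k z)| ≤ a D k * (Γ * beta d L * p) := by
    rw [abs_mul, abs_mul, abs_of_nonneg ha, abs_of_nonneg (inv_nonneg.2 hσ), mul_assoc]
    refine mul_le_mul_of_nonneg_left ?_ ha
    -- If σ² = 0, its inverse is 0 by convention and the Laplacian term disappears.
    rcases hσ.eq_or_lt with h0 | h0
    · rw [← h0]; simpa using hc
    · rw [inv_mul_le_iff₀ h0]
      refine h2.trans ?_
      calc c * sigmaSq D * beta d L * p = c * (sigmaSq D * beta d L * p) := by ring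
        _ ≤ Γ * (sigmaSq D * beta d L * p) := by gcongr
        _ = _ := by ring
  have h4 : c * beta d L * a D k * p ≤ a D k * (Γ * beta d L * p) := by
    calc c * beta d L * a D k * p = c * (beta d L * a D k * p) := by ring
      _ ≤ Γ * (beta d L * a D k * p) := by gcongr
      _ = _ := by ring
  calc |g m k z - g m 0 z| = |(g m k z - g m 0 z - a D k * (sigmaSq D)⁻¹ *
        lapZero (fun k => g m k z)) + a D k * (sigmaSq D)⁻¹ * lapZero (fun k => g m k z)| := by
        congr 1; ring
    _ ≤ _ := abs_add_le _ _
    _ ≤ a D k * (Γ * beta d L * p) + a D k * (Γ * beta d L * p) := add_le_add (h1.trans h4) h3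
    _ = _ := by ring

lemma abs_g_zero_sub_le {Γ c : ℝ} {m : ℕ} {I : Set ℝ} (hI : I.OrdConnected)
    (h : ∀ z ∈ I, GBounds ε L D g c m z) (hΓ : c ≤ Γ) (hL : 0 < L) {w z : ℝ} (hw : w ∈ I)
    (hz : z ∈ I) :
    |g m 0 w - g m 0 z| ≤ Γ * beta d L * (m : ℝ) ^ (-((d : ℝ) / 2 - 1)) * |w - z| := by
  have hβ := beta_pos d hL
  have := Convex.norm_image_sub_le_of_norm_deriv_le (f := fun w => g m 0 w)
    (C := Γ * beta d L * (m : ℝ) ^ (-((d : ℝ) / 2 - 1)))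
    (fun x hx => (h x hx).differentiable) (fun x hx => by
      refine (h x hx).deriv_le.trans ?_
      rw [rpow_exponent_eq]
      gcongr) hI.convex hz hw
  simpa only [Real.norm_eq_abs] using this

/-- A bound for the sums `∑ m^{-(d-2)/2}`. -/
def zetaBound (d : ℕ) : ℝ := 2 ^ ((d : ℝ) / 2 - 1) * 3

lemma sum_Icc_rpow_le (hd : 4 < d) (N : ℕ) :
    ∑ m ∈ Icc 2 N, (m : ℝ) ^ (-((d : ℝ) / 2 - 1)) ≤ zetaBound d := by
  have hd5 : (5 : ℝ) ≤ d := by exact_mod_cast hd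
  calc _ ≤ ∑ m ∈ Icc 2 N, 2 ^ ((d : ℝ) / 2 - 1) * wt ((d : ℝ) / 2 - 1) 1 m := by
        refine sum_le_sum fun m hm => rpow_le_wt_one (by linarith) ?_
        rw [mem_Icc] at hm; omega
    _ ≤ ∑ m ∈ range (N + 1), 2 ^ ((d : ℝ) / 2 - 1) * wt ((d : ℝ) / 2 - 1) 1 m := by
        refine sum_le_sum_of_subset_of_nonneg (fun m hm => ?_) fun m _ _ => ?_
        · rw [mem_Icc] at hm; rw [mem_range]; omega
        · have := wt_pos ((d : ℝ) / 2 - 1) zero_le_one m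
          positivity
    _ = 2 ^ ((d : ℝ) / 2 - 1) * ∑ m ∈ range (N + 1), wt ((d : ℝ) / 2 - 1) 1 m := by rw [mul_sum]
    _ ≤ 2 ^ ((d : ℝ) / 2 - 1) * (3 / 1) := by
        gcongr; exact sum_wt_le (by linarith) one_pos le_rfl _
    _ = _ := by rw [zetaBound]; ring

lemma abs_sum_g_zero_sub_le (hd : 4 < d) {Γ c : ℝ} {N : ℕ} {I : Set ℝ} (hI : I.OrdConnected)
    (h : ∀ z ∈ I, ∀ m ∈ Icc 2 N, GBounds ε L D g c m z) (hΓ : c ≤ Γ) (hΓ0 : 0 ≤ Γ) (hL : 0 < L)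
    {w z : ℝ} (hw : w ∈ I) (hz : z ∈ I) :
    |∑ m ∈ Icc 2 N, g m 0 w - ∑ m ∈ Icc 2 N, g m 0 z| ≤
      Γ * beta d L * zetaBound d * |w - z| := by
  have hβ := beta_pos d hL
  rw [← sum_sub_distrib]
  refine (abs_sum_le_sum_abs _ _).trans ?_
  calc _ ≤ ∑ m ∈ Icc 2 N, Γ * beta d L * (m : ℝ) ^ (-((d : ℝ) / 2 - 1)) * |w - z| :=
        sum_le_sum fun m hm => abs_g_zero_sub_le hI (fun z hz => h z hz m hm) hΓ hL hw hz
    _ = Γ * beta d L * (∑ m ∈ Icc 2 N, (m : ℝ) ^ (-((d : ℝ) / 2 - 1))) * |w - z| := by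
        rw [← sum_mul, ← mul_sum]
    _ ≤ _ := by gcongr; exact sum_Icc_rpow_le hd N

lemma sum_Icc_one_g_zero (hr : Recursion f g e) (hD : AssumptionD ε C c₁ c₂ η L D f e) {z : ℝ}
    (hz : 0 < z) {N : ℕ} (hN : 1 ≤ N) :
    ∑ m ∈ Icc 1 N, g m 0 z = z + ∑ m ∈ Icc 2 N, g m 0 z := by
  rw [← sum_Ioc_add_eq_sum_Icc hN, add_comm, hD.g_one_eq hr (zero_mem_cube d) hz, hD.Dhat_zero,
    mul_one]
  rfl

end

/-- The radius of the intervals on which the induction takes place. -/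
def radius (d : ℕ) (κ : ℝ) (n : ℕ) : ℝ := κ * (n : ℝ) ^ (-((d : ℝ) / 2 - 1))

/-- The intervals on which the induction takes place. -/
def zInterval {d : ℕ} (g : ℕ → Dual d → ℝ → ℝ) (κ : ℝ) (n : ℕ) : Set ℝ :=
  Metric.closedBall (zSeq g n) (radius d κ n)

lemma mem_zInterval {d : ℕ} {g : ℕ → Dual d → ℝ → ℝ} {κ z : ℝ} {n : ℕ} :
    z ∈ zInterval g κ n ↔ |z - zSeq g n| ≤ radius d κ n := by
  rw [zInterval, Metric.mem_closedBall, Real.dist_eq]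

lemma zSeq_one {d : ℕ} (g : ℕ → Dual d → ℝ → ℝ) : zSeq g 1 = 1 := by simp [zSeq]

end CoefficientBounds

/-! ### The induction on nested intervals and the critical value. -/

section CriticalValue

open Finset

section

variable {d : ℕ} {f g e : ℕ → Dual d → ℝ → ℝ} {ε α C c₁ c₂ η L K b₀ Γ : ℝ}
  {Ce Cg L₁ : ℝ → ℝ} {D : (Fin d → ℤ) → ℝ}

lemma radius_pos (d : ℕ) {κ : ℝ} (hκ : 0 < κ) {n : ℕ} (hn : 1 ≤ n) : 0 < radius d κ n := by
  have : (0 : ℝ) < n := by exact_mod_cast hn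
  unfold radius; positivity

lemma radius_one (d : ℕ) (κ : ℝ) : radius d κ 1 = κ := by simp [radius]

/-- The loss of radius from n to n + 1 leaves room for the displacement of the centre, which has one
more power of decay. -/
lemma radius_succ_add_le (hd : 4 < d) {κ : ℝ} (hκ : 0 ≤ κ) {n : ℕ} (hn : 1 ≤ n) :
    radius d κ (n + 1) + κ * ((n + 1 : ℕ) : ℝ) ^ (-((d : ℝ) / 2)) ≤ radius d κ n := by
  have hd5 : (5 : ℝ) ≤ d := by exact_mod_cast hd
  have := rpow_succ_le_sub (θ := (d : ℝ) / 2) (x := n) (by linarith) (by exact_mod_cast hn)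
  unfold radius
  push_cast
  nlinarith

/-- The increments of `zSeq` are controlled by the kernel bounds. -/
lemma abs_zSeq_succ_sub_le (hd : 4 < d) (hΓ0 : 0 < Γ) (hL : 0 < L) {c : ℝ} (hc : c ≤ Γ)
    (hsmall : Γ * beta d L * zetaBound d * 2 ^ ((d : ℝ) / 2) ≤ 1 / 2) {n : ℕ} (hn : 1 ≤ n)
    {I : Set ℝ} (hI : I.OrdConnected)
    (hG : ∀ z ∈ I, ∀ m ∈ Icc 2 (n + 1), GBounds ε L D g c m z)
    (h0 : zSeq g (n - 1) ∈ I) (h1 : zSeq g n ∈ I)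
    (ih : |zSeq g n - zSeq g (n - 1)| ≤ 2 * Γ * beta d L * (n : ℝ) ^ (-((d : ℝ) / 2))) :
    |zSeq g (n + 1) - zSeq g n| ≤
      2 * Γ * beta d L * ((n + 1 : ℕ) : ℝ) ^ (-((d : ℝ) / 2)) := by
  have hβ := beta_pos d hL
  have hd5 : (5 : ℝ) ≤ d := by exact_mod_cast hd
  have hZ : 0 < zetaBound d := by unfold zetaBound; positivity
  -- The new term contributes Γβ(n+1)^{-θ}. The change of argument in the old terms contributes at
  -- most the same again, by the Lipschitz bound and `hsmall`; hence the factor 2.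
  have e1 : zSeq g (n + 1) - zSeq g n = -(g (n + 1) 0 (zSeq g n)) -
      (∑ m ∈ Icc 2 n, g m 0 (zSeq g n) - ∑ m ∈ Icc 2 n, g m 0 (zSeq g (n - 1))) := by
    obtain ⟨j, rfl⟩ : ∃ j, n = j + 1 := ⟨n - 1, by omega⟩
    rw [show zSeq g (j + 1 + 1) = 1 - ∑ m ∈ Icc 2 (j + 1 + 1), g m 0 (zSeq g (j + 1)) from rfl,
      sum_Icc_succ_top (by omega)]
    rw [show j + 1 - 1 = j by omega]
    have : ∑ m ∈ Icc 2 (j + 1), g m 0 (zSeq g j) = 1 - zSeq g (j + 1) := by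
      rw [show zSeq g (j + 1) = 1 - ∑ m ∈ Icc 2 (j + 1), g m 0 (zSeq g j) from rfl]; ring
    rw [this]; ring
  have e2 := (hG _ h1 (n + 1) (by rw [mem_Icc]; omega)).sup_le hc hL (zero_mem_cube d)
  have e3 := abs_sum_g_zero_sub_le hd hI (N := n)
    (fun z hz m hm => hG z hz m (by rw [mem_Icc] at hm ⊢; omega)) hc hΓ0.le hL h1 h0
  have hn0 : (0 : ℝ) < n := by exact_mod_cast hn
  have e4 : (n : ℝ) ^ (-((d : ℝ) / 2)) ≤
      2 ^ ((d : ℝ) / 2) * ((n + 1 : ℕ) : ℝ) ^ (-((d : ℝ) / 2)) := by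
    have := rpow_le_wt_one (s := (d : ℝ) / 2) (by linarith) hn
    simpa [wt, add_comm] using this
  set p := ((n + 1 : ℕ) : ℝ) ^ (-((d : ℝ) / 2)) with hp
  have hp0 : 0 ≤ p := by positivity
  have e5 : Γ * beta d L * zetaBound d * |zSeq g n - zSeq g (n - 1)| ≤ Γ * beta d L * p :=
    calc _ ≤ Γ * beta d L * zetaBound d * (2 * Γ * beta d L * (2 ^ ((d : ℝ) / 2) * p)) := by
          gcongr
          exact ih.trans (by gcongr)
      _ = (Γ * beta d L * zetaBound d * 2 ^ ((d : ℝ) / 2)) * (2 * Γ * beta d L * p) := by ring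
      _ ≤ 1 / 2 * (2 * Γ * beta d L * p) := by gcongr
      _ = _ := by ring
  rw [e1]
  refine (abs_sub _ _).trans ?_
  rw [abs_neg]
  linarith

/-- The interval containment in the induction step. -/
lemma zInterval_succ_subset (hd : 4 < d) {κ : ℝ} (hκ : 0 ≤ κ) {n : ℕ} (hn : 1 ≤ n)
    (h : |zSeq g (n + 1) - zSeq g n| ≤ κ * ((n + 1 : ℕ) : ℝ) ^ (-((d : ℝ) / 2))) :
    zInterval g κ (n + 1) ⊆ zInterval g κ n := by
  intro z hz
  rw [mem_zInterval] at hz ⊢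
  have := radius_succ_add_le hd hκ hn
  have := abs_sub_le z (zSeq g (n + 1)) (zSeq g n)
  linarith

/-- The induction: on shrinking intervals around `z_n`, the `f`-bounds and the smallness of the
coefficients of the recursion hold up to `n`. -/
lemma induction_bounds (hd : 4 < d) (hε : 0 < ε)
    (hr : Recursion f g e) (hS : AssumptionS f g e) (hD : AssumptionD ε C c₁ c₂ η L D f e)
    (hE : AssumptionE α Ce L₁ L D f e) (hG : AssumptionG α ε Cg L₁ L D f g)
    (hK : 1 < K) (hL₁ : L₁ K ≤ L) (hL : 0 < L) (hΓ : 1 ≤ Γ) (hCe : Ce K ≤ Γ) (hCg : Cg K ≤ Γ)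
    (hb₀ : 8 * Γ * beta d L ≤ b₀) (hb₀4 : b₀ ≤ 1 / 4) (hα : 8 * Γ * beta d L ≤ α)
    (hsmall : Γ * beta d L * zetaBound d * 2 ^ ((d : ℝ) / 2) ≤ 1 / 2)
    (hF : ∀ (z : ℝ) (N : ℕ), Controlled (8 * Γ * beta d L) D g e N z → 1 ≤ N →
      ∀ m ≤ N, 1 ≤ m → FBounds L D f K m z) (n : ℕ) (hn : 1 ≤ n) :
    |zSeq g n - zSeq g (n - 1)| ≤ 2 * Γ * beta d L * (n : ℝ) ^ (-((d : ℝ) / 2)) ∧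
    zInterval g (2 * Γ * beta d L) n ⊆ zInterval g (2 * Γ * beta d L) 1 ∧
    (∀ z ∈ zInterval g (2 * Γ * beta d L) n, Controlled (8 * Γ * beta d L) D g e n z) ∧
    zInterval g (2 * Γ * beta d L) (n + 1) ⊆ zInterval g (2 * Γ * beta d L) n := by
  have hβ := beta_pos d hL
  have hΓ0 : 0 < Γ := by linarith
  have hd5 : (5 : ℝ) ≤ d := by exact_mod_cast hd
  have hσ := hD.sigmaSq_nonneg hS
  set κ := 2 * Γ * beta d L with hκ
  have hκ0 : 0 < κ := by positivity
  have hb : 8 * Γ * beta d L = 4 * κ := by rw [hκ]; ring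
  rw [hb] at hb₀ hα hF ⊢
  have hI1 : ∀ z ∈ zInterval g κ 1, |z - 1| ≤ κ := fun z hz => by
    rw [mem_zInterval, zSeq_one, radius_one] at hz; exact hz
  have hord : ∀ n, (zInterval g κ n).OrdConnected := fun n => by
    rw [zInterval, Real.closedBall_eq_Icc]; exact Set.ordConnected_Icc
  have hnt : ∀ n, 1 ≤ n → (zInterval g κ n).Nontrivial := fun n hn => by
    have h := radius_pos d hκ0 hn
    refine ⟨zSeq g n, ?_, zSeq g n + radius d κ n, ?_, by linarith⟩ <;> rw [mem_zInterval]
    · simpa using h.le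
    · rw [add_sub_cancel_left, abs_of_pos h]
  have hα' : ∀ n, zInterval g κ n ⊆ zInterval g κ 1 →
      zInterval g κ n ⊆ Set.Icc (1 - α) (1 + α) := fun n h z hz => by
    have := abs_le.1 (hI1 z (h hz))
    constructor <;> linarith
  have hmem0 : ∀ n, 1 ≤ n → zSeq g n ∈ zInterval g κ n := fun n hn => by
    rw [mem_zInterval, sub_self, abs_zero]; exact (radius_pos d hκ0 hn).le
  have hmem1 : ∀ n, 1 ≤ n → |zSeq g n - zSeq g (n - 1)| ≤ κ * (n : ℝ) ^ (-((d : ℝ) / 2)) →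
      zSeq g (n - 1) ∈ zInterval g κ n := fun n hn h => by
    rw [mem_zInterval, abs_sub_comm]
    refine h.trans ?_
    unfold radius
    gcongr
    · exact_mod_cast hn
    · linarith
  -- The gain of one index: control up to n gives the f-bounds up to n, and Assumptions E and G
  -- return coefficient bounds up to n + 1 on the same interval.
  have hGn : ∀ n, 1 ≤ n → zInterval g κ n ⊆ zInterval g κ 1 →
      (∀ z ∈ zInterval g κ n, Controlled (4 * κ) D g e n z) →
      (∀ z ∈ zInterval g κ n, ∀ m ∈ Icc 2 (n + 1), EBounds L D e (Ce K) m z) ∧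
      (∀ z ∈ zInterval g κ n, ∀ m ∈ Icc 2 (n + 1), GBounds ε L D g (Cg K) m z) := by
    intro n hn h1 h2
    have h3 : ∀ z ∈ zInterval g κ n, ∀ m ∈ Icc 1 n, FBounds L D f K m z := fun z hz m hm => by
      rw [mem_Icc] at hm
      exact hF z n (h2 z hz) hn m hm.2 hm.1
    exact ⟨hE K hK hL₁ n _ (hord n) (hnt n hn) (hα' n h1) h3,
      hG K hK hL₁ n _ (hord n) (hnt n hn) (hα' n h1) h3⟩
  have hstep : ∀ n, 1 ≤ n →
      |zSeq g n - zSeq g (n - 1)| ≤ κ * (n : ℝ) ^ (-((d : ℝ) / 2)) →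
      zInterval g κ n ⊆ zInterval g κ 1 →
      (∀ z ∈ zInterval g κ n, Controlled (4 * κ) D g e n z) →
      |zSeq g (n + 1) - zSeq g n| ≤ κ * ((n + 1 : ℕ) : ℝ) ^ (-((d : ℝ) / 2)) := by
    intro n hn h1 h2 h3
    exact abs_zSeq_succ_sub_le hd hΓ0 hL hCg hsmall hn (hord n) (hGn n hn h2 h3).2
      (hmem1 n hn h1) (hmem0 n hn) h1
  induction n, hn using Nat.le_induction with
  | base =>
    have c1 : |zSeq g 1 - zSeq g (1 - 1)| ≤ κ * ((1 : ℕ) : ℝ) ^ (-((d : ℝ) / 2)) := by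
      rw [zSeq_one, show zSeq g (1 - 1) = 1 from rfl]
      simpa using hκ0.le
    -- At n = 1 there are no indices m ≥ 2, and g_1(0;z) = z makes criticality the statement that z
    -- is near 1.
    have c2 : ∀ z ∈ zInterval g κ 1, Controlled (4 * κ) D g e 1 z := by
      intro z hz
      have hz1 := hI1 z hz
      have hz2 := abs_le.1 hz1
      refine ⟨by linarith, fun m h1 h2 => by omega, fun m h1 h2 => by omega,
        fun m h1 h2 => by omega, fun m h1 h2 => by omega, ?_⟩
      rw [Icc_self, sum_singleton, hD.g_one_eq hr (zero_mem_cube d) (by linarith), hD.Dhat_zero,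
        mul_one, abs_sub_comm]
      simp only [Nat.cast_one, Real.one_rpow, mul_one]
      linarith
    exact ⟨c1, le_rfl, c2,
      zInterval_succ_subset hd hκ0.le le_rfl (hstep 1 le_rfl c1 le_rfl c2)⟩
  | succ n hn ih =>
    obtain ⟨i1, i2, i3, i4⟩ := ih
    have c1 := hstep n hn i1 i2 i3
    have c2 := i4.trans i2
    obtain ⟨hEb, hGb⟩ := hGn n hn i2 i3
    have c3 : ∀ z ∈ zInterval g κ (n + 1), Controlled (4 * κ) D g e (n + 1) z := by
      intro z hz
      have hzn := i4 hz
      have hz1 := hI1 z (c2 hz)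
      have hz2 := abs_le.1 hz1
      have hzpos : 0 < z := by linarith
      have hΓκ : Γ * beta d L ≤ 4 * κ := by rw [hκ]; nlinarith [mul_pos hΓ0 hβ]
      have hΓκ2 : 2 * Γ * beta d L ≤ 4 * κ := by rw [hκ]; nlinarith [mul_pos hΓ0 hβ]
      refine ⟨by linarith, ?_, ?_, ?_, ?_, ?_⟩
      · intro m hm hm2 k hk
        refine ((hEb z hzn m (by rw [mem_Icc]; omega)).sup_le hCe hL hk).trans ?_
        gcongr
      · intro m hm hm2 k hk
        have := hD.a_nonneg k
        refine ((hEb z hzn m (by rw [mem_Icc]; omega)).diff_le hCe hD hL hk).trans ?_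
        gcongr
      · intro m hm hm2 k hk
        refine ((hGb z hzn m (by rw [mem_Icc]; omega)).sup_le hCg hL hk).trans ?_
        gcongr
      · intro m hm hm2 k hk
        have := hD.a_nonneg k
        refine ((hGb z hzn m (by rw [mem_Icc]; omega)).diff_le hCg hΓ0.le hε.le hD hσ hL hk).trans ?_
        gcongr
      · rw [sum_Icc_one_g_zero hr hD hzpos (by omega)]
        -- By definition of z_{n+1} the criticality error is z_{n+1} - z plus a change of argument
        -- from z to z_n. Each is at most one radius at n + 1.
        have e1 : 1 - (z + ∑ m ∈ Icc 2 (n + 1), g m 0 z) = -(z - zSeq g (n + 1)) +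
            (∑ m ∈ Icc 2 (n + 1), g m 0 (zSeq g n) - ∑ m ∈ Icc 2 (n + 1), g m 0 z) := by
          rw [show zSeq g (n + 1) = 1 - ∑ m ∈ Icc 2 (n + 1), g m 0 (zSeq g n) from rfl]; ring
        rw [e1]
        refine (abs_add_le _ _).trans ?_
        rw [abs_neg]
        have e2 := abs_sum_g_zero_sub_le hd (hord n) hGb hCg hΓ0.le hL (hmem0 n hn) hzn
        have e3 : |zSeq g n - z| ≤ 2 * radius d κ (n + 1) := by
          have h1 := abs_sub_le z (zSeq g (n + 1)) (zSeq g n)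
          rw [abs_sub_comm z (zSeq g n)] at h1
          have h2 := mem_zInterval.1 hz
          have h3 : κ * ((n + 1 : ℕ) : ℝ) ^ (-((d : ℝ) / 2)) ≤ radius d κ (n + 1) := by
            unfold radius
            gcongr
            · exact_mod_cast (by omega : 1 ≤ n + 1)
            · linarith
          linarith
        have hZ : 0 < zetaBound d := by unfold zetaBound; positivity
        have e4 : Γ * beta d L * zetaBound d ≤ 1 / 2 := by
          refine le_trans ?_ hsmall
          exact le_mul_of_one_le_right (by positivity)
            (Real.one_le_rpow (by norm_num) (by linarith))
        have hrad := radius_pos d hκ0 (by omega : 1 ≤ n + 1)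
        have e5 : Γ * beta d L * zetaBound d * |zSeq g n - z| ≤ 1 / 2 * (2 * radius d κ (n + 1)) := by
          gcongr
        have e6 := mem_zInterval.1 hz
        have e7 : 4 * κ * ((n + 1 : ℕ) : ℝ) ^ (-((d : ℝ) / 2 - 1)) = 4 * radius d κ (n + 1) := by
          unfold radius; ring
        rw [e7]
        linarith
    exact ⟨c1, c2, c3, zInterval_succ_subset hd hκ0.le (by omega) (hstep (n + 1) (by omega) c1 c2 c3)⟩

/-- Existence of the critical value, and bounds at the critical value. -/
lemma exists_criticalValue (hd : 4 < d) {κ b : ℝ} (hκ : 0 < κ)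
    (hctrl : ∀ n, 1 ≤ n → ∀ z ∈ zInterval g κ n, Controlled b D g e n z)
    (hsub : ∀ n, 1 ≤ n → zInterval g κ (n + 1) ⊆ zInterval g κ n) :
    ∃ zc : ℝ, IsCriticalValue g zc ∧ (∀ n, 1 ≤ n → Controlled b D g e n zc) ∧
      Tendsto (fun N => ∑ m ∈ Icc 1 N, g m 0 zc) atTop (𝓝 1) := by
  have hd5 : (5 : ℝ) ≤ d := by exact_mod_cast hd
  have hpow : Tendsto (fun n : ℕ => (n : ℝ) ^ (-((d : ℝ) / 2 - 1))) atTop (𝓝 0) :=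
    (tendsto_rpow_neg_atTop (by linarith)).comp tendsto_natCast_atTop_atTop
  have hanti : ∀ n, 1 ≤ n → ∀ j, n ≤ j → zSeq g j ∈ zInterval g κ n := by
    intro n hn j hj
    have hsub' : zInterval g κ j ⊆ zInterval g κ n := by
      induction j, hj using Nat.le_induction with
      | base => exact le_rfl
      | succ j hj ih => exact (hsub j (by omega)).trans ih
    refine hsub' ?_
    rw [mem_zInterval, sub_self, abs_zero]
    exact (radius_pos d hκ (by omega)).le
  have hcau : CauchySeq fun n => zSeq g (n + 1) := by
    refine cauchySeq_of_le_tendsto_0' (fun n => radius d κ (n + 1)) (fun n m hnm => ?_) ?_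
    · rw [dist_comm]
      exact hanti (n + 1) (by omega) (m + 1) (by omega)
    · have := (hpow.comp (tendsto_add_atTop_nat 1)).const_mul κ
      simpa [radius, Function.comp_def] using this
  obtain ⟨zc, hzc⟩ := cauchySeq_tendsto_of_complete hcau
  have hzc' : Tendsto (zSeq g) atTop (𝓝 zc) := (tendsto_add_atTop_iff_nat 1).1 hzc
  have hmem : ∀ n, 1 ≤ n → zc ∈ zInterval g κ n := fun n hn =>
    Metric.isClosed_closedBall.mem_of_tendsto hzc'
      (eventually_atTop.2 ⟨n, fun j hj => hanti n hn j hj⟩)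
  refine ⟨zc, hzc', fun n hn => hctrl n hn zc (hmem n hn), ?_⟩
  have h0 : Tendsto (fun N => 1 - ∑ m ∈ Icc 1 N, g m 0 zc) atTop (𝓝 0) := by
    have h1 := hpow.const_mul b
    rw [mul_zero] at h1
    refine squeeze_zero_norm' ?_ h1
    filter_upwards [eventually_ge_atTop 1] with N hN
    exact (hctrl N hN zc (hmem N hN)).crit
  simpa using h0.const_sub 1

end

end CriticalValue

/-! ### The susceptibility identity and the identification with p_c. -/

section Susceptibility

open Finset

lemma sum_range_antidiagonal (u v : ℕ → ℝ) (N : ℕ) :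
    ∑ n ∈ range N, ∑ p ∈ antidiagonal n, u p.1 * v p.2 =
      ∑ j ∈ range N, u j * ∑ i ∈ range (N - j), v i := by
  induction N with
  | zero => simp
  | succ N ih =>
    rw [sum_range_succ, ih, Nat.sum_antidiagonal_eq_sum_range_succ_mk]
    have h1 : ∑ j ∈ range (N + 1), u j * ∑ i ∈ range (N + 1 - j), v i =
        ∑ j ∈ range (N + 1), (u j * ∑ i ∈ range (N - j), v i + u j * v (N - j)) := by
      refine sum_congr rfl fun j hj => ?_
      rw [mem_range] at hj
      rw [show N + 1 - j = N - j + 1 by omega, sum_range_succ]; ring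
    rw [h1, sum_add_distrib, sum_range_succ (fun j => u j * ∑ i ∈ range (N - j), v i)]
    simp

/-- Mertens' theorem on Cauchy products, for partial sums. -/
lemma tendsto_sum_antidiagonal {u v : ℕ → ℝ} {V : ℝ} (hu : Summable fun n => |u n|)
    (hv : Tendsto (fun N => ∑ n ∈ range N, v n) atTop (𝓝 V)) :
    Tendsto (fun N => ∑ n ∈ range N, ∑ p ∈ antidiagonal n, u p.1 * v p.2) atTop
      (𝓝 ((∑' n, u n) * V)) := by
  obtain ⟨B, hB⟩ := (Metric.isBounded_range_of_tendsto _ hv).exists_norm_le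
  have hB' : ∀ N, |∑ n ∈ range N, v n| ≤ B := fun N => hB _ ⟨N, rfl⟩
  have h := tendsto_tsum_of_dominated_convergence (𝓕 := atTop)
    (f := fun (N : ℕ) j => u j * ∑ i ∈ range (N - j), v i) (g := fun j => u j * V)
    (bound := fun j => |u j| * B) (hu.mul_right B)
    (fun j => (hv.comp (tendsto_sub_atTop_nat j)).const_mul _)
    (Eventually.of_forall fun N j => by
      rw [Real.norm_eq_abs, abs_mul]
      exact mul_le_mul_of_nonneg_left (hB' _) (abs_nonneg _))
  rw [tsum_mul_right] at h
  refine h.congr fun N => ?_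
  rw [sum_range_antidiagonal]
  -- For j ≥ N the truncated difference N - j is 0 and the inner sum is empty, so the series is a
  -- finite sum.
  refine tsum_eq_sum fun j hj => ?_
  rw [mem_range, not_lt] at hj
  simp [Nat.sub_eq_zero_of_le hj]

section

variable {d : ℕ} {f g e : ℕ → Dual d → ℝ → ℝ} {ε C c₁ c₂ η L : ℝ} {D : (Fin d → ℤ) → ℝ}

/-- The susceptibility in terms of the generating functions of `g` and `e`. -/
lemma HasSusceptibility.exists_mul_eq (hd : 4 < d) (hr : Recursion f g e)
    (hD : AssumptionD ε C c₁ c₂ η L D f e) {z χ B : ℝ} (hz : 0 < z)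
    (hχ : HasSusceptibility f z χ) (hB0 : 0 ≤ B) (hB : B * zetaBound d ≤ 1 / 2)
    (hg : ∀ m, 2 ≤ m → |g m 0 z| ≤ B * (m : ℝ) ^ (-((d : ℝ) / 2)))
    (he : ∀ m, 2 ≤ m → |e m 0 z| ≤ B * (m : ℝ) ^ (-((d : ℝ) / 2))) :
    ∃ G T : ℝ, Tendsto (fun N => ∑ m ∈ Icc 1 N, g m 0 z) atTop (𝓝 G) ∧ χ * (1 - G) = T ∧
      1 / 2 ≤ T ∧ T ≤ 3 / 2 := by
  have hd5 : (5 : ℝ) ≤ d := by exact_mod_cast hd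
  have h0 := zero_mem_cube d
  have hsum : Summable fun n => |kernelSeq g 0 z n| := by
    rw [← summable_nat_add_iff 2]
    refine Summable.of_nonneg_of_le (fun n => abs_nonneg _) (fun n => ?_)
      ((((Real.summable_nat_rpow (p := -((d : ℝ) / 2))).2 (by linarith)).mul_left B).comp_injective
        (add_left_injective 2))
    simp only [kernelSeq, Nat.add_eq_zero_iff, OfNat.ofNat_ne_zero, and_false, if_false]
    exact hg (n + 2) (by omega)
  refine ⟨∑' n, kernelSeq g 0 z n, χ * (1 - ∑' n, kernelSeq g 0 z n), ?_, rfl, ?_⟩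
  · have := (hsum.of_abs.hasSum.tendsto_sum_nat).comp (tendsto_add_atTop_nat 1)
    simpa [Function.comp_def, sum_range_kernelSeq] using this
  -- Subtracting the Mertens limit from χ isolates the source. Its partial sums converge to χ(1 -
  -- G), and each is within 1/2 of the initial value 1 because e_1 = 0 and the rest is small.
  have hlim : Tendsto (fun N => ∑ n ∈ range N, sourceSeq e 0 z n) atTop
      (𝓝 (χ * (1 - ∑' n, kernelSeq g 0 z n))) := by
    have h1 := hχ.sub (tendsto_sum_antidiagonal (v := fun n => f n 0 z) hsum hχ)
    rw [show χ - (∑' n, kernelSeq g 0 z n) * χ = χ * (1 - ∑' n, kernelSeq g 0 z n) by ring] at h1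
    refine h1.congr fun N => ?_
    rw [← sum_sub_distrib]
    refine sum_congr rfl fun n _ => ?_
    rw [hr.eq_antidiagonal hz h0 n]; ring
  have hpart : ∀ N, 2 ≤ N → |∑ n ∈ range N, sourceSeq e 0 z n - 1| ≤ 1 / 2 := by
    intro N hN
    rw [← sum_range_add_sum_Ico _ hN, sum_range_succ, sum_range_one]
    have e1 : sourceSeq e (0 : Dual d) z 0 = 1 := by simp [sourceSeq]
    have e2 : sourceSeq e (0 : Dual d) z 1 = 0 := by simp [sourceSeq, hD.e_one z hz 0 h0]
    rw [e1, e2, add_zero, add_sub_cancel_left]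
    refine (abs_sum_le_sum_abs _ _).trans ?_
    calc _ ≤ ∑ m ∈ Ico 2 N, B * (m : ℝ) ^ (-((d : ℝ) / 2 - 1)) := by
          refine sum_le_sum fun m hm => ?_
          rw [mem_Ico] at hm
          rw [sourceSeq, if_neg (by omega)]
          refine (he m hm.1).trans ?_
          gcongr
          · exact_mod_cast (by omega : 1 ≤ m)
          · linarith
      _ ≤ ∑ m ∈ Icc 2 N, B * (m : ℝ) ^ (-((d : ℝ) / 2 - 1)) :=
          sum_le_sum_of_subset_of_nonneg Ico_subset_Icc_self fun m _ _ => by positivity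
      _ = B * ∑ m ∈ Icc 2 N, (m : ℝ) ^ (-((d : ℝ) / 2 - 1)) := by rw [mul_sum]
      _ ≤ B * zetaBound d := by gcongr; exact sum_Icc_rpow_le hd N
      _ ≤ _ := hB
  have h2 := le_of_tendsto (hlim.sub_const 1).abs (eventually_atTop.2 ⟨2, hpart⟩)
  have h3 := abs_le.1 h2
  constructor <;> linarith

/-- The critical value of the recursion is the critical value of the susceptibility. -/
lemma criticalValue_eq (hd : 4 < d) (hr : Recursion f g e)
    (hD : AssumptionD ε C c₁ c₂ η L D f e) {zc pc Γ ce cg : ℝ} {χ : ℝ → ℝ} (hL : 0 < L)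
    (hΓ0 : 0 ≤ Γ) (hce : ce ≤ Γ) (hcg : cg ≤ Γ)
    (hsmall : Γ * beta d L * zetaBound d ≤ 1 / 2) (hzc : 0 < zc)
    (hcrit : Tendsto (fun N => ∑ m ∈ Icc 1 N, g m 0 zc) atTop (𝓝 1))
    (hEG : ∀ z ∈ Set.Ioc 0 zc, ∀ m : ℕ, 2 ≤ m →
      EBounds L D e ce m z ∧ GBounds ε L D g cg m z)
    (hpc : 0 < pc) (hχ : ∀ z ∈ Set.Ioo 0 pc, HasSusceptibility f z (χ z) ∧ 0 < χ z)
    (hdiv : Tendsto χ (𝓝[<] pc) atTop) : zc = pc := by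
  have hβ := beta_pos d hL
  have hmul : ∀ z, 0 < z → z ≤ zc → z < pc → _ := fun z h1 h2 h3 =>
    HasSusceptibility.exists_mul_eq hd hr hD h1 (hχ z ⟨h1, h3⟩).1 (B := Γ * beta d L)
      (by positivity) hsmall
      (fun m hm => (hEG z ⟨h1, h2⟩ m hm).2.sup_le hcg hL (zero_mem_cube d))
      (fun m hm => (hEG z ⟨h1, h2⟩ m hm).1.sup_le hce hL (zero_mem_cube d))
  rcases lt_trichotomy zc pc with h | h | h
  · obtain ⟨G, T, hG, hT, hT1, -⟩ := hmul zc hzc le_rfl h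
    rw [tendsto_nhds_unique hG hcrit, sub_self, mul_zero] at hT
    linarith
  · exact h
  · exfalso
    have hbound : ∀ z ∈ Set.Ioo 0 pc, χ z ≤ 3 / (zc - pc) := by
      rintro z ⟨hz0, hzp⟩
      obtain ⟨G, T, hG, hT, -, hT2⟩ := hmul z hz0 (by linarith) hzp
      -- The total mass is 1 at z_c. Its linear part g_1(0;z) = z drops by z_c - z, and the other
      -- terms have Lipschitz constant at most 1/2.
      have hgap : (zc - pc) / 2 ≤ 1 - G := by
        refine ge_of_tendsto (hcrit.sub hG) ?_
        filter_upwards [eventually_ge_atTop 1] with N hN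
        rw [sum_Icc_one_g_zero hr hD hz0 hN, sum_Icc_one_g_zero hr hD hzc hN]
        have h1 := abs_sum_g_zero_sub_le hd (N := N) (I := Set.Ioc 0 zc) Set.ordConnected_Ioc
          (fun w hw m hm => (hEG w hw m (mem_Icc.1 hm).1).2) hcg hΓ0 hL
          (w := zc) (z := z) ⟨hzc, le_rfl⟩ ⟨hz0, by linarith⟩
        have h2 : 0 < zc - z := by linarith
        rw [abs_of_pos h2] at h1
        have h3 := (abs_le.1 h1).1
        nlinarith
      have hχz := (hχ z ⟨hz0, hzp⟩).2
      rw [le_div_iff₀ (by linarith)]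
      nlinarith
    obtain ⟨z, hz1, hz2⟩ := ((hdiv.eventually (eventually_gt_atTop (3 / (zc - pc)))).and
      (Ioo_mem_nhdsLT hpc)).exists
    exact absurd (hbound z hz2) (not_le.2 hz1)

end

/-- For L ≥ 1 one has β ≤ 1/L, so each smallness condition on a multiple of β is a lower bound on L.
-/
lemma mul_beta_le {d : ℕ} (hd : 0 < d) {L X y : ℝ} (hL : 1 ≤ L) (hy : 0 < y)
    (h : X / y ≤ L) : X * beta d L ≤ y := by
  have h1 : L ≤ L ^ d := le_self_pow₀ hL hd.ne'
  rw [beta, ← div_eq_mul_inv, div_le_iff₀ (by positivity)]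
  rw [div_le_iff₀ hy] at h
  nlinarith

end Susceptibility

end LaceRec

end

theorem theorem1p2 (d : ℕ) (hd : 4 < d)
    (ε C c₁ c₂ η α : ℝ) (hε : 0 < ε) (hc₁ : 0 < c₁) (hc₂ : 0 < c₂) (hη : 0 < η)
    (hα : α ∈ Set.Ioo (0 : ℝ) 1) (Ce Cg L₁ : ℝ → ℝ) :
    ∃ L₀ : ℝ, ∀ L : ℝ, L₀ ≤ L →
      ∀ (D : (Fin d → ℤ) → ℝ) (f g e : ℕ → LaceRec.Dual d → ℝ → ℝ),
        LaceRec.Recursion f g e →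
        LaceRec.AssumptionS f g e →
        LaceRec.AssumptionD ε C c₁ c₂ η L D f e →
        LaceRec.AssumptionE α Ce L₁ L D f e →
        LaceRec.AssumptionG α ε Cg L₁ L D f g →
        ∃ zc : ℝ, LaceRec.IsCriticalValue g zc ∧
          ∀ (pc : ℝ) (χ : ℝ → ℝ), 0 < pc →
            (∀ z ∈ Set.Ioo 0 pc, LaceRec.HasSusceptibility f z (χ z) ∧ 0 < χ z) →
            Tendsto χ (𝓝[<] pc) atTop →
            LaceRec.UniformEG ε Ce Cg L₁ L D f g e zc →
            zc = pc := by
  -- K is fixed before C_e(K) and C_g(K) are evaluated, so there is no circularity.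
  obtain ⟨K, b₀, hK, hb₀, hb₀4, hF⟩ := LaceRec.exists_fBounds hd C hc₁ hη
  have hα0 : 0 < α := hα.1
  set Γ : ℝ := 1 + |Ce K| + |Cg K| with hΓ
  have hΓ1 : 1 ≤ Γ := by
    have := abs_nonneg (Ce K)
    have := abs_nonneg (Cg K)
    linarith
  have hCe : Ce K ≤ Γ := by
    have := le_abs_self (Ce K)
    have := abs_nonneg (Cg K)
    linarith
  have hCg : Cg K ≤ Γ := by
    have := le_abs_self (Cg K)
    have := abs_nonneg (Ce K)
    linarith
  have hZ : 0 < LaceRec.zetaBound d := by unfold LaceRec.zetaBound; positivity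
  have hd5 : (5 : ℝ) ≤ d := by exact_mod_cast hd
  set W : ℝ := Γ * LaceRec.zetaBound d * 2 ^ ((d : ℝ) / 2) with hW
  have hW0 : 0 ≤ W := by positivity
  -- Each summand secures one requirement: L ≥ 1, L ≥ L₁(K), coefficients below b₀, intervals inside
  -- [1 - α, 1 + α], and a small Lipschitz constant.
  refine ⟨1 + |L₁ K| + 8 * Γ / b₀ + 8 * Γ / α + W / (1 / 2), ?_⟩
  intro L hL D f g e hr hS hD hE hG
  have p1 := abs_nonneg (L₁ K)
  have p2 : 0 ≤ 8 * Γ / b₀ := by positivity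
  have p3 : 0 ≤ 8 * Γ / α := by positivity
  have p4 : 0 ≤ W / (1 / 2) := by positivity
  have hL1 : 1 ≤ L := by linarith
  have hL0 : 0 < L := by linarith
  have hLK : L₁ K ≤ L := by linarith [le_abs_self (L₁ K)]
  have hβ := LaceRec.beta_pos d hL0
  have q1 : 8 * Γ * LaceRec.beta d L ≤ b₀ :=
    LaceRec.mul_beta_le (by omega) hL1 hb₀ (by linarith)
  have q2 : 8 * Γ * LaceRec.beta d L ≤ α :=
    LaceRec.mul_beta_le (by omega) hL1 hα0 (by linarith)
  have q3 : Γ * LaceRec.beta d L * LaceRec.zetaBound d * 2 ^ ((d : ℝ) / 2) ≤ 1 / 2 := by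
    have := LaceRec.mul_beta_le (d := d) (X := W) (by omega) hL1 (by norm_num : (0 : ℝ) < 1 / 2)
      (by linarith)
    rw [hW] at this
    linarith
  have q4 : Γ * LaceRec.beta d L * LaceRec.zetaBound d ≤ 1 / 2 :=
    le_trans (le_mul_of_one_le_right (by positivity)
      (Real.one_le_rpow (by norm_num) (by linarith))) q3
  have hF' : ∀ (z : ℝ) (N : ℕ), LaceRec.Controlled (8 * Γ * LaceRec.beta d L) D g e N z → 1 ≤ N →
      ∀ m ≤ N, 1 ≤ m → LaceRec.FBounds L D f K m z := fun z N hc hN m hm hm1 =>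
    hF ε c₂ L _ z D f g e N hr hS hD hc (by positivity) q1 hN hL0 m hm hm1
  have hind := LaceRec.induction_bounds hd hε hr hS hD hE hG hK hLK hL0 hΓ1 hCe hCg q1 hb₀4 q2 q3
    hF'
  obtain ⟨zc, hzc, hctrl, hcrit⟩ := LaceRec.exists_criticalValue (g := g) (e := e) (D := D) hd
    (κ := 2 * Γ * LaceRec.beta d L) (by positivity) (fun n hn => (hind n hn).2.2.1)
    (fun n hn => (hind n hn).2.2.2)
  refine ⟨zc, hzc, fun pc χ hpc hχ hdiv hEG => ?_⟩
  have hzpos : 0 < zc := by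
    have := ((hctrl 1 le_rfl).z_pos (q1.trans hb₀4)).1
    linarith
  exact LaceRec.criticalValue_eq hd hr hD hL0 (by linarith) hCe hCg q4 hzpos hcrit
    (hEG K hK hLK fun m hm => hF' zc m (hctrl m hm) hm m le_rfl hm) hpc hχ hdiv
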